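/- Write $[z]=z-z^{-1}$, and for $N\ge 1$ let $n=\lfloor N/2\rfloor$, $\bar n=\lceil N/2\rceil$. Let $q\in\mathbb C\setminus\{0,1,-1\}$, $\tau=-q-q^{-1}$, and let $\beta\in\mathbb C\setminus\{0\}$ with $[\beta]\neq 0$. Let $V=\mathbb C^2$ with canonical basis $|{\uparrow}\rangle,|{\downarrow}\rangle$. For integers $1\le a_1<\dots<a_n\le N$ and generic complex numbers $z_1,\dots,z_N$ define $$(\Psi_N)_{a_1,\dots,a_n}(z_1,\dots,z_N)=(-[q])^n\prod_{1\le i<j\le N}[qz_j/z_i][q^2z_iz_j]\oint\cdots\oint\prod_{\ell=1}^n\frac{\mathrm dw_\ell}{\pi\mathrm i\, w_\ell}\;\Xi_{a_1,\dots,a_n}(w_1,\dots,w_n|z_1,\dots,z_N),$$ $$\Xi_{a_1,\dots,a_n}=\frac{\prod_{1\le i<j\le n}[qw_j/w_i][w_i/w_j][qw_iw_j]\prod_{1\le i\le j\le n}[q^2w_iw_j]\prod_{i=1}^n[\beta w_i]}{\prod_{i=1}^n\Bigl(\prod_{j=1}^{a_i}[z_j/w_i]\prod_{j=a_i}^N[qz_j/w_i]\prod_{j=1}^N[q^2w_iz_j]\Bigr)},$$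 where the contour of each $w_i$ is a collection of positively oriented curves surrounding the poles $w_i=z_j$, $j=1,\dots,N$, but none of the points $0,-z_j,\pm qz_j,\pm q^{-2}z_j^{-1}$. Here generic means that no $z_j$ equals $0$, a $z_k$ with $k\neq j$, or any of $-z_k,\pm qz_k,\pm q^{-2}z_k^{-1}$ ($1\le k\le N$). Let $|\Psi_N(z_1,\dots,z_N)\rangle\in V^{\otimes N}$ be the vector $\sum_{a_1<\dots<a_n}(\Psi_N)_{a_1,\dots,a_n}\,|\cdots\rangle$, where the basis vector multiplying $(\Psi_N)_{a_1,\dots,a_n}$ has down spins exactly at the sites $a_1,\dots,a_n$ (for $N=1$ it is $|{\uparrow}\rangle$). The homogeneous vector is $$|\psi_N\rangle=(-1)^{\bar n(\bar n-1)/2}[\beta]^{-n}[q]^{-n(n-1)-\bar n(\bar n-1)}\,|\Psi_N(1,\dots,1)\rangle,$$ where $|\Psi_N(1,\dots,1)\rangle$ is the limit of $|\Psi_N(z_1,\dots,z_N)\rangle$ as generic $z_1,\dots,z_N$ tend to $1$. Its dependence on $\beta$ is written through the parameter $x=-[q\beta]/[\beta]$, as $|\psi_N\rangle=|\psi_N(x)\rangle$.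 **Proposition.** For every $N\ge 2$ and every $q\in\mathbb C\setminus\{0,1,-1\}$, the limits defining $|\psi_N(0)\rangle$ and $|\psi_{N-1}(\tau)\rangle$ exist (for every choice of $\beta$ representing $x=0$, respectively $x=\tau$), and $$|\psi_N(0)\rangle=\bigl(\mathcal R\,|\psi_{N-1}(\tau)\rangle\bigr)\otimes|{\uparrow}\rangle ,$$ where $\mathcal R=\prod_{i=1}^{N-1}\sigma_i^x$ is the spin-reversal operator on $V^{\otimes(N-1)}$. -/

import Mathlib

open Filter Topology

noncomputable section

namespace XXZ

/-- The shorthand `[z] = z - z⁻¹`. -/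
def br (z : ℂ) : ℂ := z - z⁻¹

/-- The parameter `τ = -q - q⁻¹`. -/
def tau (q : ℂ) : ℂ := -q - q⁻¹

/-- The number `⌊N/2⌋` of down spins. -/
abbrev nDown (N : ℕ) : ℕ := N / 2

/-- The number `⌈N/2⌉` of up spins. -/
abbrev nUp (N : ℕ) : ℕ := (N + 1) / 2

/-! Spins and vectors. The basis of `V = ℂ²` is indexed by `Fin 2`, with `0` for the up spin and
`1` for the down spin; a vector of `V^N = V ⊗ ⋯ ⊗ V` is given by its components along the
canonical basis, indexed by the spin configurations `Fin N → Fin 2`. -/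

/-- The index of the up spin. -/
abbrev up : Fin 2 := 0

/-- The index of the down spin. -/
abbrev down : Fin 2 := 1

/-- The space `V^N`. -/
abbrev Vec (N : ℕ) : Type := (Fin N → Fin 2) → ℂ

/-- The canonical basis vector labelled by the spin configuration `s`. -/
def ket {N : ℕ} (s : Fin N → Fin 2) : Vec N := Pi.single s 1

/-- The vector of `V` for the up spin. -/
def ketUp : Fin 2 → ℂ := Pi.single up 1

/-- The tensor product of a vector of `V^N` with a vector of `V`, placed at the last site. -/
def tmulLast {N : ℕ} (v : Vec N) (w : Fin 2 → ℂ) : Vec (N + 1) :=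
  fun s => v (Fin.init s) * w (s (Fin.last N))

/-- The Pauli matrix `σˣ`. -/
def sigmaX : Matrix (Fin 2) (Fin 2) ℂ := !![0, 1; 1, 0]

/-- The spin reversal operator `∏ᵢ σᵢˣ = σˣ ⊗ ⋯ ⊗ σˣ` on `V^N`. -/
def spinReversal (N : ℕ) : Matrix (Fin N → Fin 2) (Fin N → Fin 2) ℂ :=
  Matrix.of fun s t => ∏ i, sigmaX (s i) (t i)

open Classical in
/-- The spin configuration whose down spins are at the sites `a k`. -/
def config {n N : ℕ} (a : Fin n → Fin N) : Fin N → Fin 2 :=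
  fun i => if ∃ k, a k = i then down else up

/-! The multiple contour integrals. -/

/-- The integrand `Ξ_{a₁,…,aₙ}(w₁,…,wₙ | z₁,…,z_N)`. -/
def Xi {n N : ℕ} (q β : ℂ) (a : Fin n → Fin N) (z : Fin N → ℂ) (w : Fin n → ℂ) : ℂ :=
  ((∏ i, ∏ j ∈ Finset.Ioi i, br (q * w j / w i) * br (w i / w j) * br (q * w i * w j)) *
      (∏ i, ∏ j ∈ Finset.Ici i, br (q ^ 2 * w i * w j)) * ∏ i, br (β * w i)) /
    ∏ i, ((∏ j ∈ Finset.Iic (a i), br (z j / w i)) * (∏ j ∈ Finset.Ici (a i), br (q * z j / w i)) *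
      ∏ j, br (q ^ 2 * w i * z j))

/-- The points other than `z j` at which the integrand, as a function of one of the variables
`w`, may be singular: `0`, the `z k` with `k ≠ j`, and all of `-z k`, `± q z k`, `± q⁻² (z k)⁻¹`. -/
def otherSing {N : ℕ} (q : ℂ) (z : Fin N → ℂ) (j : Fin N) : Set ℂ :=
  {u | u = 0 ∨ (∃ k, k ≠ j ∧ u = z k) ∨
    ∃ k, u = -z k ∨ u = q * z k ∨ u = -(q * z k) ∨
      u = (q ^ 2 * z k)⁻¹ ∨ u = -(q ^ 2 * z k)⁻¹}

/-- Generic `z`: no `z j` coincides with another possible singularity. In particular the `z j`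
are distinct and non-zero. -/
def Generic {N : ℕ} (q : ℂ) (z : Fin N → ℂ) : Prop := ∀ j, z j ∉ otherSing q z j

/-- Half of the distance from `z j` to the other possible singularities. For generic `z`, the
circles of these radii around the points `z j` are a collection of positively oriented curves that
surround the poles `z j` and none of the other singularities. -/
def radius {N : ℕ} (q : ℂ) (z : Fin N → ℂ) (j : Fin N) : ℝ :=
  Metric.infDist (z j) (otherSing q z j) / 2

/-- The multiple contour integral `∮ ⋯ ∮ ∏ dw_ℓ / (π i w_ℓ) Ξ`, where each `w_ℓ` runs over the
circles around all the `z j`: it is the sum, over all the ways `c` of choosing one of the circles for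
each variable, of integrals over products of circles. -/
def contourIntegral {n N : ℕ} (q β : ℂ) (a : Fin n → Fin N) (z : Fin N → ℂ) : ℂ :=
  ∑ c : Fin n → Fin N,
    torusIntegral (fun w => (∏ l, (Real.pi * Complex.I * w l)⁻¹) * Xi q β a z w)
      (fun l => z (c l)) (fun l => radius q z (c l))

/-- The component `(Ψ_N)_{a₁,…,aₙ}(z₁,…,z_N)`. -/
def PsiComp {N : ℕ} (q β : ℂ) (a : Fin (nDown N) → Fin N) (z : Fin N → ℂ) : ℂ :=
  (-br q) ^ nDown N *
    (∏ i, ∏ j ∈ Finset.Ioi i, br (q * z j / z i) * br (q ^ 2 * z i * z j)) *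
    contourIntegral q β a z

open Classical in
/-- The vector `|Ψ_N(z₁,…,z_N)⟩`, for generic `z`. -/
def Psi {N : ℕ} (q β : ℂ) (z : Fin N → ℂ) : Vec N :=
  ∑ a : Fin (nDown N) → Fin N with StrictMono a, PsiComp q β a z • ket (config a)

/-- The normalisation factor `(-1)^{n̄(n̄-1)/2} [β]^{-n} [q]^{-n(n-1)-n̄(n̄-1)}`. -/
def normFactor (N : ℕ) (q β : ℂ) : ℂ :=
  (-1) ^ (nUp N * (nUp N - 1) / 2) * (br β ^ nDown N)⁻¹ *
    (br q ^ (nDown N * (nDown N - 1) + nUp N * (nUp N - 1)))⁻¹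

/-- `v` is the rescaled homogeneous limit of `|Ψ_N⟩`: the limit as the generic `z₁,…,z_N` tend to
`1`. -/
def IsHomLimit (N : ℕ) (q β : ℂ) (v : Vec N) : Prop :=
  Tendsto (fun z : Fin N → ℂ => normFactor N q β • Psi q β z)
    (𝓝[{z | Generic q z}] (fun _ => 1)) (𝓝 v)

/-- The homogeneous vector `|ψ_N⟩`, normalised `|Ψ_N(1,…,1)⟩`, in terms of `q` and `β`. -/
def psi (N : ℕ) (q β : ℂ) : Vec N :=
  limUnder (𝓝[{z : Fin N → ℂ | Generic q z}] (fun _ => 1))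
    (fun z => normFactor N q β • Psi q β z)

/-- `β` represents the value `x` of the boundary parameter: `x = -[qβ]/[β]`, where `β` is non-zero
and `[β] ≠ 0`. -/
def Represents (q β x : ℂ) : Prop := β ≠ 0 ∧ br β ≠ 0 ∧ x = -br (q * β) / br β

end XXZ

end

noncomputable section

namespace XXZ

/-! ### Cauchy's formula on a polydisc -/

/-! The relation already holds for distinct parameters z_j, once β is tied to the last parameter;
the homogeneous statement is its limit. Put X(w) = q²w² + q⁻²w⁻² (`xf`). Since [z/w][q²wz] = X(z) -
X(w), and the poles at the z_j are simple, the contour integrals become sums over the nodes X(z_j)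
with Lagrange denominators (`contourIntegral_eq`, `resSum`). The last integration variable interacts
with the others through a polynomial in X, so interpolation theory carries out its sum.

Take N+1 sites and β = (q z_{N+1})⁻¹. Components with a down spin at the last site vanish by a
degree count (`Phi_eq_zero_of_last`). A component with down spins at A, not containing the last
site, is an explicit multiple of the N-site component with down spins at the complement of A and
boundary parameter q z_{N+1} (`Phi_castSucc_comp_eq`). When A fills the leftmost sites both sides
factorise: one by triangularity (`Phi_castAdd`), the other, with its down spins rightmost, by the
evaluation `Phi_natAdd`. The remaining A follow from the exchange relation `Phi_exchange`: moving a
down spin of A to the right moves a down spin of the complement to the left, and the two moves are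
inverse to each other.

The evaluation behind `Phi_natAdd` is an interpolation argument for n up spins x followed by m down
spins y. Up to a power of β, the sum is a polynomial in β² with known zeros (qy_l)⁻². One further
value, at β = x_0⁻¹, fixes it, and there the first up spin drops out (`downSum_remove_up`). What
remains is interpolated in a variable t put in place of x_0, at the points t = q y_l, where a down
spin drops out as well (`downSum_fusion`). This gives a recursion along the cases n = m and n = m+1.

For the limit, the exchange relation is rewritten as a divided difference, so that every component
extends to a function continuous jointly in z and β at the homogeneous point
(`exists_mem_regAlg_Phi_eq`). As z → 1 the two boundary parameters tend to q⁻¹ and q, which up to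
sign are the values representing x = 0 and x = τ; the sign does not matter after normalisation
(`psi_neg`). -/

theorem torusIntegral_prod_sub_inv_mul {n : ℕ} (H : (Fin n → ℂ) → ℂ) (c : Fin n → ℂ)
    (R : Fin n → ℝ) (hR : ∀ i, 0 < R i)
    (hH : ∀ w : Fin n → ℂ, (∀ i, w i ∈ Metric.closedBall (c i) (R i)) → DifferentiableAt ℂ H w) :
    torusIntegral (fun w => (∏ i, (w i - c i)⁻¹) * H w) c R =
      (2 * Real.pi * Complex.I) ^ n * H c := by
  induction n with
  | zero => simp
  | succ n ih =>
    have hmem : ∀ θ : Fin (n + 1) → ℝ, ∀ i,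
        torusMap c R θ i ∈ Metric.closedBall (c i) (R i) := by
      intro θ i
      simp [torusMap, Complex.norm_exp_ofReal_mul_I, abs_of_pos (hR i)]
    have hint : TorusIntegrable (fun w => (∏ i, (w i - c i)⁻¹) * H w) c R := by
      have hcont : Continuous (torusMap c R) := by unfold torusMap; fun_prop
      refine (ContinuousOn.integrableOn_compact isCompact_Icc ?_)
      refine Continuous.continuousOn ?_
      refine Continuous.mul ?_ ?_
      · refine continuous_finsetProd _ fun i _ => ?_
        refine Continuous.inv₀ (by fun_prop) fun θ => ?_
        simp [torusMap, (hR i).ne', Complex.exp_ne_zero]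
      · refine continuous_iff_continuousAt.2 fun θ => ?_
        exact ContinuousAt.comp (hH _ (hmem θ)).continuousAt hcont.continuousAt
    rw [torusIntegral_succ hint]
    -- With the first variable frozen on its circle, the induction hypothesis evaluates the other
    -- integrals; the one-variable Cauchy formula finishes.
    have key : ∀ x ∈ Metric.sphere (c 0) (R 0),
        torusIntegral (fun y => (∏ i, ((Fin.cons x y : Fin (n + 1) → ℂ) i - c i)⁻¹) *
          H (Fin.cons x y)) (c ∘ Fin.succ) (R ∘ Fin.succ) =
        (x - c 0)⁻¹ • ((2 * Real.pi * Complex.I) ^ n * H (Fin.cons x (c ∘ Fin.succ))) := by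
      intro x hx
      simp only [Fin.prod_univ_succ, Fin.cons_zero, Fin.cons_succ, mul_assoc]
      rw [torusIntegral_const_mul, smul_eq_mul]
      congr 1
      have := ih (fun y => H (Fin.cons x y)) (c ∘ Fin.succ) (R ∘ Fin.succ) (fun i => hR _) ?_
      · simpa [mul_assoc] using this
      · intro w hw
        refine DifferentiableAt.comp (f := fun y : Fin n → ℂ => (Fin.cons x y : Fin (n + 1) → ℂ))
          w (hH _ ?_) ?_
        · refine Fin.cases ?_ ?_
          · simpa using Metric.sphere_subset_closedBall hx
          · intro i; simpa using hw i
        · refine differentiableAt_pi.2 (Fin.cases ?_ ?_)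
          · simp
          · intro i; simp only [Fin.cons_succ]; fun_prop
    rw [circleIntegral.integral_congr (hR 0).le key]
    have hd : DiffContOnCl ℂ
        (fun x => (2 * Real.pi * Complex.I) ^ n * H (Fin.cons x (c ∘ Fin.succ)))
        (Metric.ball (c 0) (R 0)) := by
      refine DifferentiableOn.diffContOnCl ?_
      rw [closure_ball _ (hR 0).ne']
      intro x hx
      refine DifferentiableAt.differentiableWithinAt (DifferentiableAt.const_mul ?_ _)
      refine DifferentiableAt.comp (f := fun x : ℂ =>
          (Fin.cons x (c ∘ Fin.succ) : Fin (n + 1) → ℂ)) x (hH _ ?_) ?_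
      · refine Fin.cases ?_ ?_
        · simpa using hx
        · intro i; simpa using (hR _).le
      · refine differentiableAt_pi.2 (Fin.cases ?_ ?_)
        · simp
        · intro i; simp
    rw [hd.circleIntegral_sub_inv_smul (Metric.mem_ball_self (hR 0)), smul_eq_mul]
    have : (Fin.cons (c 0) (c ∘ Fin.succ) : Fin (n + 1) → ℂ) = c := Fin.cons_self_tail c
    rw [this, pow_succ]
    ring

/-! ### The sum over residues -/

/-- The function `q²z² + q⁻²z⁻²`. -/
def xf (q z : ℂ) : ℂ := q ^ 2 * z ^ 2 + (q ^ 2 * z ^ 2)⁻¹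

/-- The function `z² + z⁻²`. -/
def uf (z : ℂ) : ℂ := z ^ 2 + (z ^ 2)⁻¹

theorem br_mul_br_eq_xf_sub_xf {q z w : ℂ} (hq : q ≠ 0) (hz : z ≠ 0) (hw : w ≠ 0) :
    br (z / w) * br (q ^ 2 * w * z) = xf q z - xf q w := by
  unfold br xf; field_simp; ring

theorem br_mul_br_eq_xf_sub_uf {q x w : ℂ} (hq : q ≠ 0) (hx : x ≠ 0) (hw : w ≠ 0) :
    br (q * x / w) * br (q * w * x) = xf q x - uf w := by
  unfold br xf uf; field_simp; ring

theorem br_inv (z : ℂ) : br z⁻¹ = -br z := by unfold br; simp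

theorem br_neg (z : ℂ) : br (-z) = -br z := by
  unfold br; rw [inv_neg]; ring

theorem br_div_comm (z w : ℂ) : br (z / w) = -br (w / z) := by rw [← br_inv, inv_div]

theorem br_one : br 1 = 0 := by simp [br]

theorem br_eq_zero_iff {z : ℂ} : br z = 0 ↔ z = 0 ∨ z = 1 ∨ z = -1 := by
  unfold br
  rcases eq_or_ne z 0 with rfl | hz
  · simp
  · rw [← sq_eq_one_iff, sub_eq_zero, ← mul_eq_one_iff_eq_inv₀ hz, sq]
    simp [hz]

/-- The product of `f i j` over the pairs `i < j`. -/
def pairProd {n : ℕ} (f : Fin n → Fin n → ℂ) : ℂ := ∏ i, ∏ j, if i < j then f i j else 1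

theorem prod_Ioi_eq_pairProd {n : ℕ} (f : Fin n → Fin n → ℂ) :
    ∏ i, ∏ j ∈ Finset.Ioi i, f i j = pairProd f := by
  unfold pairProd
  refine Finset.prod_congr rfl fun i _ => ?_
  rw [← Finset.prod_filter]
  congr 1
  ext j; simp

theorem pairProd_mul {n : ℕ} (f g : Fin n → Fin n → ℂ) :
    pairProd (fun i j => f i j * g i j) = pairProd f * pairProd g := by
  simp only [pairProd, ← Finset.prod_mul_distrib]
  refine Finset.prod_congr rfl fun i _ => Finset.prod_congr rfl fun j _ => ?_
  split_ifs <;> simp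

/-- The pair interaction of the integration variables. -/
def vdm {n : ℕ} (q : ℂ) (w : Fin n → ℂ) : ℂ :=
  pairProd fun k l => (xf q (w k) - xf q (w l)) * (xf q (w l) - uf (w k))

section
variable {ι : Type*} [Fintype ι] [DecidableEq ι]

/-- The derivative factor at the node `c`. -/
def mu (q : ℂ) (z : ι → ℂ) (c : ι) : ℂ := ∏ j ∈ Finset.univ.erase c, (xf q (z j) - xf q (z c))

/-- The sum over all choices of one node for each integration variable. -/
def resSum {n : ℕ} (q : ℂ) (z : ι → ℂ) (g : Fin n → ι → ℂ) : ℂ :=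
  ∑ c : Fin n → ι, (∏ k, (mu q z (c k))⁻¹ * g k (c k)) * vdm q (z ∘ c)

end

/-- The one-variable factor attached to the position `a`. -/
def phi {N : ℕ} (q : ℂ) (z : Fin N → ℂ) (a : Fin N) (w : ℂ) : ℂ :=
  (∏ j ∈ Finset.Ioi a, br (z j / w)) / ∏ j ∈ Finset.Ici a, br (q * z j / w)

/-- The product in front of the integrals. -/
def pref {N : ℕ} (q : ℂ) (z : Fin N → ℂ) : ℂ :=
  pairProd fun i j => br (q * z j / z i) * br (q ^ 2 * z i * z j)

/-- The component attached to the positions `a`, as a sum over residues. -/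
def Phi {n N : ℕ} (q β : ℂ) (z : Fin N → ℂ) (a : Fin n → Fin N) : ℂ :=
  br q ^ n * pref q z * resSum q z fun k s => phi q z (a k) (z s) * br (β * z s)

/-- No factor in a denominator of the sum over residues vanishes. -/
structure Good {ι : Type*} (q : ℂ) (z : ι → ℂ) : Prop where
  ne_zero : ∀ i, z i ≠ 0
  br_div : ∀ i j, i ≠ j → br (z i / z j) ≠ 0
  br_mul : ∀ i j, br (q ^ 2 * z i * z j) ≠ 0
  br_q_div : ∀ i j, br (q * z i / z j) ≠ 0

theorem Good.comp {ι κ : Type*} {q : ℂ} {z : ι → ℂ} (h : Good q z) {f : κ → ι}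
    (hf : Function.Injective f) : Good q (z ∘ f) :=
  ⟨fun _ => h.1 _, fun _ _ hij => h.2 _ _ (hf.ne hij), fun _ _ => h.3 _ _, fun _ _ => h.4 _ _⟩

theorem Good.q_ne_zero {ι : Type*} {q : ℂ} {z : ι → ℂ} (h : Good q z) (i : ι) : q ≠ 0 := by
  rintro rfl
  exact h.4 i i (by simp [br])

theorem Good.br_q {ι : Type*} {q : ℂ} {z : ι → ℂ} (h : Good q z) (i : ι) : br q ≠ 0 := by
  have := h.4 i i
  rwa [mul_div_assoc, div_self (h.1 i), mul_one] at this

theorem Good.xf_ne {ι : Type*} {q : ℂ} {z : ι → ℂ} (h : Good q z) {i j : ι} (hij : i ≠ j) :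
    xf q (z i) - xf q (z j) ≠ 0 := by
  rw [← br_mul_br_eq_xf_sub_xf (h.q_ne_zero i) (h.1 i) (h.1 j)]
  exact mul_ne_zero (h.2 _ _ hij) (h.3 _ _)

/-! ### Evaluation of the contour integrals -/

section
variable {N : ℕ} {q : ℂ} {z : Fin N → ℂ}

theorem Generic.good (h : Generic q z) (hq : q ≠ 0) : Good q z := by
  have hne : ∀ i, z i ≠ 0 := fun i hi => h i (Or.inl hi)
  refine ⟨hne, fun i j hij => ?_, fun i j => ?_, fun i j => ?_⟩ <;>
    rw [Ne, br_eq_zero_iff, not_or, not_or]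
  · refine ⟨div_ne_zero (hne i) (hne j), fun h1 => h i (Or.inr (Or.inl ⟨j, hij.symm, ?_⟩)),
      fun h1 => h i (Or.inr (Or.inr ⟨j, Or.inl ?_⟩))⟩
    · rwa [div_eq_one_iff_eq (hne j)] at h1
    · rw [div_eq_iff (hne j)] at h1; rw [h1]; ring
  · have h0 : q ^ 2 * z i ≠ 0 := mul_ne_zero (pow_ne_zero _ hq) (hne i)
    refine ⟨mul_ne_zero h0 (hne j), fun h1 => h j (Or.inr (Or.inr ⟨i, ?_⟩)),
      fun h1 => h j (Or.inr (Or.inr ⟨i, ?_⟩))⟩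
    · exact Or.inr (Or.inr (Or.inr (Or.inl (eq_inv_of_mul_eq_one_right h1))))
    · refine Or.inr (Or.inr (Or.inr (Or.inr ?_)))
      rw [← neg_eq_iff_eq_neg]
      exact eq_inv_of_mul_eq_one_right (by rw [mul_neg, h1, neg_neg])
  · refine ⟨div_ne_zero (mul_ne_zero hq (hne i)) (hne j),
      fun h1 => h j (Or.inr (Or.inr ⟨i, Or.inr (Or.inl ?_)⟩)),
      fun h1 => h j (Or.inr (Or.inr ⟨i, Or.inr (Or.inr (Or.inl ?_))⟩))⟩
    · rw [div_eq_one_iff_eq (hne j)] at h1; exact h1.symm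
    · rw [div_eq_iff (hne j)] at h1; rw [h1]; ring

theorem isClosed_otherSing (j : Fin N) : IsClosed (otherSing q z j) := by
  have : otherSing q z j = {0} ∪ ((⋃ k, ⋃ (_ : k ≠ j), {z k}) ∪
      ⋃ k, {-z k, q * z k, -(q * z k), (q ^ 2 * z k)⁻¹, -(q ^ 2 * z k)⁻¹}) := by
    ext u; simp [otherSing]
  rw [this]
  refine Set.Finite.isClosed (Set.Finite.union (Set.finite_singleton _) (Set.Finite.union ?_ ?_))
  · exact Set.finite_iUnion fun k => Set.finite_iUnion fun _ => Set.finite_singleton _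
  · exact Set.finite_iUnion fun k => Set.toFinite _

theorem Generic.infDist_pos (h : Generic q z) (j : Fin N) :
    0 < Metric.infDist (z j) (otherSing q z j) :=
  ((isClosed_otherSing j).notMem_iff_infDist_pos ⟨0, Or.inl rfl⟩).1 (h j)

theorem Generic.radius_pos (h : Generic q z) (j : Fin N) : 0 < radius q z j :=
  half_pos (h.infDist_pos j)

theorem Generic.notMem_otherSing (h : Generic q z) {j : Fin N} {u : ℂ}
    (hu : u ∈ Metric.closedBall (z j) (radius q z j)) : u ∉ otherSing q z j := by
  intro hmem
  have h1 := Metric.infDist_le_dist_of_mem (x := z j) hmem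
  rw [Metric.mem_closedBall, dist_comm] at hu
  have := h.infDist_pos j
  unfold radius at hu
  linarith

theorem br_ne_of_notMem_otherSing (hq : q ≠ 0) (hz : ∀ i, z i ≠ 0) {j : Fin N} {u : ℂ}
    (hu : u ∉ otherSing q z j) :
    u ≠ 0 ∧ u + z j ≠ 0 ∧ (∀ k, k ≠ j → br (z k / u) ≠ 0) ∧ (∀ k, br (q * z k / u) ≠ 0) ∧
      ∀ k, br (q ^ 2 * u * z k) ≠ 0 := by
  have hu0 : u ≠ 0 := fun hi => hu (Or.inl hi)
  refine ⟨hu0, fun h1 => hu (Or.inr (Or.inr ⟨j, Or.inl (eq_neg_of_add_eq_zero_left h1)⟩)),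
    fun k hk => ?_, fun k => ?_, fun k => ?_⟩ <;>
    rw [Ne, br_eq_zero_iff, not_or, not_or]
  · refine ⟨div_ne_zero (hz k) hu0, fun h1 => hu (Or.inr (Or.inl ⟨k, hk, ?_⟩)),
      fun h1 => hu (Or.inr (Or.inr ⟨k, Or.inl ?_⟩))⟩
    · rw [div_eq_one_iff_eq hu0] at h1; exact h1.symm
    · rw [div_eq_iff hu0] at h1; rw [h1]; ring
  · refine ⟨div_ne_zero (mul_ne_zero hq (hz k)) hu0,
      fun h1 => hu (Or.inr (Or.inr ⟨k, Or.inr (Or.inl ?_)⟩)),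
      fun h1 => hu (Or.inr (Or.inr ⟨k, Or.inr (Or.inr (Or.inl ?_))⟩))⟩
    · rw [div_eq_one_iff_eq hu0] at h1; exact h1.symm
    · rw [div_eq_iff hu0] at h1; rw [h1]; ring
  · have h0 : q ^ 2 * z k ≠ 0 := mul_ne_zero (pow_ne_zero _ hq) (hz k)
    rw [mul_right_comm]
    refine ⟨mul_ne_zero h0 hu0, fun h1 => hu (Or.inr (Or.inr ⟨k, ?_⟩)),
      fun h1 => hu (Or.inr (Or.inr ⟨k, ?_⟩))⟩
    · exact Or.inr (Or.inr (Or.inr (Or.inl (eq_inv_of_mul_eq_one_right h1))))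
    · refine Or.inr (Or.inr (Or.inr (Or.inr ?_)))
      rw [← neg_eq_iff_eq_neg]
      exact eq_inv_of_mul_eq_one_right (by rw [mul_neg, h1, neg_neg])

/-- The numerator of the integrand. -/
def xiNum {n : ℕ} (q β : ℂ) (w : Fin n → ℂ) : ℂ :=
  (∏ i, ∏ j ∈ Finset.Ioi i, br (q * w j / w i) * br (w i / w j) * br (q * w i * w j)) *
    (∏ i, ∏ j ∈ Finset.Ici i, br (q ^ 2 * w i * w j)) * ∏ i, br (β * w i)

/-- The one-variable factor of the integrand, multiplied by `w - z c`. -/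
def regFactor (q : ℂ) (z : Fin N → ℂ) (a c : Fin N) (w : ℂ) : ℂ :=
  -(z c / (Real.pi * Complex.I * (w + z c))) * ((∏ j ∈ Finset.Ioi a, br (z j / w)) /
    ((∏ j ∈ Finset.univ.erase c, br (z j / w)) * (∏ j ∈ Finset.Ici a, br (q * z j / w)) *
      ∏ j, br (q ^ 2 * w * z j)))

/-- Pairing [w_i/w_j] with [q²w_iw_j], and [qw_j/w_i] with [qw_iw_j], turns the interaction into
differences of `xf` and `uf`; of the [q²w_iw_j] only the diagonal ones stay outside. -/
theorem xiNum_eq {n : ℕ} {β : ℂ} (hq : q ≠ 0) {w : Fin n → ℂ} (hw : ∀ i, w i ≠ 0) :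
    xiNum q β w = vdm q w * ∏ i, (br (q ^ 2 * w i * w i) * br (β * w i)) := by
  have h1 : ∀ i, ∏ j ∈ Finset.Ici i, br (q ^ 2 * w i * w j) =
      br (q ^ 2 * w i * w i) * ∏ j ∈ Finset.Ioi i, br (q ^ 2 * w i * w j) := by
    intro i
    rw [← Finset.Ioi_insert, Finset.prod_insert (by simp)]
  have h2 : vdm q w = ∏ i, ∏ j ∈ Finset.Ioi i, (br (q * w j / w i) * br (w i / w j) *
      br (q * w i * w j) * br (q ^ 2 * w i * w j)) := by
    rw [vdm, prod_Ioi_eq_pairProd]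
    congr 1
    ext i j
    rw [← br_mul_br_eq_xf_sub_xf hq (hw i) (hw j), ← br_mul_br_eq_xf_sub_uf hq (hw j) (hw i)]
    rw [mul_right_comm (q ^ 2) (w j)]
    ring
  simp only [xiNum, h1, h2, Finset.prod_mul_distrib]
  ring

theorem integrand_eq {n : ℕ} {β : ℂ} {a : Fin n → Fin N} {c : Fin n → Fin N} {w : Fin n → ℂ}
    (hq : q ≠ 0) (hz : ∀ i, z i ≠ 0) (hw : ∀ k, w k ∉ otherSing q z (c k))
    (hwc : ∀ k, w k ≠ z (c k)) :
    (∏ l, (Real.pi * Complex.I * w l)⁻¹) * Xi q β a z w =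
      (∏ k, (w k - z (c k))⁻¹) * (xiNum q β w * ∏ k, regFactor q z (a k) (c k) (w k)) := by
  rw [Xi, ← xiNum, div_eq_mul_inv, ← Finset.prod_inv_distrib, mul_left_comm,
    ← Finset.prod_mul_distrib, mul_left_comm _ (xiNum q β w), ← Finset.prod_mul_distrib]
  congr 1
  refine Finset.prod_congr rfl fun k _ => ?_
  obtain ⟨h0, h1, h2, h3, h4⟩ := br_ne_of_notMem_otherSing hq hz (hw k)
  set u := w k
  -- The denominator over j ≤ a is completed to a product over all nodes. This is the origin of the
  -- numerator in `phi`, and it isolates the vanishing factor [z_c/u] whatever the position of c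
  -- relative to a.
  have e1 : (∏ j ∈ Finset.Iic (a k), br (z j / u)) * ∏ j ∈ Finset.Ioi (a k), br (z j / u) =
      br (z (c k) / u) * ∏ j ∈ Finset.univ.erase (c k), br (z j / u) := by
    rw [Finset.mul_prod_erase _ (fun j => br (z j / u)) (Finset.mem_univ _), ← Finset.prod_union]
    · congr 1
      ext j; simp [le_or_gt]
    · rw [Finset.disjoint_left]; intro j; simp
  have hsub : u - z (c k) ≠ 0 := sub_ne_zero.2 (hwc k)
  have e2 : br (z (c k) / u) = -((u - z (c k)) * (u + z (c k)) / (z (c k) * u)) := by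
    have := hz (c k)
    unfold br; field_simp; ring
  have h5 : br (z (c k) / u) ≠ 0 := by
    rw [e2]; exact neg_ne_zero.2 (div_ne_zero (mul_ne_zero hsub h1) (mul_ne_zero (hz _) h0))
  have h6 : (∏ j ∈ Finset.univ.erase (c k), br (z j / u)) ≠ 0 :=
    Finset.prod_ne_zero_iff.2 fun j hj => h2 j (Finset.ne_of_mem_erase hj)
  have h7 : (∏ j ∈ Finset.Ici (a k), br (q * z j / u)) ≠ 0 :=
    Finset.prod_ne_zero_iff.2 fun j _ => h3 j
  have h8 : (∏ j, br (q ^ 2 * u * z j)) ≠ 0 := Finset.prod_ne_zero_iff.2 fun j _ => h4 j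
  have h9 : (∏ j ∈ Finset.Iic (a k), br (z j / u)) ≠ 0 := by
    intro h
    rw [h, zero_mul] at e1
    exact mul_ne_zero h5 h6 e1.symm
  have hpi : (Real.pi : ℂ) ≠ 0 := by exact_mod_cast Real.pi_ne_zero
  unfold regFactor
  generalize (∏ j ∈ Finset.Ici (a k), br (q * z j / u)) = A at *
  generalize (∏ j, br (q ^ 2 * u * z j)) = B at *
  generalize (∏ j ∈ Finset.univ.erase (c k), br (z j / u)) = E at *
  generalize (∏ j ∈ Finset.Iic (a k), br (z j / u)) = F at *
  generalize (∏ j ∈ Finset.Ioi (a k), br (z j / u)) = G at *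
  rw [e2] at e1
  have hzc := hz (c k)
  have hI := Complex.I_ne_zero
  generalize Complex.I = I' at *
  field_simp
  field_simp at e1
  linear_combination e1

theorem differentiableAt_br_comp {E : Type*} [NormedAddCommGroup E] [NormedSpace ℂ E] {f : E → ℂ}
    {x : E} (hf : DifferentiableAt ℂ f x) (h : f x ≠ 0) :
    DifferentiableAt ℂ (fun y => br (f y)) x := by
  unfold br
  exact hf.sub (hf.inv h)

theorem differentiableAt_div_comp {E : Type*} [NormedAddCommGroup E] [NormedSpace ℂ E]
    {f g : E → ℂ} {x : E} (hf : DifferentiableAt ℂ f x) (hg : DifferentiableAt ℂ g x)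
    (h : g x ≠ 0) : DifferentiableAt ℂ (fun y => f y / g y) x := by
  simp only [div_eq_mul_inv]
  exact hf.mul (hg.inv h)

theorem differentiableAt_finset_prod {E κ : Type*} [NormedAddCommGroup E] [NormedSpace ℂ E]
    {s : Finset κ} {f : κ → E → ℂ} {x : E} (h : ∀ i ∈ s, DifferentiableAt ℂ (f i) x) :
    DifferentiableAt ℂ (fun y => ∏ i ∈ s, f i y) x := by
  classical
  have := HasFDerivAt.finsetProd (u := s) (g := f) fun i hi => (h i hi).hasFDerivAt
  exact this.differentiableAt

theorem differentiableAt_xiNum {n : ℕ} {β : ℂ} (hq : q ≠ 0) (hβ : β ≠ 0) {w : Fin n → ℂ}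
    (hw : ∀ i, w i ≠ 0) : DifferentiableAt ℂ (fun w => xiNum q β w) w := by
  have hd : ∀ i, DifferentiableAt ℂ (fun w : Fin n → ℂ => w i) w := fun i => by fun_prop
  unfold xiNum
  refine DifferentiableAt.mul (DifferentiableAt.mul ?_ ?_) ?_
  · refine differentiableAt_finset_prod fun i _ => differentiableAt_finset_prod
      fun j _ => ?_
    refine DifferentiableAt.mul (DifferentiableAt.mul ?_ ?_) ?_
    · exact differentiableAt_br_comp (differentiableAt_div_comp ((hd j).const_mul q) (hd i) (hw i))
        (div_ne_zero (mul_ne_zero hq (hw j)) (hw i))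
    · exact differentiableAt_br_comp (differentiableAt_div_comp (hd i) (hd j) (hw j)) (div_ne_zero (hw i) (hw j))
    · exact differentiableAt_br_comp (((hd i).const_mul q).mul (hd j))
        (mul_ne_zero (mul_ne_zero hq (hw i)) (hw j))
  · refine differentiableAt_finset_prod fun i _ => differentiableAt_finset_prod
      fun j _ => ?_
    exact differentiableAt_br_comp (((hd i).const_mul _).mul (hd j))
      (mul_ne_zero (mul_ne_zero (pow_ne_zero _ hq) (hw i)) (hw j))
  · refine differentiableAt_finset_prod fun i _ => ?_
    exact differentiableAt_br_comp ((hd i).const_mul _) (mul_ne_zero hβ (hw i))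

theorem differentiableAt_regFactor (hq : q ≠ 0) (hz : ∀ i, z i ≠ 0) {a c : Fin N} {u : ℂ}
    (hu : u ∉ otherSing q z c) : DifferentiableAt ℂ (regFactor q z a c) u := by
  obtain ⟨h0, h1, h2, h3, h4⟩ := br_ne_of_notMem_otherSing hq hz hu
  have hpi : (Real.pi : ℂ) ≠ 0 := by exact_mod_cast Real.pi_ne_zero
  have hid : DifferentiableAt ℂ (fun w : ℂ => w) u := differentiableAt_id
  have hdiv : ∀ x : ℂ, x ≠ 0 → DifferentiableAt ℂ (fun w => br (x / w)) u := fun x hx =>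
    differentiableAt_br_comp ((differentiableAt_const x).div hid h0) (div_ne_zero hx h0)
  unfold regFactor
  refine DifferentiableAt.mul (DifferentiableAt.neg ?_) (DifferentiableAt.div ?_ ?_ ?_)
  · exact (differentiableAt_const _).div ((hid.add_const _).const_mul _)
      (mul_ne_zero (mul_ne_zero hpi Complex.I_ne_zero) h1)
  · exact differentiableAt_finset_prod fun j _ => hdiv _ (hz j)
  · refine DifferentiableAt.mul (DifferentiableAt.mul ?_ ?_) ?_
    · exact differentiableAt_finset_prod fun j _ => hdiv _ (hz j)
    · exact differentiableAt_finset_prod fun j _ => hdiv _ (mul_ne_zero hq (hz j))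
    · refine differentiableAt_finset_prod fun j _ => ?_
      exact differentiableAt_br_comp ((hid.const_mul _).mul_const _)
        (mul_ne_zero (mul_ne_zero (pow_ne_zero _ hq) h0) (hz j))
  · exact mul_ne_zero (mul_ne_zero
      (Finset.prod_ne_zero_iff.2 fun j hj => h2 j (Finset.ne_of_mem_erase hj))
      (Finset.prod_ne_zero_iff.2 fun j _ => h3 j)) (Finset.prod_ne_zero_iff.2 fun j _ => h4 j)

theorem mu_eq (h : Good q z) (c : Fin N) :
    mu q z c = (∏ j ∈ Finset.univ.erase c, br (z j / z c)) *
      ∏ j ∈ Finset.univ.erase c, br (q ^ 2 * z c * z j) := by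
  rw [mu, ← Finset.prod_mul_distrib]
  refine Finset.prod_congr rfl fun j _ => ?_
  rw [br_mul_br_eq_xf_sub_xf (h.q_ne_zero c) (h.1 _) (h.1 _)]

/-- The diagonal factor [q²w²] of the numerator cancels the j = c factor of ∏ [q²wz_j], leaving the
Lagrange denominator `mu`. The sign is 2πi · (-z_c)/(πi · 2z_c) = -1. -/
theorem regFactor_self (h : Good q z) (a c : Fin N) :
    2 * Real.pi * Complex.I * (regFactor q z a c (z c) * br (q ^ 2 * z c * z c)) =
      -((mu q z c)⁻¹ * phi q z a (z c)) := by
  have hpi : (Real.pi : ℂ) ≠ 0 := by exact_mod_cast Real.pi_ne_zero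
  have hzc := h.1 c
  have h4 := h.3 c c
  have h5 : (∏ j ∈ Finset.univ.erase c, br (z j / z c)) ≠ 0 :=
    Finset.prod_ne_zero_iff.2 fun j hj => h.2 j c (Finset.ne_of_mem_erase hj)
  have h6 : (∏ j ∈ Finset.univ.erase c, br (q ^ 2 * z c * z j)) ≠ 0 :=
    Finset.prod_ne_zero_iff.2 fun j hj => h.3 _ _
  have h7 : (∏ j ∈ Finset.Ici a, br (q * z j / z c)) ≠ 0 :=
    Finset.prod_ne_zero_iff.2 fun j _ => h.4 _ _
  rw [mu_eq h, regFactor, phi, ← Finset.mul_prod_erase _ (fun j => br (q ^ 2 * z c * z j))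
    (Finset.mem_univ c)]
  have hI := Complex.I_ne_zero
  generalize Complex.I = I' at *
  have h2z : z c + z c ≠ 0 := by rw [← two_mul]; exact mul_ne_zero two_ne_zero hzc
  have e : br (q ^ 2 * z c * z c) * (br (q ^ 2 * z c * z c))⁻¹ = 1 := mul_inv_cancel₀ h4
  generalize (∏ j ∈ Finset.Ici a, br (q * z j / z c)) = A at *
  generalize (∏ j ∈ Finset.univ.erase c, br (z j / z c)) = E at *
  generalize (∏ j ∈ Finset.univ.erase c, br (q ^ 2 * z c * z j)) = F at *
  generalize (∏ j ∈ Finset.Ioi a, br (z j / z c)) = G at *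
  generalize br (q ^ 2 * z c * z c) = B at *
  field_simp
  ring

/-- On the polydisc selected by c, the only singular factors are the simple poles at z_{c k}; each
variable contributes one sign from `regFactor_self`. -/
theorem contourIntegral_eq {n : ℕ} {β : ℂ} (h : Generic q z) (hq : q ≠ 0) (hβ : β ≠ 0)
    (a : Fin n → Fin N) :
    contourIntegral q β a z = (-1) ^ n *
      resSum q z fun k s => phi q z (a k) (z s) * br (β * z s) := by
  have hg := h.good hq
  rw [contourIntegral, resSum, Finset.mul_sum]
  refine Finset.sum_congr rfl fun c _ => ?_
  have hmem : ∀ θ : Fin n → ℝ, ∀ k, torusMap (fun l => z (c l)) (fun l => radius q z (c l)) θ k ∈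
      Metric.sphere (z (c k)) (radius q z (c k)) := by
    intro θ k
    simp [torusMap, Complex.norm_exp_ofReal_mul_I, abs_of_pos (h.radius_pos (c k))]
  have key : torusIntegral (fun w => (∏ l, (Real.pi * Complex.I * w l)⁻¹) * Xi q β a z w)
      (fun l => z (c l)) (fun l => radius q z (c l)) =
      torusIntegral (fun w => (∏ k, (w k - z (c k))⁻¹) *
        (xiNum q β w * ∏ k, regFactor q z (a k) (c k) (w k)))
      (fun l => z (c l)) (fun l => radius q z (c l)) := by
    unfold torusIntegral
    congr 1
    funext θ
    beta_reduce
    rw [integrand_eq (c := c) hq hg.1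
      (fun k => h.notMem_otherSing (Metric.sphere_subset_closedBall (hmem θ k)))
      fun k => Metric.ne_of_mem_sphere (hmem θ k) (h.radius_pos _).ne']
  rw [key, torusIntegral_prod_sub_inv_mul _ _ _ fun k => h.radius_pos _]
  · rw [xiNum_eq hq fun k => hg.1 _]
    have := Finset.prod_congr (rfl : (Finset.univ : Finset (Fin n)) = Finset.univ)
      fun k _ => regFactor_self hg (a k) (c k)
    rw [Finset.prod_mul_distrib, Finset.prod_const, Finset.card_univ, Fintype.card_fin,
      Finset.prod_mul_distrib, Finset.prod_neg, Finset.card_univ, Fintype.card_fin] at this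
    simp only [← mul_assoc, Finset.prod_mul_distrib, Function.comp_def] at this ⊢
    linear_combination (vdm q fun k => z (c k)) * (∏ k, br (β * z (c k))) * this
  · intro w hw
    have hw' : ∀ k, w k ∉ otherSing q z (c k) := fun k => h.notMem_otherSing (hw k)
    refine (differentiableAt_xiNum hq hβ fun k hk => hw' k (Or.inl hk)).mul ?_
    refine differentiableAt_finset_prod fun k _ => ?_
    exact (differentiableAt_regFactor hq hg.1 (hw' k)).comp w
      (by fun_prop : DifferentiableAt ℂ (fun w : Fin n → ℂ => w k) w)

theorem PsiComp_eq_Phi {β : ℂ} (h : Generic q z) (hq : q ≠ 0) (hβ : β ≠ 0)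
    (a : Fin (nDown N) → Fin N) : PsiComp q β a z = Phi q β z a := by
  rw [PsiComp, contourIntegral_eq h hq hβ, prod_Ioi_eq_pairProd, Phi, pref, neg_pow]
  have : ((-1 : ℂ) ^ nDown N) * (-1) ^ nDown N = 1 := by rw [← mul_pow]; simp
  linear_combination (br q ^ nDown N * (pairProd fun i j => br (q * z j / z i) *
    br (q ^ 2 * z i * z j)) * resSum q z fun k s => phi q z (a k) (z s) * br (β * z s)) * this

end

/-! ### Exchange relations -/

theorem val_swap {n : ℕ} (i i' k : Fin n) : (Equiv.swap i i' k).val =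
    if k.val = i.val then i'.val else if k.val = i'.val then i.val else k.val := by
  simp only [Equiv.swap_apply_def, Fin.ext_iff]
  split_ifs <;> rfl

theorem swap_lt_swap_iff {n : ℕ} {i i' : Fin n} (h : i'.val = i.val + 1) (k l : Fin n) :
    (Equiv.swap i i' k < Equiv.swap i i' l ∧
      ¬(Equiv.swap i i' k = i ∧ Equiv.swap i i' l = i')) ↔ (k < l ∧ ¬(k = i ∧ l = i')) := by
  simp only [Fin.ext_iff, Fin.lt_def, val_swap]
  split_ifs <;> omega

/-- For neighbours, (i, i') is the only ordered pair whose order the transposition reverses, so the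
rest of the product is merely permuted. Having one E for all f allows different products to be
compared. -/
theorem exists_pairProd_eq_mul {n : ℕ} {i i' : Fin n} (h : i'.val = i.val + 1) :
    ∃ E : (Fin n → Fin n → ℂ) → ℂ, (∀ f, pairProd f = f i i' * E f) ∧
      ∀ f, E (fun k l => f (Equiv.swap i i' k) (Equiv.swap i i' l)) = E f := by
  refine ⟨fun f => ∏ p : Fin n × Fin n,
    if p.1 < p.2 ∧ ¬(p.1 = i ∧ p.2 = i') then f p.1 p.2 else 1, fun f => ?_, fun f => ?_⟩
  · beta_reduce
    rw [pairProd, ← Fintype.prod_prod_type',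
      ← Finset.mul_prod_erase _ _ (Finset.mem_univ (i, i')),
      ← Finset.mul_prod_erase (Finset.univ : Finset (Fin n × Fin n)) (fun p =>
        if p.1 < p.2 ∧ ¬(p.1 = i ∧ p.2 = i') then f p.1 p.2 else 1) (Finset.mem_univ (i, i'))]
    have hlt : i < i' := by rw [Fin.lt_def]; omega
    simp only [hlt, if_true, and_self, not_true, and_false, if_false, one_mul]
    congr 1
    refine Finset.prod_congr rfl fun p hp => ?_
    have : ¬(p.1 = i ∧ p.2 = i') := fun h' =>
      Finset.ne_of_mem_erase hp (Prod.ext h'.1 h'.2)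
    simp [this]
  · beta_reduce
    rw [← Equiv.prod_comp ((Equiv.swap i i').prodCongr (Equiv.swap i i'))]
    refine Finset.prod_congr rfl fun p _ => ?_
    simp only [Equiv.prodCongr_apply, Prod.map, swap_lt_swap_iff h, Equiv.swap_apply_self]

section
variable {ι κ : Type*} [Fintype ι] [DecidableEq ι] [Fintype κ] [DecidableEq κ]

theorem mu_comp_equiv (q : ℂ) (z : ι → ℂ) (e : κ ≃ ι) (c : κ) :
    mu q (z ∘ e) c = mu q z (e c) := by
  unfold mu
  refine Finset.prod_bij (fun j _ => e j) ?_ ?_ ?_ ?_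
  · intro j hj; simpa using hj
  · intro j _ j' _ h; simpa using h
  · intro j hj; exact ⟨e.symm j, by simpa [Equiv.symm_apply_eq] using hj, by simp⟩
  · intro j _; rfl

theorem resSum_comp_equiv {n : ℕ} (q : ℂ) (z : ι → ℂ) (e : κ ≃ ι) (g : Fin n → ι → ℂ) :
    resSum q (z ∘ e) (fun k c => g k (e c)) = resSum q z g := by
  unfold resSum
  refine Fintype.sum_equiv (Equiv.piCongrRight fun _ => e) _ _ fun c => ?_
  simp only [mu_comp_equiv]
  rfl

theorem resSum_congr {n : ℕ} {q : ℂ} {z : ι → ℂ} {g g' : Fin n → ι → ℂ}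
    (h : ∀ k s, g k s = g' k s) : resSum q z g = resSum q z g' := by
  have : g = g' := by ext k s; exact h k s
  rw [this]

theorem resSum_linear {n : ℕ} (q : ℂ) (z : ι → ℂ) (k₀ : Fin n) {g g₁ g₂ : Fin n → ι → ℂ}
    {α α₁ α₂ : ℂ} (h₀ : ∀ c, α * g k₀ c = α₁ * g₁ k₀ c + α₂ * g₂ k₀ c)
    (h : ∀ k, k ≠ k₀ → ∀ c, g₁ k c = g k c ∧ g₂ k c = g k c) :
    α * resSum q z g = α₁ * resSum q z g₁ + α₂ * resSum q z g₂ := by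
  unfold resSum
  rw [Finset.mul_sum, Finset.mul_sum, Finset.mul_sum, ← Finset.sum_add_distrib]
  refine Finset.sum_congr rfl fun c _ => ?_
  have e : ∀ g' : Fin n → ι → ℂ, ∏ k, (mu q z (c k))⁻¹ * g' k (c k) =
      (mu q z (c k₀))⁻¹ * g' k₀ (c k₀) *
        ∏ k ∈ Finset.univ.erase k₀, (mu q z (c k))⁻¹ * g' k (c k) := fun g' =>
    (Finset.mul_prod_erase _ (fun k => (mu q z (c k))⁻¹ * g' k (c k)) (Finset.mem_univ k₀)).symm
  have e1 : ∏ k ∈ Finset.univ.erase k₀, (mu q z (c k))⁻¹ * g₁ k (c k) =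
      ∏ k ∈ Finset.univ.erase k₀, (mu q z (c k))⁻¹ * g k (c k) :=
    Finset.prod_congr rfl fun k hk => by rw [(h k (Finset.ne_of_mem_erase hk) _).1]
  have e2 : ∏ k ∈ Finset.univ.erase k₀, (mu q z (c k))⁻¹ * g₂ k (c k) =
      ∏ k ∈ Finset.univ.erase k₀, (mu q z (c k))⁻¹ * g k (c k) :=
    Finset.prod_congr rfl fun k hk => by rw [(h k (Finset.ne_of_mem_erase hk) _).2]
  rw [e g, e g₁, e g₂, e1, e2]
  linear_combination (mu q z (c k₀))⁻¹ * (∏ k ∈ Finset.univ.erase k₀,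
    (mu q z (c k))⁻¹ * g k (c k)) * vdm q (z ∘ c) * h₀ (c k₀)

end

section
variable {N : ℕ} {i i' : Fin N}

theorem Ioi_eq_insert (h : i'.val = i.val + 1) :
    Finset.Ioi i = insert i' (Finset.Ioi i') := by
  ext j; simp only [Finset.mem_Ioi, Finset.mem_insert, Fin.lt_def, Fin.ext_iff]; omega

theorem Ici_eq_insert (j : Fin N) : Finset.Ici j = insert j (Finset.Ioi j) :=
  (Finset.Ioi_insert j).symm

/-- The numerator common to the factors attached to two neighbouring positions. -/
def phiTail (z : Fin N → ℂ) (q : ℂ) (i i' : Fin N) (w : ℂ) : ℂ :=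
  (∏ j ∈ Finset.Ioi i', br (z j / w)) /
    (br (q * z i / w) * br (q * z i' / w) * ∏ j ∈ Finset.Ioi i', br (q * z j / w))

theorem phi_left (h : i'.val = i.val + 1) (q : ℂ) (z : Fin N → ℂ) (w : ℂ) :
    phi q z i w = br (z i' / w) * phiTail z q i i' w := by
  have h1 : i ∉ insert i' (Finset.Ioi i') := by
    simp only [Finset.mem_insert, Finset.mem_Ioi, Fin.lt_def, Fin.ext_iff]; omega
  rw [phi, phiTail, Ici_eq_insert, Ioi_eq_insert h, Finset.prod_insert (by simp),
    Finset.prod_insert h1, Finset.prod_insert (by simp)]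
  ring

theorem phi_right {q : ℂ} {z : Fin N → ℂ} {w : ℂ} (hw : br (q * z i / w) ≠ 0) :
    phi q z i' w = br (q * z i / w) * phiTail z q i i' w := by
  rw [phi, phiTail, Ici_eq_insert, Finset.prod_insert (by simp), mul_assoc, ← mul_div_assoc,
    mul_div_mul_left _ _ hw]

/-- Because the tail is symmetric in z_i and z_{i'}, exchange identities only involve the factors
[z_{i'}/w] and [qz_i/w] of `phi_left` and `phi_right`. -/
theorem phiTail_swap (h : i'.val = i.val + 1) (q : ℂ) (z : Fin N → ℂ) (w : ℂ) :
    phiTail (z ∘ Equiv.swap i i') q i i' w = phiTail z q i i' w := by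
  have h1 : ∀ j ∈ Finset.Ioi i', Equiv.swap i i' j = j := by
    intro j hj
    rw [Finset.mem_Ioi, Fin.lt_def] at hj
    refine Equiv.swap_apply_of_ne_of_ne ?_ ?_ <;> rw [Ne, Fin.ext_iff] <;> omega
  have h2 : ∀ f : ℂ → ℂ, ∏ j ∈ Finset.Ioi i', f (z (Equiv.swap i i' j)) =
      ∏ j ∈ Finset.Ioi i', f (z j) := fun f =>
    Finset.prod_congr rfl fun j hj => by rw [h1 j hj]
  simp only [phiTail, Function.comp_apply, Equiv.swap_apply_left, Equiv.swap_apply_right,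
    h2 fun x => br (x / w), h2 fun x => br (q * x / w), mul_comm (br (q * z i' / w))]

theorem phi_swap_of_ne (h : i'.val = i.val + 1) (q : ℂ) (z : Fin N → ℂ) {a : Fin N} (ha : a ≠ i)
    (ha' : a ≠ i') (w : ℂ) : phi q (z ∘ Equiv.swap i i') a w = phi q z a w := by
  have hs : ∀ j, a < Equiv.swap i i' j ↔ a < j := by
    intro j
    rw [Ne, Fin.ext_iff] at ha ha'
    simp only [Fin.lt_def, val_swap]
    split_ifs <;> omega
  have hs' : ∀ j, a ≤ Equiv.swap i i' j ↔ a ≤ j := by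
    intro j
    rw [Ne, Fin.ext_iff] at ha ha'
    simp only [Fin.le_def, val_swap]
    split_ifs <;> omega
  unfold phi
  congr 1
  · exact Finset.prod_equiv (Equiv.swap i i') (by simp [hs]) (by simp)
  · exact Finset.prod_equiv (Equiv.swap i i') (by simp [hs']) (by simp)

theorem pref_swap (h : i'.val = i.val + 1) (q : ℂ) (z : Fin N → ℂ) :
    pref q (z ∘ Equiv.swap i i') * br (q * z i' / z i) = pref q z * br (q * z i / z i') := by
  obtain ⟨E, hE, hE'⟩ := exists_pairProd_eq_mul h
  have := hE' fun i j => br (q * z j / z i) * br (q ^ 2 * z i * z j)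
  simp only [pref, hE, Function.comp_apply, Equiv.swap_apply_left, Equiv.swap_apply_right, this]
  rw [mul_right_comm (q ^ 2)]
  ring

/-- The exchange relation for a down spin at `i` and an up spin at `i + 1`. -/
theorem Phi_exchange {n : ℕ} {q β : ℂ} {z : Fin N → ℂ} (hz : Good q z) (h : i'.val = i.val + 1)
    {a : Fin n → Fin N} {k₀ : Fin n} (ha : a k₀ = i) (ha' : ∀ k, k ≠ k₀ → a k ≠ i ∧ a k ≠ i') :
    br (z i' / z i) * Phi q β z (Equiv.swap i i' ∘ a) =
      br q * Phi q β z a - br (q * z i' / z i) * Phi q β (z ∘ Equiv.swap i i') a := by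
  -- Relabelling the nodes confines the effect of the exchanged parameters to `phi`, so all three
  -- sums run over the same nodes.
  have hr : resSum q (z ∘ Equiv.swap i i') (fun k s => phi q (z ∘ Equiv.swap i i') (a k)
      ((z ∘ Equiv.swap i i') s) * br (β * (z ∘ Equiv.swap i i') s)) =
      resSum q z fun k s => phi q (z ∘ Equiv.swap i i') (a k) (z s) * br (β * z s) :=
    resSum_comp_equiv q z (Equiv.swap i i')
      (fun k s => phi q (z ∘ Equiv.swap i i') (a k) (z s) * br (β * z s))
  have hl : br (z i' / z i) * resSum q z (fun k s => phi q z ((Equiv.swap i i' ∘ a) k) (z s) *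
        br (β * z s)) =
      br q * resSum q z (fun k s => phi q z (a k) (z s) * br (β * z s)) +
      -br (q * z i / z i') * resSum q z (fun k s => phi q (z ∘ Equiv.swap i i') (a k) (z s) *
        br (β * z s)) := by
    refine resSum_linear q z k₀ (fun c => ?_) fun k hk c => ?_
    · have h1 := hz.1 i
      have h2 := hz.1 i'
      have h3 := hz.1 c
      have h4 := hz.q_ne_zero i
      -- Three-term identity in the single variable attached to the moved spin; the other variables
      -- do not see the exchange.
      have key : br (z i' / z i) * br (q * z i / z c) =
          br q * br (z i' / z c) - br (q * z i / z i') * br (z i / z c) := by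
        unfold br; field_simp; ring
      rw [Function.comp_apply, ha, Equiv.swap_apply_left, phi_right (hz.4 i c), phi_left h,
        phi_left h, phiTail_swap h, Function.comp_apply, Equiv.swap_apply_right]
      linear_combination phiTail z q i i' (z c) * br (β * z c) * key
    · obtain ⟨h1, h2⟩ := ha' k hk
      rw [phi_swap_of_ne h q z h1 h2, Function.comp_apply, Equiv.swap_apply_of_ne_of_ne h1 h2]
      exact ⟨rfl, rfl⟩
  rw [Phi, Phi, Phi, hr]
  linear_combination br q ^ n * pref q z * hl + br q ^ n * (resSum q z fun k s =>
    phi q (z ∘ Equiv.swap i i') (a k) (z s) * br (β * z s)) * pref_swap h q z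

end

/-- Exchanging the parameters of two neighbouring down spins, in the sum over residues. -/
theorem resSum_phi_swap {ι : Type*} [Fintype ι] [DecidableEq ι] {m : ℕ} {q : ℂ} (hq : q ≠ 0)
    {z : ι → ℂ} {y : Fin m → ℂ} (hz : ∀ s, z s ≠ 0) (hy : ∀ l, y l ≠ 0)
    (hyz : ∀ l s, br (q * y l / z s) ≠ 0) (v : ι → ℂ) {i i' : Fin m} (h : i'.val = i.val + 1) :
    resSum q z (fun k s => phi q (y ∘ Equiv.swap i i') k (z s) * v s) =
      resSum q z (fun k s => phi q y k (z s) * v s) := by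
  obtain ⟨E, hE, hE'⟩ := exists_pairProd_eq_mul h
  have hii : i ≠ i' := by rw [Ne, Fin.ext_iff]; omega
  set T : (Fin m → ℂ) → (Fin m → ι) → ℂ := fun y c =>
    (∏ k, (mu q z (c k))⁻¹ * (phi q y k (z (c k)) * v (c k))) * vdm q (z ∘ c) with hT
  -- The identity is proved after symmetrising in the two integration variables of the neighbouring
  -- spins; this symmetrisation is harmless under the sum over c.
  have hsym : ∀ c, T (y ∘ Equiv.swap i i') c + T (y ∘ Equiv.swap i i') (c ∘ Equiv.swap i i') =
      T y c + T y (c ∘ Equiv.swap i i') := by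
    intro c
    have hprod : ∀ (y : Fin m → ℂ) (c : Fin m → ι),
        ∏ k, (mu q z (c k))⁻¹ * (phi q y k (z (c k)) * v (c k)) =
        ((mu q z (c i))⁻¹ * (phi q y i (z (c i)) * v (c i))) *
        (((mu q z (c i'))⁻¹ * (phi q y i' (z (c i')) * v (c i'))) *
        ∏ k ∈ (Finset.univ.erase i).erase i',
          (mu q z (c k))⁻¹ * (phi q y k (z (c k)) * v (c k))) := by
      intro y c
      rw [Finset.mul_prod_erase _ (fun k => (mu q z (c k))⁻¹ * (phi q y k (z (c k)) * v (c k)))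
        (by simp [hii.symm]), Finset.mul_prod_erase _ (fun k => (mu q z (c k))⁻¹ *
        (phi q y k (z (c k)) * v (c k))) (by simp)]
    have hrest : ∀ y' c', (y' = y ∨ y' = y ∘ Equiv.swap i i') →
        (c' = c ∨ c' = c ∘ Equiv.swap i i') →
        ∏ k ∈ (Finset.univ.erase i).erase i',
          (mu q z (c' k))⁻¹ * (phi q y' k (z (c' k)) * v (c' k)) =
        ∏ k ∈ (Finset.univ.erase i).erase i',
          (mu q z (c k))⁻¹ * (phi q y k (z (c k)) * v (c k)) := by
      intro y' c' hy' hc'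
      refine Finset.prod_congr rfl fun k hk => ?_
      have hk1 : k ≠ i' := Finset.ne_of_mem_erase hk
      have hk2 : k ≠ i := Finset.ne_of_mem_erase (Finset.mem_of_mem_erase hk)
      have hc1 : c' k = c k := by
        rcases hc' with rfl | rfl
        · rfl
        · rw [Function.comp_apply, Equiv.swap_apply_of_ne_of_ne hk2 hk1]
      rw [hc1]
      rcases hy' with rfl | rfl
      · rfl
      · rw [phi_swap_of_ne h q y hk2 hk1]
    have hv1 : vdm q (z ∘ c) = _ := hE _
    have hv2 : vdm q (z ∘ (c ∘ Equiv.swap i i')) = _ := hE _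
    have hv3 := hE' fun k l => (xf q (z (c k)) - xf q (z (c l))) *
      (xf q (z (c l)) - uf (z (c k)))
    simp only [Function.comp_apply] at hv1 hv2
    rw [hv3, Equiv.swap_apply_left, Equiv.swap_apply_right] at hv2
    simp only [hT]
    rw [hv1, hv2, hprod, hprod, hprod, hprod, hrest _ _ (Or.inl rfl) (Or.inl rfl),
      hrest _ _ (Or.inl rfl) (Or.inr rfl), hrest _ _ (Or.inr rfl) (Or.inl rfl),
      hrest _ _ (Or.inr rfl) (Or.inr rfl)]
    generalize (∏ k ∈ (Finset.univ.erase i).erase i',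
          (mu q z (c k))⁻¹ * (phi q y k (z (c k)) * v (c k))) = A
    simp only [Function.comp_apply, Equiv.swap_apply_left, Equiv.swap_apply_right]
    have hr : ∀ s, br (q * (y ∘ Equiv.swap i i') i / z s) ≠ 0 := by
      intro s; simpa using hyz i' s
    simp only [phi_left h, phi_right (hyz i _), phi_right (hr _), phiTail_swap h,
      Function.comp_apply, Equiv.swap_apply_left, Equiv.swap_apply_right]
    set w₁ := z (c i) with hw1
    set w₂ := z (c i') with hw2
    have n1 : w₁ ≠ 0 := hz _
    have n2 : w₂ ≠ 0 := hz _
    have n3 := hy i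
    have n4 := hy i'
    -- The symmetrised numerator, antisymmetric factors removed, is unchanged when the two
    -- parameters are exchanged.
    have key : br (y i' / w₁) * br (q * y i / w₂) * br (q * w₂ / w₁) -
        br (y i' / w₂) * br (q * y i / w₁) * br (q * w₁ / w₂) =
        br (y i / w₁) * br (q * y i' / w₂) * br (q * w₂ / w₁) -
        br (y i / w₂) * br (q * y i' / w₁) * br (q * w₁ / w₂) := by
      unfold br; field_simp; ring
    rw [← br_mul_br_eq_xf_sub_uf hq n2 n1, ← br_mul_br_eq_xf_sub_uf hq n1 n2,
      mul_right_comm q w₂ w₁]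
    generalize (E fun k l => (xf q (z (c k)) - xf q (z (c l))) *
      (xf q (z (c l)) - uf (z (c k)))) = B
    linear_combination -(A * B * (mu q z (c i))⁻¹ * (mu q z (c i'))⁻¹ * v (c i) * v (c i') *
      phiTail y q i i' w₁ * phiTail y q i i' w₂ * (xf q w₁ - xf q w₂) * br (q * w₁ * w₂)) * key
  have hre : ∀ y, ∑ c, T y (c ∘ Equiv.swap i i') = ∑ c, T y c := fun y =>
    Equiv.sum_comp (Equiv.arrowCongr (Equiv.swap i i') (Equiv.refl ι)) (T y)
  have hsum := Finset.sum_congr (rfl : (Finset.univ : Finset (Fin m → ι)) = Finset.univ)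
    fun c _ => hsym c
  rw [Finset.sum_add_distrib, Finset.sum_add_distrib, hre, hre, ← two_mul, ← two_mul] at hsum
  exact mul_left_cancel₀ two_ne_zero hsum

/-! ### Lagrange interpolation in the residue sums -/

open Polynomial in
-- Up to sign the sum is the coefficient of degree |ι| - 1 of the interpolation polynomial, which is
-- p itself and has smaller degree.
theorem sum_eval_div_prod_eq_zero {ι : Type*} [Fintype ι] [DecidableEq ι] {X : ι → ℂ}
    (hX : Function.Injective X) (p : ℂ[X]) (hp : p.natDegree + 1 < Fintype.card ι) :
    ∑ s, (∏ j ∈ Finset.univ.erase s, (X j - X s))⁻¹ * p.eval (X s) = 0 := by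
  have h1 := Lagrange.coeff_eq_sum (s := Finset.univ) (v := X) hX.injOn (P := p)
    (lt_of_le_of_lt degree_le_natDegree (by
      rw [Finset.card_univ]; exact_mod_cast (by omega : p.natDegree < Fintype.card ι)))
  rw [coeff_eq_zero_of_natDegree_lt (by rw [Finset.card_univ]; omega)] at h1
  have h2 : ∀ s, (∏ j ∈ Finset.univ.erase s, (X j - X s))⁻¹ * p.eval (X s) =
      (-1) ^ (Fintype.card ι - 1) *
        (p.eval (X s) / ∏ j ∈ Finset.univ.erase s, (X s - X j)) := by
    intro s
    have : ∏ j ∈ Finset.univ.erase s, (X j - X s) =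
        (-1) ^ (Fintype.card ι - 1) * ∏ j ∈ Finset.univ.erase s, (X s - X j) := by
      rw [← Finset.card_univ, ← Finset.card_erase_of_mem (Finset.mem_univ s), ← Finset.prod_const,
        ← Finset.prod_mul_distrib]
      exact Finset.prod_congr rfl fun j _ => by ring
    rw [this, mul_inv, ← inv_pow, inv_neg_one]
    ring
  simp only [h2]
  rw [← Finset.mul_sum, ← h1, mul_zero]

open Polynomial in
-- This is the vanishing statement with T adjoined as one more node, solved for the term at T; the
-- extra node allows the degree to be larger by one.
theorem sum_eval_div_prod_div_sub {ι : Type*} [Fintype ι] [DecidableEq ι] {X : ι → ℂ}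
    (hX : Function.Injective X) {T : ℂ} (hT : ∀ s, X s ≠ T) (p : ℂ[X])
    (hp : p.natDegree < Fintype.card ι) :
    ∑ s, (∏ j ∈ Finset.univ.erase s, (X j - X s))⁻¹ * ((T - X s)⁻¹ * p.eval (X s)) =
      -((∏ s, (X s - T))⁻¹ * p.eval T) := by
  have hX' : Function.Injective (fun o : Option ι => o.elim T X) := by
    rintro (_ | s) (_ | s') h
    · rfl
    · exact absurd h.symm (hT s')
    · exact absurd h (hT s)
    · exact congrArg some (hX h)
  have h := sum_eval_div_prod_eq_zero hX' p (by rw [Fintype.card_option]; omega)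
  rw [Fintype.sum_option] at h
  have e1 : (Finset.univ.erase (none : Option ι)) =
      Finset.univ.map Function.Embedding.some := by
    ext (_ | s) <;> simp
  have e2 : ∀ s : ι, (Finset.univ.erase (some s)) =
      insert none ((Finset.univ.erase s).map Function.Embedding.some) := by
    intro s; ext (_ | s') <;> simp
  rw [e1, Finset.prod_map] at h
  have e3 : ∀ s : ι, (∏ j ∈ Finset.univ.erase (some s), ((fun o : Option ι => o.elim T X) j -
      (fun o : Option ι => o.elim T X) (some s)))⁻¹ =
      (∏ j ∈ Finset.univ.erase s, (X j - X s))⁻¹ * (T - X s)⁻¹ := by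
    intro s
    rw [e2, Finset.prod_insert (by simp), Finset.prod_map, mul_inv_rev]
    rfl
  simp only [e3, mul_assoc] at h
  simp only [Function.Embedding.some_apply, Option.elim] at h
  linear_combination h

section
variable {ι : Type*} [Fintype ι] [DecidableEq ι]

open Polynomial in
/-- The interaction of one more variable with the variables `w`, as a polynomial. -/
def pairPoly {n : ℕ} (q : ℂ) (w : Fin n → ℂ) : ℂ[X] :=
  ∏ k, ((C (xf q (w k)) - X) * (X - C (uf (w k))))

open Polynomial in
theorem natDegree_pairPoly_le {n : ℕ} (q : ℂ) (w : Fin n → ℂ) :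
    (pairPoly q w).natDegree ≤ 2 * n := by
  refine (natDegree_prod_le _ _).trans ?_
  refine (Finset.sum_le_sum (g := fun _ => 2) fun k _ => ?_).trans (by simp [mul_comm])
  refine natDegree_mul_le.trans ?_
  rw [← neg_sub X, natDegree_neg, natDegree_X_sub_C, natDegree_X_sub_C]

open Polynomial in
theorem eval_pairPoly {n : ℕ} (q : ℂ) (w : Fin n → ℂ) (u : ℂ) :
    (pairPoly q w).eval u = ∏ k, ((xf q (w k) - u) * (u - uf (w k))) := by
  simp [pairPoly, eval_prod]

/-- In a pair k < l the interaction depends on w_l only through `xf`, whereas w_k also enters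
through `uf`. Hence it is the last variable that can be summed by interpolation. -/
theorem vdm_snoc {n : ℕ} (q : ℂ) (w : Fin n → ℂ) (u : ℂ) :
    vdm q (Fin.snoc w u : Fin (n + 1) → ℂ) = vdm q w * (pairPoly q w).eval (xf q u) := by
  rw [eval_pairPoly, vdm, vdm, pairProd, pairProd, Fin.prod_univ_castSucc]
  simp [Fin.prod_univ_castSucc, Fin.castSucc_lt_last, Finset.prod_mul_distrib, Fin.le_last,
    Fin.not_lt.2]

theorem resSum_succ {n : ℕ} (q : ℂ) (z : ι → ℂ) (g : Fin (n + 1) → ι → ℂ) :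
    resSum q z g = ∑ c : Fin n → ι, (∏ k, (mu q z (c k))⁻¹ * g k.castSucc (c k)) *
      vdm q (z ∘ c) * ∑ s, (mu q z s)⁻¹ * (g (Fin.last n) s *
        (pairPoly q (z ∘ c)).eval (xf q (z s))) := by
  unfold resSum
  rw [← (Fin.snocEquiv fun _ => ι).sum_comp, Fintype.sum_prod_type_right]
  refine Finset.sum_congr rfl fun c _ => ?_
  rw [Finset.mul_sum]
  refine Finset.sum_congr rfl fun s _ => ?_
  have : z ∘ (Fin.snoc c s : Fin (n + 1) → ι) = Fin.snoc (z ∘ c) (z s) :=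
    Fin.comp_snoc z c s
  simp only [Fin.snocEquiv, Equiv.coe_fn_mk, this, vdm_snoc, Fin.prod_univ_castSucc,
    Fin.snoc_castSucc, Fin.snoc_last]
  ring

theorem Good.xf_injective {κ : Type*} {q : ℂ} {z : κ → ℂ} (h : Good q z) :
    Function.Injective fun s => xf q (z s) := by
  intro s s' hs
  by_contra hne
  exact h.xf_ne hne (sub_eq_zero.2 hs)

/-- If the factor of the last variable is constant, its sum is a Lagrange sum of a polynomial of
degree at most 2n, two for each other variable. -/
theorem resSum_eq_zero_of_last {n : ℕ} {q : ℂ} {z : ι → ℂ} (hz : Good q z)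
    {g : Fin (n + 1) → ι → ℂ} {C : ℂ} (hg : ∀ s, g (Fin.last n) s = C)
    (hn : 2 * n + 1 < Fintype.card ι) : resSum q z g = 0 := by
  rw [resSum_succ]
  refine Finset.sum_eq_zero fun c _ => ?_
  have := sum_eval_div_prod_eq_zero hz.xf_injective (pairPoly q (z ∘ c))
    (lt_of_le_of_lt (Nat.add_le_add_right (natDegree_pairPoly_le _ _) 1) hn)
  have h2 : ∑ s, (mu q z s)⁻¹ * (g (Fin.last n) s * (pairPoly q (z ∘ c)).eval (xf q (z s))) =
      C * ∑ s, (mu q z s)⁻¹ * (pairPoly q (z ∘ c)).eval (xf q (z s)) := by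
    rw [Finset.mul_sum]
    exact Finset.sum_congr rfl fun s _ => by rw [hg]; ring
  unfold mu at h2 ⊢
  rw [h2, this, mul_zero, mul_zero]

/-- A node at which all the factors vanish can be removed. -/
theorem resSum_remove {κ : Type*} [Fintype κ] [DecidableEq κ] {n : ℕ} (q : ℂ) (z : κ → ℂ)
    {f : ι → κ} (hf : Function.Injective f) {s₀ : κ} (hs : ∀ s, s = s₀ ∨ s ∈ Set.range f)
    (hs₀ : s₀ ∉ Set.range f) {g : Fin n → κ → ℂ} (hg : ∀ k, g k s₀ = 0) :
    resSum q z g =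
      resSum q (z ∘ f) fun k s => (xf q (z s₀) - xf q (z (f s)))⁻¹ * g k (f s) := by
  have hmu : ∀ s, mu q z (f s) = (xf q (z s₀) - xf q (z (f s))) * mu q (z ∘ f) s := by
    intro s
    have : Finset.univ.erase (f s) =
        insert s₀ ((Finset.univ.erase s).map ⟨f, hf⟩) := by
      ext j
      simp only [Finset.mem_erase, Finset.mem_univ, and_true, Finset.mem_insert,
        Finset.mem_map, Function.Embedding.coeFn_mk]
      constructor
      · intro hj
        rcases hs j with h | ⟨t, rfl⟩
        · exact Or.inl h
        · exact Or.inr ⟨t, fun h => hj (by rw [h]), rfl⟩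
      · rintro (rfl | ⟨t, ht, rfl⟩)
        · exact fun h => hs₀ ⟨s, h.symm⟩
        · exact hf.ne ht
    rw [mu, this, Finset.prod_insert, Finset.prod_map]
    · rfl
    · simp only [Finset.mem_map, not_exists, not_and, Function.Embedding.coeFn_mk]
      exact fun t _ ht => hs₀ ⟨t, ht⟩
  unfold resSum
  symm
  refine Finset.sum_of_injOn (fun c => f ∘ c) ?_ (by simp) ?_ ?_
  · intro c _ c' _ h
    funext k
    exact hf (congrFun h k)
  · intro c _ hc
    -- A choice outside the image uses the removed node at least once, so its term contains a
    -- vanishing factor.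
    have : ∃ k, c k = s₀ := by
      by_contra hne
      push Not at hne
      have h' : ∀ k, ∃ t, f t = c k := fun k => (hs (c k)).resolve_left (hne k)
      choose t ht using h'
      exact hc ⟨t, by simp, funext ht⟩
    obtain ⟨k, hk⟩ := this
    rw [Finset.prod_eq_zero (Finset.mem_univ k) (by rw [hk, hg, mul_zero]), zero_mul]
  · intro c _
    simp only [Function.comp_apply, hmu, mul_inv]
    congr 1
    exact Finset.prod_congr rfl fun k _ => by ring

end

theorem prod_Ioi_castSucc {n : ℕ} (k : Fin n) (f : Fin (n + 1) → ℂ) :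
    ∏ j ∈ Finset.Ioi k.castSucc, f j = (∏ j ∈ Finset.Ioi k, f j.castSucc) * f (Fin.last n) := by
  have h1 : Finset.Ioi k.castSucc = Finset.univ.filter fun j => k.castSucc < j := by ext; simp
  have h2 : Finset.Ioi k = Finset.univ.filter fun j => k < j := by ext; simp
  rw [h1, h2, Finset.prod_filter, Finset.prod_filter, Fin.prod_univ_castSucc]
  simp [Fin.castSucc_lt_last]

theorem phi_castSucc {n : ℕ} (q : ℂ) (y : Fin (n + 1) → ℂ) (k : Fin n) (w : ℂ) :
    phi q y k.castSucc w = phi q (y ∘ Fin.castSucc) k w *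
      (br (y (Fin.last n) / w) / br (q * y (Fin.last n) / w)) := by
  rw [phi, phi, Ici_eq_insert, Ici_eq_insert, Finset.prod_insert (by simp),
    Finset.prod_insert (by simp), prod_Ioi_castSucc, prod_Ioi_castSucc]
  simp only [Function.comp_apply]
  rw [← mul_assoc, mul_div_mul_comm]

theorem phi_last {n : ℕ} (q : ℂ) (y : Fin (n + 1) → ℂ) (w : ℂ) :
    phi q y (Fin.last n) w = (br (q * y (Fin.last n) / w))⁻¹ := by
  have : Finset.Ioi (Fin.last n) = ∅ := by ext j; simp [Fin.le_last]
  rw [phi, Ici_eq_insert, this]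
  simp

/-! ### The component with all down spins to the right -/

/-- The sum over residues for up spins at `x` followed by down spins at `y`. -/
def downSum {n m : ℕ} (q : ℂ) (v : ℂ → ℂ) (x : Fin n → ℂ) (y : Fin m → ℂ) : ℂ :=
  resSum q (Sum.elim x y) fun k s => phi q y k (Sum.elim x y s) * v (Sum.elim x y s)

/-- In addition to `Good`, no `± q⁻³` is a product of two parameters. -/
structure Good3 {ι : Type*} (q : ℂ) (z : ι → ℂ) : Prop extends Good q z where
  br_q3 : ∀ i j, br (q ^ 3 * z i * z j) ≠ 0

theorem Good3.comp {ι κ : Type*} {q : ℂ} {z : ι → ℂ} (h : Good3 q z) {f : κ → ι}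
    (hf : Function.Injective f) : Good3 q (z ∘ f) :=
  ⟨h.toGood.comp hf, fun _ _ => h.br_q3 _ _⟩

theorem downSum_comp_perm {n m : ℕ} {q : ℂ} (v : ℂ → ℂ) {x : Fin n → ℂ} {y : Fin m → ℂ}
    (h : Good q (Sum.elim x y)) (σ : Equiv.Perm (Fin m)) :
    downSum q v x (y ∘ σ) = downSum q v x y := by
  have hel : ∀ (y : Fin m → ℂ) (σ : Equiv.Perm (Fin m)),
      Sum.elim x (y ∘ σ) = Sum.elim x y ∘ (Equiv.sumCongr (Equiv.refl _) σ) := by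
    intro y σ
    ext (i | l) <;> rfl
  rcases m with _ | m
  · congr 1; ext l; exact l.elim0
  have hmem : σ ∈ Submonoid.closure
      (Set.range fun i : Fin m => Equiv.swap i.castSucc i.succ) := by
    rw [Equiv.Perm.mclosure_swap_castSucc_succ]; trivial
  induction hmem using Submonoid.closure_induction generalizing y with
  | one => rfl
  | mem σ hσ =>
    obtain ⟨i, rfl⟩ := hσ
    have hii : (i.succ).val = (i.castSucc).val + 1 := by simp
    unfold downSum
    rw [hel y]
    -- Permuting y also permutes the nodes; relabelling undoes this, so that only the permutation
    -- inside `phi` remains.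
    have h1 := resSum_comp_equiv q (Sum.elim x y)
      (Equiv.sumCongr (Equiv.refl _) (Equiv.swap i.castSucc i.succ))
      (fun k s => phi q (y ∘ Equiv.swap i.castSucc i.succ) k (Sum.elim x y s) *
        v (Sum.elim x y s))
    simp only [Function.comp_def] at h1 ⊢
    rw [h1]
    exact resSum_phi_swap (h.q_ne_zero (Sum.inr i.castSucc)) h.1 (fun l => h.1 (Sum.inr l))
      (fun l s => h.4 (Sum.inr l) s) _ hii
  | mul σ τ _ _ h1 h2 =>
    have : y ∘ (σ * τ : Equiv.Perm _) = (y ∘ σ) ∘ τ := rfl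
    rw [this, h2, h1 h]
    rw [hel]
    exact h.comp (Equiv.injective _)

/-- At this value of β the boundary factor cancels the only factor [qy/w] in `phi` of the last
position, leaving the constant -1. The symmetry in y then moves the zero to every l. -/
theorem downSum_eq_zero_last {n m : ℕ} {q : ℂ} {x : Fin n → ℂ} {y : Fin (m + 1) → ℂ}
    (h : Good q (Sum.elim x y)) (hmn : m < n) :
    downSum q (fun w => br ((q * y (Fin.last m))⁻¹ * w)) x y = 0 := by
  refine resSum_eq_zero_of_last h (C := -1) (fun s => ?_) ?_
  · have h1 : br (q * y (Fin.last m) / Sum.elim x y s) ≠ 0 := h.4 (Sum.inr (Fin.last m)) s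
    have h2 : (q * y (Fin.last m))⁻¹ * Sum.elim x y s =
        (q * y (Fin.last m) / Sum.elim x y s)⁻¹ := by rw [inv_div, div_eq_inv_mul]
    beta_reduce
    rw [phi_last, h2, br_inv, mul_neg, inv_mul_cancel₀ h1]
  · simp; omega

theorem downSum_eq_zero {n m : ℕ} {q : ℂ} {x : Fin n → ℂ} {y : Fin m → ℂ}
    (h : Good q (Sum.elim x y)) (hmn : m ≤ n) (l : Fin m) :
    downSum q (fun w => br ((q * y l)⁻¹ * w)) x y = 0 := by
  rcases m with _ | m
  · exact l.elim0
  have h' : Good q (Sum.elim x (y ∘ Equiv.swap l (Fin.last m))) := by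
    have : Sum.elim x (y ∘ Equiv.swap l (Fin.last m)) =
        Sum.elim x y ∘ (Equiv.sumCongr (Equiv.refl _) (Equiv.swap l (Fin.last m))) := by
      ext (i | l) <;> rfl
    rw [this]
    exact h.comp (Equiv.injective _)
  have := downSum_eq_zero_last h' (by omega)
  rwa [downSum_comp_perm _ h, Function.comp_apply, Equiv.swap_apply_right] at this

/-! ### Recursions for the down-right sum and its polynomial dependence on the parameters. -/

section
variable {n m : ℕ} {q : ℂ}

/-- Removing the last down spin. -/
theorem downSum_fusion {x : Fin n → ℂ} {y : Fin (m + 1) → ℂ} (h : Good3 q (Sum.elim x y))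
    (hmn : m ≤ n) :
    downSum q (fun w => (br (q ^ 2 * (q * y (Fin.last m)) * w))⁻¹) x y =
      -((∏ s, (xf q (Sum.elim x y s) - xf q (q * y (Fin.last m))))⁻¹ *
        downSum q (fun w => br ((q ^ 2 * y (Fin.last m))⁻¹ * w)) x (y ∘ Fin.castSucc)) := by
  set z := Sum.elim x y with hz
  set yl := y (Fin.last m) with hyl
  have hzl : z (Sum.inr (Fin.last m)) = yl := rfl
  have hq : q ≠ 0 := h.q_ne_zero (Sum.inr (Fin.last m))
  have hyl0 : yl ≠ 0 := h.ne_zero (Sum.inr (Fin.last m))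
  have ht0 : q * yl ≠ 0 := mul_ne_zero hq hyl0
  have hd : ∀ s, br (q * yl / z s) ≠ 0 := fun s => h.br_q_div (Sum.inr (Fin.last m)) s
  have h3 : ∀ s, br (q ^ 2 * (q * yl) * z s) ≠ 0 := fun s => by
    have := h.br_q3 (Sum.inr (Fin.last m)) s
    rwa [hzl, pow_succ, mul_assoc (q ^ 2) q] at this
  have hxt : ∀ s, xf q (q * yl) - xf q (z s) = br (q * yl / z s) * br (q ^ 2 * (q * yl) * z s) := by
    intro s
    rw [← br_mul_br_eq_xf_sub_xf hq ht0 (h.ne_zero s), mul_right_comm (q ^ 2)]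
  have hne : ∀ s, xf q (z s) ≠ xf q (q * yl) := fun s hs => by
    have := hxt s
    rw [hs, sub_self] at this
    exact mul_ne_zero (hd s) (h3 s) this.symm
  -- The weight was chosen so that together with `phi` at the last position it equals 1/(T - X(w))
  -- with T = X(q y_last). The sum is then the value of the interaction at T, since 2m < n + m + 1.
  have hlast : ∀ c : Fin m → Fin n ⊕ Fin (m + 1),
      ∑ s, (mu q z s)⁻¹ * (phi q y (Fin.last m) (z s) * (br (q ^ 2 * (q * yl) * z s))⁻¹ *
        (pairPoly q (z ∘ c)).eval (xf q (z s))) =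
      -((∏ s, (xf q (z s) - xf q (q * yl)))⁻¹ *
        (pairPoly q (z ∘ c)).eval (xf q (q * yl))) := by
    intro c
    rw [← sum_eval_div_prod_div_sub h.toGood.xf_injective hne (pairPoly q (z ∘ c))
      (lt_of_le_of_lt (natDegree_pairPoly_le _ _) (by simp; omega))]
    refine Finset.sum_congr rfl fun s _ => ?_
    rw [hxt, phi_last, ← hyl, mul_inv]
    rfl
  have hstep : downSum q (fun w => (br (q ^ 2 * (q * yl) * w))⁻¹) x y =
      -((∏ s, (xf q (z s) - xf q (q * yl)))⁻¹ * resSum q z fun (k : Fin m) s =>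
        phi q y k.castSucc (z s) * (br (q ^ 2 * (q * yl) * z s))⁻¹ *
          ((xf q (z s) - xf q (q * yl)) * (xf q (q * yl) - uf (z s)))) := by
    rw [downSum, resSum_succ]
    simp only [← hz, hlast]
    rw [resSum, Finset.mul_sum, ← Finset.sum_neg_distrib]
    refine Finset.sum_congr rfl fun c _ => ?_
    rw [eval_pairPoly]
    simp only [← mul_assoc, Function.comp_apply, Finset.prod_mul_distrib]
    ring
  rw [hstep]
  congr 2
  -- All remaining factors vanish at the node y_last because each contains [y_last/w]. The
  -- interaction evaluated at T cancels the old weight, and its surviving factor [q²y_last/w]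
  -- becomes a boundary factor with new parameter (q²y_last)⁻¹.
  rw [resSum_remove q z (f := Sum.map id Fin.castSucc) (s₀ := Sum.inr (Fin.last m))]
  · have hel : z ∘ Sum.map id Fin.castSucc = Sum.elim x (y ∘ Fin.castSucc) := by
      ext (i | l) <;> rfl
    rw [downSum, hel]
    refine resSum_congr fun k s => ?_
    have hs : z (Sum.map id Fin.castSucc s) = Sum.elim x (y ∘ Fin.castSucc) s := congrFun hel s
    rw [← hs]
    set s' := Sum.map id Fin.castSucc s with hs'
    have hsl : Sum.inr (Fin.last m) ≠ s' := by
      rw [hs']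
      rcases s with i | l
      · simp
      · simpa using (Fin.castSucc_lt_last l).ne'
    have hws : z s' ≠ 0 := h.ne_zero s'
    rw [phi_castSucc, ← hyl, hzl, ← hzl]
    rw [← br_mul_br_eq_xf_sub_xf hq (h.ne_zero _) hws, hzl]
    have e1 : xf q (z s') - xf q (q * yl) =
        -(br (q * yl / z s') * br (q ^ 2 * (q * yl) * z s')) := by rw [← hxt]; ring
    have e2 : xf q (q * yl) - uf (z s') = br (q ^ 2 * yl / z s') * br (q ^ 2 * z s' * yl) := by
      rw [← br_mul_br_eq_xf_sub_uf hq ht0 hws]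
      congr 2 <;> ring
    have e3 : br ((q ^ 2 * yl)⁻¹ * z s') = -br (q ^ 2 * yl / z s') := by
      rw [br_div_comm, neg_neg, div_eq_inv_mul]
    have n1 : br (yl / z s') ≠ 0 := h.br_div _ _ hsl
    have n2 : br (q ^ 2 * z s' * yl) ≠ 0 := h.br_mul s' (Sum.inr (Fin.last m))
    have n3 := hd s'
    have n4 := h3 s'
    rw [e1, e2, e3]
    generalize br (yl / z s') = A1 at *
    generalize br (q ^ 2 * z s' * yl) = A2 at *
    generalize br (q * yl / z s') = A3 at *
    generalize br (q ^ 2 * (q * yl) * z s') = A4 at *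
    field_simp
  · rintro (⟨_⟩ | ⟨_⟩) (⟨_⟩ | ⟨_⟩) hab <;> simp_all [Fin.ext_iff]
  · rintro (i | l)
    · exact Or.inr ⟨Sum.inl i, rfl⟩
    · refine Fin.lastCases (Or.inl rfl) (fun l => Or.inr ⟨Sum.inr l, rfl⟩) l
  · rintro ⟨i | l, hil⟩
    · simp at hil
    · simp only [Sum.map_inr, Sum.inr.injEq] at hil
      exact (Fin.castSucc_lt_last l).ne hil
  · intro k
    rw [phi_castSucc, hzl, ← hyl, div_self hyl0, br_one]
    simp

/-- Removing the first up spin. -/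
theorem downSum_remove_up {x : Fin (n + 1) → ℂ} {y : Fin m → ℂ} (h : Good q (Sum.elim x y)) :
    downSum q (fun w => br ((x 0)⁻¹ * w)) x y =
      (-1) ^ m * downSum q (fun w => (br (q ^ 2 * x 0 * w))⁻¹) (x ∘ Fin.succ) y := by
  set z := Sum.elim x y with hz
  have hq : q ≠ 0 := h.q_ne_zero (Sum.inl 0)
  have hz0 : z (Sum.inl 0) = x 0 := rfl
  rw [downSum, resSum_remove q z (f := Sum.map Fin.succ id) (s₀ := Sum.inl 0)]
  · have hel : z ∘ Sum.map Fin.succ id = Sum.elim (x ∘ Fin.succ) y := by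
      ext (i | l) <;> rfl
    have : downSum q (fun w => (br (q ^ 2 * x 0 * w))⁻¹) (x ∘ Fin.succ) y =
        resSum q (z ∘ Sum.map Fin.succ id) fun k s =>
          phi q y k (z (Sum.map Fin.succ id s)) *
            (br (q ^ 2 * x 0 * z (Sum.map Fin.succ id s)))⁻¹ := by
      rw [downSum, ← hel]; rfl
    rw [this, resSum, resSum, Finset.mul_sum]
    refine Finset.sum_congr rfl fun c _ => ?_
    rw [← mul_assoc]
    congr 1
    rw [← Fin.prod_const, ← Finset.prod_mul_distrib]
    refine Finset.prod_congr rfl fun k _ => ?_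
    set s := c k
    have hsl : Sum.inl 0 ≠ Sum.map Fin.succ id s := by
      rcases s with i | l
      · simpa using (Fin.succ_ne_zero i).symm
      · simp
    set s' := Sum.map Fin.succ id s
    have hws : z s' ≠ 0 := h.ne_zero s'
    -- The boundary factor is -[x_0/w], while removing the node x_0 divides by [x_0/w][q²x_0w]; each
    -- variable keeps -1/[q²x_0w].
    rw [← hz, ← br_mul_br_eq_xf_sub_xf hq (h.ne_zero _) hws, hz0]
    have n1 : br (x 0 / z s') ≠ 0 := h.br_div _ _ hsl
    have e : br ((x 0)⁻¹ * z s') = -br (x 0 / z s') := by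
      rw [br_div_comm, neg_neg, div_eq_inv_mul]
    rw [e, mul_right_comm (q ^ 2), mul_inv]
    generalize br (x 0 / z s') = A at *
    field_simp
  · rintro (⟨_⟩ | ⟨_⟩) (⟨_⟩ | ⟨_⟩) hab <;> simp_all [Fin.ext_iff]
  · rintro (i | l)
    · refine Fin.cases (Or.inl rfl) (fun i => Or.inr ⟨Sum.inl i, rfl⟩) i
    · exact Or.inr ⟨Sum.inr l, rfl⟩
  · rintro ⟨i | l, hil⟩
    · simp only [Sum.map_inl, Sum.inl.injEq] at hil
      exact Fin.succ_ne_zero i hil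
    · simp at hil
  · intro k
    have hx0 : x 0 ≠ 0 := h.ne_zero (Sum.inl 0)
    rw [← hz, hz0, inv_mul_cancel₀ hx0, br_one, mul_zero]

open Polynomial in
-- Each β[βw] = wβ² - w⁻¹ is linear in β². The constant term, recorded separately, is the sum with
-- weight w⁻¹ needed for interpolation at infinity in `prod_br_mul_downSum_eq`.
theorem exists_poly_downSum (x : Fin n → ℂ) (y : Fin m → ℂ) :
    ∃ p : ℂ[X], p.natDegree ≤ m ∧
      (∀ β, β ≠ 0 → β ^ m * downSum q (fun w => br (β * w)) x y = p.eval (β ^ 2)) ∧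
      p.eval 0 = (-1) ^ m * downSum q (fun w => w⁻¹) x y := by
  set z := Sum.elim x y with hz
  refine ⟨∑ c : Fin m → Fin n ⊕ Fin m, C ((∏ k, (mu q z (c k))⁻¹ * phi q y k (z (c k))) *
    vdm q (z ∘ c)) * ∏ k, (C (z (c k)) * X - C (z (c k))⁻¹), ?_, ?_, ?_⟩
  · refine natDegree_sum_le_of_forall_le _ _ fun c _ => ?_
    refine (natDegree_C_mul_le _ _).trans ((natDegree_prod_le _ _).trans ?_)
    refine (Finset.sum_le_sum (g := fun _ => 1) fun k _ => ?_).trans (by simp)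
    rw [sub_eq_add_neg, ← C_neg]
    exact natDegree_linear_le
  · intro β hβ
    rw [eval_finsetSum, downSum, resSum, Finset.mul_sum]
    refine Finset.sum_congr rfl fun c _ => ?_
    simp only [eval_mul, eval_C, eval_prod, eval_sub, eval_X, ← hz]
    have : ∏ k, (z (c k) * β ^ 2 - (z (c k))⁻¹) = β ^ m * ∏ k, br (β * z (c k)) := by
      rw [show β ^ m = ∏ _k : Fin m, β by simp, ← Finset.prod_mul_distrib]
      refine Finset.prod_congr rfl fun k _ => ?_
      unfold br
      rw [mul_inv, mul_sub, ← mul_assoc β β⁻¹, mul_inv_cancel₀ hβ]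
      ring
    rw [this]
    simp only [Finset.prod_mul_distrib]
    ring
  · rw [eval_finsetSum, downSum, resSum, Finset.mul_sum]
    refine Finset.sum_congr rfl fun c _ => ?_
    simp only [eval_mul, eval_C, eval_prod, eval_sub, eval_X, ← hz, mul_zero, zero_sub,
      Finset.prod_neg, Finset.card_univ, Fintype.card_fin, Finset.prod_mul_distrib]
    ring

open Polynomial in
-- The degree is n rather than n + m: `vdm` kills non-injective choices, and an injective choice
-- cancels m of the n + m factors in front. Evaluation at 0 corresponds to t → ∞.
theorem exists_poly_downSum_inv {x : Fin n → ℂ} {y : Fin m → ℂ} (hq : q ≠ 0)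
    (hz : ∀ s, Sum.elim x y s ≠ 0) :
    ∃ p : ℂ[X], p.natDegree ≤ n ∧
      (∀ t, t ≠ 0 → (∀ s, br (q ^ 2 * t * Sum.elim x y s) ≠ 0) →
        (∏ s, br (q ^ 2 * t * Sum.elim x y s)) *
          downSum q (fun w => (br (q ^ 2 * t * w))⁻¹) x y = t ^ n * p.eval (t ^ 2)⁻¹) ∧
      p.eval 0 = (q ^ 2) ^ n * (∏ s, Sum.elim x y s) * downSum q (fun w => w⁻¹) x y := by
  set z := Sum.elim x y with hzdef
  have hinj : ∀ c : Fin m → Fin n ⊕ Fin m, ¬Function.Injective c → vdm q (z ∘ c) = 0 := by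
    intro c hc
    rw [Function.Injective] at hc
    push Not at hc
    obtain ⟨k, l, hkl, hne⟩ := hc
    wlog hlt : k < l generalizing k l
    · exact this l k hkl.symm hne.symm (lt_of_le_of_ne (not_lt.1 hlt) hne.symm)
    rw [vdm, pairProd]
    refine Finset.prod_eq_zero (Finset.mem_univ k) (Finset.prod_eq_zero (Finset.mem_univ l) ?_)
    simp [hlt, hkl]
  have hcard : ∀ c : Fin m → Fin n ⊕ Fin m, Function.Injective c →
      (Finset.univ \ Finset.univ.image c).card = n := by
    intro c hc
    rw [Finset.card_sdiff_of_subset (Finset.subset_univ _), Finset.card_image_of_injective _ hc]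
    simp
  have hsplit : ∀ (c : Fin m → Fin n ⊕ Fin m), Function.Injective c →
      ∀ f : Fin n ⊕ Fin m → ℂ, ∏ s, f s =
        (∏ s ∈ Finset.univ \ Finset.univ.image c, f s) * ∏ k, f (c k) := by
    intro c hc f
    rw [← Finset.prod_image (s := Finset.univ) (f := f) fun a _ b _ hab => hc hab,
      Finset.prod_sdiff (Finset.subset_univ _)]
  refine ⟨∑ c : Fin m → Fin n ⊕ Fin m, C ((∏ k, (mu q z (c k))⁻¹ * phi q y k (z (c k))) *
    vdm q (z ∘ c)) * ∏ s ∈ Finset.univ \ Finset.univ.image c,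
      (C (-(q ^ 2 * z s)⁻¹) * X + C (q ^ 2 * z s)), ?_, ?_, ?_⟩
  · refine natDegree_sum_le_of_forall_le _ _ fun c _ => ?_
    by_cases hc : Function.Injective c
    · refine (natDegree_C_mul_le _ _).trans ((natDegree_prod_le _ _).trans ?_)
      refine (Finset.sum_le_sum (g := fun _ => 1) fun k _ => natDegree_linear_le).trans ?_
      simp [hcard c hc]
    · simp [hinj c hc]
  · intro t ht hbr
    rw [eval_finsetSum, downSum, resSum, Finset.mul_sum, Finset.mul_sum]
    refine Finset.sum_congr rfl fun c _ => ?_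
    by_cases hc : Function.Injective c
    · rw [hsplit c hc]
      have h1 : t ^ n * ∏ s ∈ Finset.univ \ Finset.univ.image c,
          (-(q ^ 2 * z s)⁻¹ * (t ^ 2)⁻¹ + q ^ 2 * z s) =
          ∏ s ∈ Finset.univ \ Finset.univ.image c, br (q ^ 2 * t * z s) := by
        have ht' : t ^ n = ∏ _s ∈ Finset.univ \ Finset.univ.image c, t := by
          rw [Finset.prod_const, hcard c hc]
        rw [ht', ← Finset.prod_mul_distrib]
        refine Finset.prod_congr rfl fun s _ => ?_
        have := hz s
        unfold br
        field_simp
        ring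
      have h2 : (∏ k, br (q ^ 2 * t * z (c k))) * ∏ k, (br (q ^ 2 * t * z (c k)))⁻¹ = 1 := by
        rw [← Finset.prod_mul_distrib]
        exact Finset.prod_eq_one fun k _ => mul_inv_cancel₀ (hbr _)
      simp only [eval_mul, eval_C, eval_prod, eval_add, eval_X, Finset.prod_mul_distrib, ← hzdef]
      linear_combination (∏ s ∈ Finset.univ \ Finset.univ.image c, br (q ^ 2 * t * z s)) *
        (∏ k, (mu q z (c k))⁻¹) * (∏ k, phi q y k (z (c k))) * vdm q (z ∘ c) * h2 -
        (∏ k, (mu q z (c k))⁻¹) * (∏ k, phi q y k (z (c k))) * vdm q (z ∘ c) * h1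
    · rw [← hzdef, hinj c hc]; simp
  · rw [eval_finsetSum, downSum, resSum, Finset.mul_sum]
    refine Finset.sum_congr rfl fun c _ => ?_
    by_cases hc : Function.Injective c
    · rw [hsplit c hc]
      simp only [eval_mul, eval_C, eval_prod, eval_add, eval_X, Finset.prod_mul_distrib, ← hzdef,
        mul_zero, zero_add, Finset.prod_const, hcard c hc]
      have h2 : (∏ k, z (c k)) * ∏ k, (z (c k))⁻¹ = 1 := by
        rw [← Finset.prod_mul_distrib]
        exact Finset.prod_eq_one fun k _ => mul_inv_cancel₀ (hz _)
      linear_combination -((∏ k, (mu q z (c k))⁻¹) * (∏ k, phi q y k (z (c k))) *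
        vdm q (z ∘ c) * (q ^ 2) ^ n * (∏ s ∈ Finset.univ \ Finset.univ.image c, z s)) * h2
    · rw [← hzdef, hinj c hc]; simp

end

theorem sq_ne_sq_of_br {a b : ℂ} (hb : b ≠ 0) (h : br (a / b) ≠ 0) : a ^ 2 ≠ b ^ 2 := by
  intro hab
  apply h
  rw [br_eq_zero_iff]
  rcases sq_eq_sq_iff_eq_or_eq_neg.1 hab with rfl | rfl
  · exact Or.inr (Or.inl (div_self hb))
  · exact Or.inr (Or.inr (by rw [neg_div, div_self hb]))

theorem pairProd_succ {n : ℕ} (f : Fin (n + 1) → Fin (n + 1) → ℂ) :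
    pairProd f = (∏ j : Fin n, f 0 j.succ) * pairProd fun i j => f i.succ j.succ := by
  unfold pairProd
  rw [Fin.prod_univ_succ]
  simp [Fin.prod_univ_succ, Fin.succ_pos]

/-- The part of the component with all down spins to the right that does not depend on `β`. -/
def crossVal {n m : ℕ} (q : ℂ) (x : Fin n → ℂ) (y : Fin m → ℂ) : ℂ :=
  (pairProd fun i j => br (q * x i * x j) / br (q ^ 2 * x i * x j)) *
    ∏ i, ∏ l, (br (q * y l / x i) * br (q ^ 2 * x i * y l))⁻¹

/-- The value of the sum over residues for the component with all down spins to the right. -/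
def downVal {n m : ℕ} (q β : ℂ) (x : Fin n → ℂ) (y : Fin m → ℂ) : ℂ :=
  (-1) ^ (n * m) * (br q)⁻¹ ^ m * (∏ l, br (q * β * y l)) * crossVal q x y

/-! ### Closed form of the down-right sum by interpolation. -/

section
variable {n m : ℕ} {q : ℂ}

theorem crossVal_succ (x : Fin (n + 1) → ℂ) (y : Fin m → ℂ) :
    crossVal q x y = (∏ j : Fin n, br (q * x 0 * x j.succ) / br (q ^ 2 * x 0 * x j.succ)) *
      (∏ l, (br (q * y l / x 0) * br (q ^ 2 * x 0 * y l))⁻¹) * crossVal q (x ∘ Fin.succ) y := by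
  unfold crossVal
  rw [pairProd_succ, Fin.prod_univ_succ]
  simp only [Function.comp_apply]
  ring

theorem crossVal_castSucc (x : Fin n → ℂ) (y : Fin (m + 1) → ℂ) :
    crossVal q x y = crossVal q x (y ∘ Fin.castSucc) *
      ∏ i, (br (q * y (Fin.last m) / x i) * br (q ^ 2 * x i * y (Fin.last m)))⁻¹ := by
  unfold crossVal
  simp only [Fin.prod_univ_castSucc (n := m), Finset.prod_mul_distrib, Function.comp_apply]
  ring

theorem crossVal_comp_perm (x : Fin n → ℂ) (y : Fin m → ℂ) (σ : Equiv.Perm (Fin m)) :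
    crossVal q x (y ∘ σ) = crossVal q x y := by
  unfold crossVal
  congr 1
  refine Finset.prod_congr rfl fun i _ => ?_
  exact Equiv.prod_comp σ fun l => (br (q * y l / x i) * br (q ^ 2 * x i * y l))⁻¹

/-- The evaluation of all sums over residues with `n` up spins followed by `m` down spins. -/
def DownSumEval (q : ℂ) (n m : ℕ) : Prop :=
  ∀ (x : Fin n → ℂ) (y : Fin m → ℂ), Good3 q (Sum.elim x y) → ∀ β, β ≠ 0 →
    downSum q (fun w => br (β * w)) x y = downVal q β x y

/-- The empty sum is 1, while `crossVal` contains a product over pairs of up spins, which is empty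
exactly when n ≤ 1. -/
theorem downSumEval_zero (hn : n ≤ 1) : DownSumEval q n 0 := by
  intro x y _ β _
  have : n = 0 ∨ n = 1 := by omega
  rcases this with rfl | rfl <;> simp [downSum, resSum, downVal, crossVal, vdm, pairProd]

/-- Fusion reduces the left side to m down spins with parameter (q²y_last)⁻¹, where `hE` applies.
The resulting factors [qy_last/y_l] cancel against the product of node differences. -/
theorem prod_br_mul_downSum_last (hmn : m ≤ n) (hE : DownSumEval q n m) {x : Fin n → ℂ}
    {y : Fin (m + 1) → ℂ} (h : Good3 q (Sum.elim x y)) :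
    (∏ s, br (q ^ 2 * (q * y (Fin.last m)) * Sum.elim x y s)) *
      downSum q (fun w => (br (q ^ 2 * (q * y (Fin.last m)) * w))⁻¹) x y =
      (-1) ^ ((m + 1) * n) * (br q)⁻¹ ^ (m + 1) * crossVal q x y *
        ∏ i, br (q * (q * y (Fin.last m)) * x i) := by
  set yl := y (Fin.last m) with hyl
  have hq : q ≠ 0 := h.q_ne_zero (Sum.inr (Fin.last m))
  have hbq : br q ≠ 0 := h.br_q (Sum.inr (Fin.last m))
  have hyl0 : yl ≠ 0 := h.ne_zero (Sum.inr (Fin.last m))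
  have hy0 : ∀ l, y l ≠ 0 := fun l => h.ne_zero (Sum.inr l)
  have hx0 : ∀ i, x i ≠ 0 := fun i => h.ne_zero (Sum.inl i)
  have h3 : ∀ s, br (q ^ 2 * (q * yl) * Sum.elim x y s) ≠ 0 := fun s => by
    have := h.br_q3 (Sum.inr (Fin.last m)) s
    rwa [Sum.elim_inr, pow_succ, mul_assoc (q ^ 2) q] at this
  have hel : Sum.elim x (y ∘ Fin.castSucc) = Sum.elim x y ∘ Sum.map id Fin.castSucc := by
    ext (i | l) <;> rfl
  have hg' : Good3 q (Sum.elim x (y ∘ Fin.castSucc)) := by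
    rw [hel]
    exact h.comp (Function.injective_id.sumMap (Fin.castSucc_injective m))
  have hβ : (q ^ 2 * yl)⁻¹ ≠ 0 := inv_ne_zero (mul_ne_zero (pow_ne_zero _ hq) hyl0)
  rw [downSum_fusion h hmn, hE _ _ hg' _ hβ, downVal, crossVal_castSucc x y]
  have e1 : ∏ s, (xf q (Sum.elim x y s) - xf q (q * yl)) = (-1) ^ (n + m + 1) *
      ((∏ i, br (q * yl / x i)) * ((∏ l : Fin m, br (q * yl / y l.castSucc)) * br q)) *
      ∏ s, br (q ^ 2 * (q * yl) * Sum.elim x y s) := by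
    have : (∏ i, br (q * yl / x i)) * ((∏ l : Fin m, br (q * yl / y l.castSucc)) * br q) =
        ∏ s, br (q * yl / Sum.elim x y s) := by
      rw [Fintype.prod_sum_type, Fin.prod_univ_castSucc (n := m)]
      simp only [Sum.elim_inl, Sum.elim_inr]
      rw [← hyl, mul_div_assoc q yl yl, div_self hyl0, mul_one]
    rw [this]
    have hc : (-1 : ℂ) ^ (n + m + 1) = ∏ _s : Fin n ⊕ Fin (m + 1), (-1 : ℂ) := by
      simp [add_assoc]
    rw [hc, ← Finset.prod_mul_distrib, ← Finset.prod_mul_distrib]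
    refine Finset.prod_congr rfl fun s _ => ?_
    have := br_mul_br_eq_xf_sub_xf hq (mul_ne_zero hq hyl0) (h.ne_zero s)
    rw [mul_right_comm (q ^ 2)] at this
    linear_combination this
  have e2 : ∏ l : Fin m, br (q * (q ^ 2 * yl)⁻¹ * (y ∘ Fin.castSucc) l) =
      (-1) ^ m * ∏ l : Fin m, br (q * yl / y l.castSucc) := by
    rw [show (-1 : ℂ) ^ m = ∏ _l : Fin m, (-1 : ℂ) by simp, ← Finset.prod_mul_distrib]
    refine Finset.prod_congr rfl fun l _ => ?_
    have := hy0 l.castSucc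
    rw [neg_one_mul, ← br_inv, Function.comp_apply]
    congr 1
    field_simp
  have e3 : ∏ i, br (q * (q * yl) * x i) = ∏ i, br (q ^ 2 * x i * yl) :=
    Finset.prod_congr rfl fun i _ => by congr 1; ring
  have e4 : ∏ i, (br (q * yl / x i) * br (q ^ 2 * x i * yl))⁻¹ =
      (∏ i, br (q * yl / x i))⁻¹ * (∏ i, br (q ^ 2 * x i * yl))⁻¹ := by
    rw [← Finset.prod_inv_distrib, ← Finset.prod_inv_distrib, ← Finset.prod_mul_distrib]
    exact Finset.prod_congr rfl fun i _ => by rw [mul_inv]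
  have n1 : ∏ i, br (q * yl / x i) ≠ 0 :=
    Finset.prod_ne_zero_iff.2 fun i _ => h.br_q_div (Sum.inr (Fin.last m)) (Sum.inl i)
  have n2 : ∏ i, br (q ^ 2 * x i * yl) ≠ 0 :=
    Finset.prod_ne_zero_iff.2 fun i _ => h.br_mul (Sum.inl i) (Sum.inr (Fin.last m))
  have n3 : ∏ l : Fin m, br (q * yl / y l.castSucc) ≠ 0 :=
    Finset.prod_ne_zero_iff.2 fun l _ => h.br_q_div (Sum.inr (Fin.last m)) (Sum.inr l.castSucc)
  have n4 : ∏ s, br (q ^ 2 * (q * yl) * Sum.elim x y s) ≠ 0 :=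
    Finset.prod_ne_zero_iff.2 fun s _ => h3 s
  rw [e1, e2, e3, e4]
  have hs : ((-1 : ℂ) ^ (n + m + 1))⁻¹ = (-1) ^ (n + m + 1) := by
    rw [← inv_pow, inv_neg_one]
  have hs2 : -((-1 : ℂ) ^ (n + m + 1) * ((-1) ^ (n * m) * (-1) ^ m)) = (-1) ^ ((m + 1) * n) := by
    rw [show -((-1 : ℂ) ^ (n + m + 1) * ((-1) ^ (n * m) * (-1) ^ m)) =
      (-1) ^ ((m + 1) * n) * ((-1) ^ m * (-1) ^ m) by ring, ← mul_pow]
    simp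
  rw [← hs2]
  simp only [mul_inv, hs, pow_succ (br q)⁻¹ m]
  generalize (br q)⁻¹ ^ m = B
  generalize (∏ i, br (q * yl / x i)) = A1 at *
  generalize (∏ i, br (q ^ 2 * x i * yl)) = A2 at *
  generalize (∏ l : Fin m, br (q * yl / y l.castSucc)) = A3 at *
  generalize (∏ s, br (q ^ 2 * (q * yl) * Sum.elim x y s)) = A4 at *
  field_simp

theorem prod_br_mul_downSum (hmn : m ≤ n) (hE : DownSumEval q n m) {x : Fin n → ℂ}
    {y : Fin (m + 1) → ℂ} (h : Good3 q (Sum.elim x y)) (l : Fin (m + 1)) :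
    (∏ s, br (q ^ 2 * (q * y l) * Sum.elim x y s)) *
      downSum q (fun w => (br (q ^ 2 * (q * y l) * w))⁻¹) x y =
      (-1) ^ ((m + 1) * n) * (br q)⁻¹ ^ (m + 1) * crossVal q x y *
        ∏ i, br (q * (q * y l) * x i) := by
  have hel : Sum.elim x (y ∘ Equiv.swap l (Fin.last m)) =
      Sum.elim x y ∘ (Equiv.sumCongr (Equiv.refl _) (Equiv.swap l (Fin.last m))) := by
    ext (i | l) <;> rfl
  have h' : Good3 q (Sum.elim x (y ∘ Equiv.swap l (Fin.last m))) := by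
    rw [hel]
    exact h.comp (Equiv.injective _)
  have := prod_br_mul_downSum_last hmn hE h'
  rw [downSum_comp_perm _ h.toGood, crossVal_comp_perm, Function.comp_apply,
    Equiv.swap_apply_right, hel] at this
  rw [← this]
  congr 1
  exact (Equiv.prod_comp (Equiv.sumCongr (Equiv.refl _) (Equiv.swap l (Fin.last m)))
    fun s => br (q ^ 2 * (q * y l) * Sum.elim x y s)).symm

open Polynomial in
-- `hE` determines the polynomial in β² at every nonzero argument, each of which is a square, hence
-- also its constant term.
theorem downSum_inv_eq (hE : DownSumEval q n m) {x : Fin n → ℂ} {y : Fin m → ℂ} (hq : q ≠ 0)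
    (h : Good3 q (Sum.elim x y)) :
    downSum q (fun w => w⁻¹) x y =
      (-1) ^ (n * m) * (br q)⁻¹ ^ m * (∏ l, (q * y l)⁻¹) * crossVal q x y := by
  obtain ⟨p, -, hp, hp0⟩ := exists_poly_downSum (q := q) x y
  set p' : ℂ[X] := C ((-1) ^ (n * m) * (br q)⁻¹ ^ m * crossVal q x y) *
    ∏ l, (C (q * y l) * X - C (q * y l)⁻¹) with hp'
  have heq : p = p' := by
    refine Polynomial.eq_of_infinite_eval_eq _ _
      (Set.Infinite.mono ?_ (Set.finite_singleton (0 : ℂ)).infinite_compl)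
    intro u hu
    obtain ⟨β, hβ⟩ := IsAlgClosed.exists_pow_nat_eq u two_pos
    have hβ0 : β ≠ 0 := by
      rintro rfl
      exact hu (by simpa using hβ.symm)
    rw [Set.mem_ofPred_eq, ← hβ, ← hp β hβ0, hE x y h β hβ0, downVal, hp']
    have : β ^ m * ∏ l, br (q * β * y l) = ∏ l, (q * y l * β ^ 2 - (q * y l)⁻¹) := by
      rw [show β ^ m = ∏ _k : Fin m, β by simp, ← Finset.prod_mul_distrib]
      refine Finset.prod_congr rfl fun l _ => ?_
      have := h.ne_zero (Sum.inr l)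
      rw [Sum.elim_inr] at this
      unfold br
      field_simp
    simp only [eval_mul, eval_C, eval_prod, eval_sub, eval_X]
    rw [← this]
    ring
  rw [heq, hp'] at hp0
  simp only [eval_mul, eval_C, eval_prod, eval_sub, eval_X, mul_zero, zero_sub,
    Finset.prod_neg, Finset.card_univ, Fintype.card_fin] at hp0
  have hs : ((-1 : ℂ) ^ m) ≠ 0 := pow_ne_zero _ (by norm_num)
  refine mul_left_cancel₀ hs ?_
  rw [← hp0]
  ring

open Polynomial in
-- Both sides are, up to tⁿ, polynomials of degree at most n in t⁻², and they agree at the m + 1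
-- points t = q y_l. This suffices for n = m; for n = m + 1 one more point is needed, and the value
-- at t⁻² = 0 is supplied by the square case.
theorem prod_br_mul_downSum_eq (hmn : n = m ∨ n = m + 1 ∧ DownSumEval q n (m + 1))
    (hE : DownSumEval q n m) {x : Fin n → ℂ} {y : Fin (m + 1) → ℂ}
    (h : Good3 q (Sum.elim x y)) {t : ℂ} (ht : t ≠ 0)
    (hts : ∀ s, br (q ^ 2 * t * Sum.elim x y s) ≠ 0) :
    (∏ s, br (q ^ 2 * t * Sum.elim x y s)) *
      downSum q (fun w => (br (q ^ 2 * t * w))⁻¹) x y =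
      (-1) ^ ((m + 1) * n) * (br q)⁻¹ ^ (m + 1) * crossVal q x y * ∏ i, br (q * t * x i) := by
  have hq : q ≠ 0 := h.q_ne_zero (Sum.inr (Fin.last m))
  have hy0 : ∀ l, y l ≠ 0 := fun l => h.ne_zero (Sum.inr l)
  have hx0 : ∀ i, x i ≠ 0 := fun i => h.ne_zero (Sum.inl i)
  obtain ⟨p, hpd, hp, hp0⟩ := exists_poly_downSum_inv hq h.ne_zero
  set K := (-1) ^ ((m + 1) * n) * (br q)⁻¹ ^ (m + 1) * crossVal q x y with hK
  set p' : ℂ[X] := C K * ∏ i, (C (-(q * x i)⁻¹) * X + C (q * x i)) with hp'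
  have hpd' : p'.natDegree ≤ n := by
    refine (natDegree_C_mul_le _ _).trans ((natDegree_prod_le _ _).trans ?_)
    exact (Finset.sum_le_sum (g := fun _ => 1) fun k _ => natDegree_linear_le).trans (by simp)
  have hev : ∀ t, t ≠ 0 → t ^ n * p'.eval (t ^ 2)⁻¹ = K * ∏ i, br (q * t * x i) := by
    intro t ht
    have : t ^ n * ∏ i, (-(q * x i)⁻¹ * (t ^ 2)⁻¹ + q * x i) = ∏ i, br (q * t * x i) := by
      rw [show t ^ n = ∏ _i : Fin n, t by simp, ← Finset.prod_mul_distrib]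
      refine Finset.prod_congr rfl fun i _ => ?_
      have := hx0 i
      unfold br
      field_simp
      ring
    simp only [hp', eval_mul, eval_C, eval_prod, eval_add, eval_X]
    rw [← this]
    ring
  have hyq : ∀ l, q * y l ≠ 0 := fun l => mul_ne_zero hq (hy0 l)
  have hval : ∀ l, p.eval ((q * y l) ^ 2)⁻¹ = p'.eval ((q * y l) ^ 2)⁻¹ := by
    intro l
    refine mul_left_cancel₀ (pow_ne_zero n (hyq l)) ?_
    rw [hev _ (hyq l), ← hp _ (hyq l)]
    · exact prod_br_mul_downSum (by omega) hE h l
    · intro s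
      have := h.br_q3 (Sum.inr l) s
      rwa [Sum.elim_inr, pow_succ, mul_assoc (q ^ 2) q] at this
  have hinj : Function.Injective fun l => ((q * y l) ^ 2)⁻¹ := by
    intro l l' hl
    by_contra hne
    refine sq_ne_sq_of_br (hy0 l') (h.br_div (Sum.inr l) (Sum.inr l') (by simpa using hne)) ?_
    have := inv_injective hl
    rw [mul_pow, mul_pow] at this
    exact mul_left_cancel₀ (pow_ne_zero 2 hq) this
  have heq : p = p' := by
    rcases hmn with rfl | ⟨rfl, hE'⟩
    · refine Polynomial.eq_of_natDegree_lt_card_of_eval_eq _ _ hinj hval ?_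
      rw [Fintype.card_fin]
      omega
    · refine Polynomial.eq_of_natDegree_lt_card_of_eval_eq _ _
        (f := fun o : Option (Fin (m + 1)) => o.elim 0 fun l => ((q * y l) ^ 2)⁻¹) ?_ ?_ ?_
      · rintro (_ | l) (_ | l') hl
        · rfl
        · exact absurd hl.symm (inv_ne_zero (pow_ne_zero 2 (hyq l')))
        · exact absurd hl (inv_ne_zero (pow_ne_zero 2 (hyq l)))
        · exact congrArg some (hinj hl)
      · rintro (_ | l)
        · simp only [Option.elim]
          rw [hp0, downSum_inv_eq hE' hq h, hp']
          simp only [eval_mul, eval_C, eval_prod, eval_add, eval_X, mul_zero, zero_add]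
          rw [Fintype.prod_sum_type]
          simp only [Sum.elim_inl, Sum.elim_inr]
          have e : (∏ l, y l) * ∏ l, (q * y l)⁻¹ = (q ^ (m + 1))⁻¹ := by
            rw [← Finset.prod_mul_distrib, ← inv_pow, ← Fin.prod_const]
            refine Finset.prod_congr rfl fun l _ => ?_
            have := hy0 l
            field_simp
          have e' : ∏ i, q * x i = q ^ (m + 1) * ∏ i, x i := by
            rw [Finset.prod_mul_distrib, Fin.prod_const]
          have e2 : (q ^ 2) ^ (m + 1) * (q ^ (m + 1))⁻¹ = q ^ (m + 1) := by
            rw [← pow_mul, two_mul, pow_add, mul_inv_cancel_right₀ (pow_ne_zero _ hq)]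
          rw [e', hK, ← e2, ← e]
          ring
        · exact hval l
      · rw [Fintype.card_option, Fintype.card_fin]
        omega
  rw [hp t ht hts, heq, hev t ht]

open Polynomial in
-- One step adds an up spin and a down spin: the zeros in β give the shape ∏ [qβy_l], and the value
-- at β = x_0⁻¹ gives the constant.
theorem downSumEval_succ (hmn : n = m ∨ n = m + 1 ∧ DownSumEval q n (m + 1))
    (hE : DownSumEval q n m) : DownSumEval q (n + 1) (m + 1) := by
  intro x y h β hβ
  have hq : q ≠ 0 := h.q_ne_zero (Sum.inl 0)
  have hbq : br q ≠ 0 := h.br_q (Sum.inl 0)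
  have hy0 : ∀ l, y l ≠ 0 := fun l => h.ne_zero (Sum.inr l)
  have hx0 : x 0 ≠ 0 := h.ne_zero (Sum.inl 0)
  have hyq : ∀ l, q * y l ≠ 0 := fun l => mul_ne_zero hq (hy0 l)
  have hel : Sum.elim (x ∘ Fin.succ) y = Sum.elim x y ∘ Sum.map Fin.succ id := by
    ext (i | l) <;> rfl
  have hg' : Good3 q (Sum.elim (x ∘ Fin.succ) y) := by
    rw [hel]
    exact h.comp ((Fin.succ_injective n).sumMap Function.injective_id)
  have hts : ∀ s, br (q ^ 2 * x 0 * Sum.elim (x ∘ Fin.succ) y s) ≠ 0 := by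
    intro s
    rw [hel]
    exact h.br_mul (Sum.inl 0) _
  have hH := prod_br_mul_downSum_eq hmn hE hg' hx0 hts
  have hD := downSum_remove_up h.toGood
  have hr : ∏ l, br (q * (x 0)⁻¹ * y l) ≠ 0 := by
    refine Finset.prod_ne_zero_iff.2 fun l _ => ?_
    have := h.br_q_div (Sum.inr l) (Sum.inl 0)
    rw [Sum.elim_inr, Sum.elim_inl] at this
    rwa [mul_right_comm, ← div_eq_mul_inv]
  obtain ⟨p, hpd, hp, -⟩ := exists_poly_downSum (q := q) x y
  set K := downSum q (fun w => br ((x 0)⁻¹ * w)) x y / ∏ l, br (q * (x 0)⁻¹ * y l) with hK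
  set p' : ℂ[X] := C K * ∏ l, (C (q * y l) * X + C (-(q * y l)⁻¹)) with hp'
  have hpd' : p'.natDegree ≤ m + 1 := by
    refine (natDegree_C_mul_le _ _).trans ((natDegree_prod_le _ _).trans ?_)
    exact (Finset.sum_le_sum (g := fun _ => 1) fun k _ => natDegree_linear_le).trans (by simp)
  have hev : ∀ β, β ≠ 0 → p'.eval (β ^ 2) = β ^ (m + 1) * (K * ∏ l, br (q * β * y l)) := by
    intro β hβ
    have : β ^ (m + 1) * ∏ l, br (q * β * y l) = ∏ l, (q * y l * β ^ 2 + -(q * y l)⁻¹) := by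
      rw [← Fin.prod_const, ← Finset.prod_mul_distrib]
      refine Finset.prod_congr rfl fun l _ => ?_
      have := hy0 l
      unfold br
      field_simp
      ring
    simp only [hp', eval_mul, eval_C, eval_prod, eval_add, eval_X]
    rw [← this]
    ring
  -- The degree is at most m + 1, and there are m + 2 nodes: the m + 1 zeros (qy_l)⁻² and the
  -- normalising point x_0⁻².
  have heq : p = p' := by
    refine Polynomial.eq_of_natDegree_lt_card_of_eval_eq _ _
      (f := fun o : Option (Fin (m + 1)) =>
        o.elim ((x 0)⁻¹ ^ 2) fun l => (q * y l)⁻¹ ^ 2) ?_ ?_ ?_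
    · have hxy : ∀ l, (x 0)⁻¹ ^ 2 ≠ (q * y l)⁻¹ ^ 2 := by
        intro l hl
        rw [inv_pow, inv_pow] at hl
        exact sq_ne_sq_of_br hx0 (h.br_q_div (Sum.inr l) (Sum.inl 0)) (inv_injective hl).symm
      rintro (_ | l) (_ | l') hl
      · rfl
      · exact absurd hl (hxy l')
      · exact absurd hl.symm (hxy l)
      · simp only [Option.elim, inv_pow] at hl
        have hl := inv_injective hl
        rw [mul_pow, mul_pow] at hl
        by_contra hne
        exact sq_ne_sq_of_br (hy0 l') (h.br_div (Sum.inr l) (Sum.inr l')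
          (by intro h'; exact hne (by rw [Sum.inr_injective h'])))
          (mul_left_cancel₀ (pow_ne_zero 2 hq) hl)
    · rintro (_ | l)
      · simp only [Option.elim]
        rw [← hp _ (inv_ne_zero hx0), hev _ (inv_ne_zero hx0), hK, div_mul_cancel₀ _ hr]
      · simp only [Option.elim]
        rw [← hp _ (inv_ne_zero (hyq l)), hev _ (inv_ne_zero (hyq l)),
          downSum_eq_zero h.toGood (by omega) l,
          Finset.prod_eq_zero (Finset.mem_univ l)]
        · ring
        · rw [mul_right_comm, mul_inv_cancel₀ (hyq l), br_one]
    · rw [Fintype.card_option, Fintype.card_fin]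
      omega
  have hfin := hp β hβ
  rw [heq, hev β hβ] at hfin
  rw [mul_left_cancel₀ (pow_ne_zero _ hβ) hfin, hK, hD, downVal, crossVal_succ]
  have n1 : ∏ s, br (q ^ 2 * x 0 * Sum.elim (x ∘ Fin.succ) y s) ≠ 0 :=
    Finset.prod_ne_zero_iff.2 fun s _ => hts s
  have e0 : downSum q (fun w => (br (q ^ 2 * x 0 * w))⁻¹) (x ∘ Fin.succ) y = _ :=
    eq_div_of_mul_eq n1 ((mul_comm _ _).trans hH)
  have e1 : ∏ s, br (q ^ 2 * x 0 * Sum.elim (x ∘ Fin.succ) y s) =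
      (∏ j : Fin n, br (q ^ 2 * x 0 * x j.succ)) * ∏ l, br (q ^ 2 * x 0 * y l) := by
    rw [Fintype.prod_sum_type]; rfl
  have e2 : ∏ l, (br (q * y l / x 0) * br (q ^ 2 * x 0 * y l))⁻¹ =
      (∏ l, br (q * (x 0)⁻¹ * y l))⁻¹ * (∏ l, br (q ^ 2 * x 0 * y l))⁻¹ := by
    rw [← Finset.prod_inv_distrib, ← Finset.prod_inv_distrib, ← Finset.prod_mul_distrib]
    refine Finset.prod_congr rfl fun l _ => ?_
    rw [mul_inv, mul_right_comm q (x 0)⁻¹, div_eq_mul_inv (q * y l)]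
  rw [e0, e1, e2, Finset.prod_div_distrib]
  have hs : (-1 : ℂ) ^ ((n + 1) * (m + 1)) = (-1) ^ (m + 1) * (-1) ^ ((m + 1) * n) := by ring
  rw [hs]
  simp only [Function.comp_apply]
  rw [div_eq_mul_inv, div_eq_mul_inv, div_eq_mul_inv, mul_inv]
  ring

/-- The two families must advance together: the new square case is itself an input for the new case
with one extra up spin. -/
theorem downSumEval_self_and_succ (q : ℂ) (m : ℕ) :
    DownSumEval q m m ∧ DownSumEval q (m + 1) m := by
  induction m with
  | zero => exact ⟨downSumEval_zero zero_le_one, downSumEval_zero le_rfl⟩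
  | succ m ih =>
    have h1 := downSumEval_succ (Or.inl rfl) ih.1
    exact ⟨h1, downSumEval_succ (Or.inr ⟨rfl, h1⟩) ih.2⟩

end

/-! ### Products over blocks of sites -/

theorem pairProd_congr {n : ℕ} {f g : Fin n → Fin n → ℂ} (h : ∀ i j, i < j → f i j = g i j) :
    pairProd f = pairProd g := by
  unfold pairProd
  refine Finset.prod_congr rfl fun i _ => Finset.prod_congr rfl fun j _ => ?_
  split_ifs with hij
  · exact h i j hij
  · rfl

theorem pairProd_add {n m : ℕ} (f : Fin (n + m) → Fin (n + m) → ℂ) :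
    pairProd f = (pairProd fun i j => f (Fin.castAdd m i) (Fin.castAdd m j)) *
      (∏ i, ∏ l, f (Fin.castAdd m i) (Fin.natAdd n l)) *
      pairProd fun k l => f (Fin.natAdd n k) (Fin.natAdd n l) := by
  have h1 : ∀ (i : Fin n) (j : Fin m), Fin.castAdd m i < Fin.natAdd n j := by
    intro i j; rw [Fin.lt_def, Fin.val_castAdd, Fin.val_natAdd]; omega
  have h2 : ∀ (i : Fin n) (j : Fin m), ¬Fin.natAdd n j < Fin.castAdd m i := fun i j =>
    (h1 i j).not_gt
  have h3 : ∀ i j : Fin n, Fin.castAdd m i < Fin.castAdd m j ↔ i < j := fun i j => Iff.rfl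
  have h4 : ∀ i j : Fin m, Fin.natAdd n i < Fin.natAdd n j ↔ i < j := by
    intro i j; simp only [Fin.lt_def, Fin.val_natAdd]; omega
  simp only [pairProd, Fin.prod_univ_add, h1, h2, h3, h4, if_true, if_false,
    Finset.prod_const_one, mul_one, Finset.prod_mul_distrib]
  rw [mul_assoc]

theorem pairProd_castSucc {n : ℕ} (f : Fin (n + 1) → Fin (n + 1) → ℂ) :
    pairProd f = (pairProd fun i j => f i.castSucc j.castSucc) *
      ∏ i : Fin n, f i.castSucc (Fin.last n) := by
  unfold pairProd
  rw [Fin.prod_univ_castSucc]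
  simp [Fin.prod_univ_castSucc, Fin.castSucc_lt_last, Finset.prod_mul_distrib, Fin.le_last,
    Fin.not_lt.2]

theorem prod_Iio_eq_pairProd {n : ℕ} (f : Fin n → Fin n → ℂ) :
    ∏ i, ∏ j ∈ Finset.Iio i, f i j = pairProd fun i j => f j i := by
  unfold pairProd
  rw [Finset.prod_comm]
  refine Finset.prod_congr rfl fun i _ => ?_
  rw [← Finset.prod_filter]
  congr 1
  ext j; simp

theorem prod_Ioi_natAdd {n m : ℕ} (k : Fin m) (f : Fin (n + m) → ℂ) :
    ∏ j ∈ Finset.Ioi (Fin.natAdd n k), f j = ∏ l ∈ Finset.Ioi k, f (Fin.natAdd n l) := by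
  have h1 : Finset.Ioi (Fin.natAdd n k) =
      Finset.univ.filter fun j => Fin.natAdd n k < j := by ext; simp
  have h2 : Finset.Ioi k = Finset.univ.filter fun j => k < j := by ext; simp
  rw [h1, h2, Finset.prod_filter, Finset.prod_filter, Fin.prod_univ_add]
  have h3 : ∀ i : Fin n, ¬Fin.natAdd n k < Fin.castAdd m i := by
    intro i; rw [Fin.lt_def, Fin.val_castAdd, Fin.val_natAdd]; omega
  have h4 : ∀ l : Fin m, Fin.natAdd n k < Fin.natAdd n l ↔ k < l := by
    intro l; simp only [Fin.lt_def, Fin.val_natAdd]; omega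
  simp [h3, h4]

theorem prod_Ioi_castAdd {n m : ℕ} (k : Fin n) (f : Fin (n + m) → ℂ) :
    ∏ j ∈ Finset.Ioi (Fin.castAdd m k), f j =
      (∏ l ∈ Finset.Ioi k, f (Fin.castAdd m l)) * ∏ i, f (Fin.natAdd n i) := by
  have h1 : Finset.Ioi (Fin.castAdd m k) =
      Finset.univ.filter fun j => Fin.castAdd m k < j := by ext; simp
  have h2 : Finset.Ioi k = Finset.univ.filter fun j => k < j := by ext; simp
  rw [h1, h2, Finset.prod_filter, Finset.prod_filter, Fin.prod_univ_add]
  have h3 : ∀ i : Fin m, Fin.castAdd m k < Fin.natAdd n i := by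
    intro i; rw [Fin.lt_def, Fin.val_castAdd, Fin.val_natAdd]; omega
  have h4 : ∀ l : Fin n, Fin.castAdd m k < Fin.castAdd m l ↔ k < l := fun l => Iff.rfl
  simp [h3, h4]

theorem phi_natAdd {n m : ℕ} (q : ℂ) (z : Fin (n + m) → ℂ) (k : Fin m) (w : ℂ) :
    phi q z (Fin.natAdd n k) w = phi q (z ∘ Fin.natAdd n) k w := by
  rw [phi, phi, Ici_eq_insert, Ici_eq_insert, Finset.prod_insert (by simp),
    Finset.prod_insert (by simp), prod_Ioi_natAdd, prod_Ioi_natAdd]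
  rfl

/-- The pair factors between two down spins. -/
def downPair (q : ℂ) {n : ℕ} (z : Fin n → ℂ) : ℂ :=
  pairProd fun i j => br (q * z j / z i) * br (q * z i * z j)

/-- The component with all down spins to the right. -/
theorem Phi_natAdd {n m : ℕ} (hnm : n = m ∨ n = m + 1) {q β : ℂ} {z : Fin (n + m) → ℂ}
    (h : Good3 q z) (hβ : β ≠ 0) :
    Phi q β z (Fin.natAdd n : Fin m → Fin (n + m)) = (-1) ^ (n * m) *
      (∏ l, br (q * β * z (Fin.natAdd n l))) * downPair q (z ∘ Fin.castAdd m) *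
        pref q (z ∘ Fin.natAdd n) := by
  rcases Nat.eq_zero_or_pos (n + m) with h0 | h0
  · obtain ⟨rfl, rfl⟩ : n = 0 ∧ m = 0 := by omega
    simp [Phi, pref, downPair, pairProd, resSum, vdm]
  have hbq : br q ≠ 0 := h.br_q ⟨0, h0⟩
  have hE : DownSumEval q n m := by
    rcases hnm with rfl | rfl
    · exact (downSumEval_self_and_succ q _).1
    · exact (downSumEval_self_and_succ q _).2
  have hel : Sum.elim (z ∘ Fin.castAdd m) (z ∘ Fin.natAdd n) = z ∘ finSumFinEquiv := by
    ext (i | l) <;> simp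
  have hsum : resSum q z (fun k s => phi q z (Fin.natAdd n k) (z s) * br (β * z s)) =
      downSum q (fun w => br (β * w)) (z ∘ Fin.castAdd m) (z ∘ Fin.natAdd n) := by
    rw [downSum, hel, ← resSum_comp_equiv q z finSumFinEquiv]
    exact resSum_congr fun k s => by rw [phi_natAdd]; rfl
  have hg : Good3 q (Sum.elim (z ∘ Fin.castAdd m) (z ∘ Fin.natAdd n)) := by
    rw [hel]; exact h.comp (Equiv.injective _)
  rw [Phi, hsum, hE _ _ hg β hβ, downVal, crossVal, pref, pairProd_add]
  have e1 : (∏ i, ∏ l, br (q * z (Fin.natAdd n l) / z (Fin.castAdd m i)) *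
      br (q ^ 2 * z (Fin.castAdd m i) * z (Fin.natAdd n l))) *
      ∏ i, ∏ l, (br (q * (z ∘ Fin.natAdd n) l / (z ∘ Fin.castAdd m) i) *
        br (q ^ 2 * (z ∘ Fin.castAdd m) i * (z ∘ Fin.natAdd n) l))⁻¹ = 1 := by
    simp only [← Finset.prod_mul_distrib]
    refine Finset.prod_eq_one fun i _ => Finset.prod_eq_one fun l _ => ?_
    exact mul_inv_cancel₀ (mul_ne_zero (h.br_q_div _ _) (h.br_mul _ _))
  have e2 : (pairProd fun i j => br (q * z (Fin.castAdd m j) / z (Fin.castAdd m i)) *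
      br (q ^ 2 * z (Fin.castAdd m i) * z (Fin.castAdd m j))) *
      (pairProd fun i j => br (q * (z ∘ Fin.castAdd m) i * (z ∘ Fin.castAdd m) j) /
        br (q ^ 2 * (z ∘ Fin.castAdd m) i * (z ∘ Fin.castAdd m) j)) =
      downPair q (z ∘ Fin.castAdd m) := by
    rw [← pairProd_mul]
    refine pairProd_congr fun i j _ => ?_
    have := h.br_mul (Fin.castAdd m i) (Fin.castAdd m j)
    simp only [Function.comp_apply]
    rw [mul_assoc, mul_div_cancel₀ _ this]
  have e3 : br q ^ m * (br q)⁻¹ ^ m = 1 := by rw [← mul_pow, mul_inv_cancel₀ hbq, one_pow]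
  rw [← e2]
  simp only [Function.comp_apply, pref] at e1 ⊢
  generalize (∏ i, ∏ l, br (q * z (Fin.natAdd n l) / z (Fin.castAdd m i)) *
      br (q ^ 2 * z (Fin.castAdd m i) * z (Fin.natAdd n l))) = A at *
  generalize (∏ i, ∏ l, (br (q * z (Fin.natAdd n l) / z (Fin.castAdd m i)) *
        br (q ^ 2 * z (Fin.castAdd m i) * z (Fin.natAdd n l)))⁻¹) = B at *
  generalize (pairProd fun i j => br (q * z (Fin.castAdd m j) / z (Fin.castAdd m i)) *
      br (q ^ 2 * z (Fin.castAdd m i) * z (Fin.castAdd m j))) = C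
  generalize (pairProd fun i j => br (q * z (Fin.castAdd m i) * z (Fin.castAdd m j)) /
      br (q ^ 2 * z (Fin.castAdd m i) * z (Fin.castAdd m j))) = D
  generalize (pairProd fun k l => br (q * z (Fin.natAdd n l) / z (Fin.natAdd n k)) *
      br (q ^ 2 * z (Fin.natAdd n k) * z (Fin.natAdd n l))) = E
  generalize (∏ l, br (q * β * z (Fin.natAdd n l))) = F
  generalize br q ^ m = G at *
  generalize (br q)⁻¹ ^ m = H at *
  linear_combination (-1) ^ (n * m) * F * C * D * E * (A * B * e3 + e1)

/-- The component with all down spins to the left. -/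
theorem Phi_castAdd {n m : ℕ} {q β : ℂ} {z : Fin (n + m) → ℂ} (h : Good q z) :
    Phi q β z (Fin.castAdd m : Fin n → Fin (n + m)) =
      downPair q (z ∘ Fin.castAdd m) * pref q (z ∘ Fin.natAdd n) *
        ∏ k, br (β * z (Fin.castAdd m k)) := by
  rcases Nat.eq_zero_or_pos (n + m) with h0 | h0
  · obtain ⟨rfl, rfl⟩ : n = 0 ∧ m = 0 := by omega
    simp [Phi, pref, downPair, pairProd, resSum, vdm]
  have hbq : br q ≠ 0 := h.br_q ⟨0, h0⟩
  have hq : q ≠ 0 := h.q_ne_zero ⟨0, h0⟩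
  -- Triangularity: `phi` at position k vanishes on the nodes to its right, so c k ≤ k, and `vdm`
  -- forces c to be injective. Only the identical choice survives.
  have hone : resSum q z (fun k s => phi q z (Fin.castAdd m k) (z s) * br (β * z s)) =
      (∏ k : Fin n, (mu q z (Fin.castAdd m k))⁻¹ * (phi q z (Fin.castAdd m k)
        (z (Fin.castAdd m k)) * br (β * z (Fin.castAdd m k)))) * vdm q (z ∘ Fin.castAdd m) := by
    unfold resSum
    refine Finset.sum_eq_single_of_mem _ (Finset.mem_univ _) fun c _ hc => ?_
    by_contra hne
    rw [← Ne, mul_ne_zero_iff, Finset.prod_ne_zero_iff] at hne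
    obtain ⟨h1, h2⟩ := hne
    have hle : ∀ k, (c k).val ≤ k.val := by
      intro k
      by_contra hlt
      have h3 := h1 k (Finset.mem_univ k)
      rw [mul_ne_zero_iff, mul_ne_zero_iff, phi, div_ne_zero_iff, Finset.prod_ne_zero_iff] at h3
      refine h3.2.1.1 (c k) ?_ (by rw [div_self (h.1 _), br_one])
      rw [Finset.mem_Ioi, Fin.lt_def, Fin.val_castAdd]
      omega
    have hinj : ∀ k l, k < l → c k ≠ c l := by
      intro k l hkl hcl
      refine h2 ?_
      rw [vdm, pairProd]
      refine Finset.prod_eq_zero (Finset.mem_univ k) (Finset.prod_eq_zero (Finset.mem_univ l) ?_)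
      simp [hkl, hcl]
    refine hc (funext fun k => Fin.ext ?_)
    rw [Fin.val_castAdd]
    induction hk : k.val using Nat.strong_induction_on generalizing k with
    | _ j ih =>
      subst hk
      refine le_antisymm (hle k) ?_
      by_contra hlt
      rw [not_le] at hlt
      have h5 := ih (c k).val hlt ⟨(c k).val, hlt.trans k.isLt⟩ rfl
      exact hinj ⟨(c k).val, hlt.trans k.isLt⟩ k (by rw [Fin.lt_def]; exact hlt) (Fin.ext h5)
  set y := z ∘ Fin.castAdd m with hy
  set x := z ∘ Fin.natAdd n with hx
  have hmu : ∀ k : Fin n, mu q z (Fin.castAdd m k) =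
      (∏ l ∈ Finset.Ioi k, (xf q (y l) - xf q (y k))) *
        (∏ l ∈ Finset.Iio k, (xf q (y l) - xf q (y k))) *
          ∏ i, (br (x i / y k) * br (q ^ 2 * y k * x i)) := by
    intro k
    have h1 : Finset.univ.erase (Fin.castAdd m k) =
        ((Finset.Ioi k ∪ Finset.Iio k).map (Fin.castAddEmb m)) ∪
          Finset.univ.map (Fin.natAddEmb n) := by
      ext j
      simp only [Finset.mem_erase, Finset.mem_univ, and_true, Finset.mem_union, Finset.mem_map,
        Finset.mem_Ioi, Finset.mem_Iio, Fin.castAddEmb_apply, Fin.natAddEmb_apply, true_and]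
      refine Fin.addCases (fun l => ?_) (fun i => ?_) j
      · have : ∀ i : Fin m, Fin.natAdd n i ≠ Fin.castAdd m l := by
          intro i; rw [Ne, Fin.ext_iff, Fin.val_castAdd, Fin.val_natAdd]; omega
        simp only [this, exists_false, or_false, (Fin.castAdd_injective n m).eq_iff,
          exists_eq_right, Ne]
        rw [or_comm, ← Ne, ne_iff_lt_or_gt]
      · have : ∀ l : Fin n, Fin.castAdd m l ≠ Fin.natAdd n i := by
          intro l; rw [Ne, Fin.ext_iff, Fin.val_castAdd, Fin.val_natAdd]; omega
        simp [(this k).symm]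
    rw [mu, h1, Finset.prod_union, Finset.prod_map, Finset.prod_map, Finset.prod_union]
    · congr 1
      refine Finset.prod_congr rfl fun i _ => ?_
      exact (br_mul_br_eq_xf_sub_xf hq (h.1 (Fin.natAdd n i)) (h.1 (Fin.castAdd m k))).symm
    · rw [Finset.disjoint_left]; intro j hj hj'
      rw [Finset.mem_Ioi] at hj; rw [Finset.mem_Iio] at hj'
      exact absurd hj hj'.not_gt
    · rw [Finset.disjoint_left]; intro j hj hj'
      rw [Finset.mem_map] at hj hj'
      obtain ⟨l, -, rfl⟩ := hj
      obtain ⟨i, -, hi⟩ := hj'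
      have := congrArg Fin.val hi
      simp at this
      omega
  have hphi : ∀ k : Fin n, phi q z (Fin.castAdd m k) (y k) =
      (∏ l ∈ Finset.Ioi k, br (y l / y k) / br (q * y l / y k)) * (br q)⁻¹ *
        ∏ i, br (x i / y k) / br (q * x i / y k) := by
    intro k
    rw [phi, Ici_eq_insert, Finset.prod_insert (by simp), prod_Ioi_castAdd, prod_Ioi_castAdd]
    have : q * z (Fin.castAdd m k) / y k = q := by
      rw [mul_div_assoc]
      have : z (Fin.castAdd m k) / y k = 1 := div_self (h.1 _)
      rw [this, mul_one]
    rw [this, Finset.prod_div_distrib, Finset.prod_div_distrib]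
    simp only [hx, hy, Function.comp_apply]
    simp only [div_eq_mul_inv, mul_inv]
    ring
  have hz : ∀ k, z (Fin.castAdd m k) = y k := fun _ => rfl
  rw [Phi, hone]
  simp only [hz, hphi, hmu, mul_inv, ← Finset.prod_inv_distrib, Finset.prod_mul_distrib,
    Finset.prod_const, Finset.card_univ, Fintype.card_fin]
  rw [prod_Ioi_eq_pairProd, prod_Ioi_eq_pairProd, prod_Iio_eq_pairProd, pref, pairProd_add,
    vdm]
  simp only [hz]
  have hz' : ∀ i, z (Fin.natAdd n i) = x i := fun _ => rfl
  simp only [hz']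
  have e1 : (pairProd fun i j => br (q * y j / y i) * br (q ^ 2 * y i * y j)) *
      ((pairProd fun k l => (xf q (y l) - xf q (y k))⁻¹) *
        (pairProd fun k l => (xf q (y k) - xf q (y l))⁻¹) *
        (pairProd fun k l => br (y l / y k) / br (q * y l / y k)) *
        pairProd fun k l => (xf q (y k) - xf q (y l)) * (xf q (y l) - uf (y k))) =
      downPair q y := by
    rw [← pairProd_mul, ← pairProd_mul, ← pairProd_mul, ← pairProd_mul]
    refine pairProd_congr fun k l hkl => ?_
    have hne : Fin.castAdd m k ≠ Fin.castAdd m l := fun hh =>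
      hkl.ne (Fin.castAdd_injective n m hh)
    have n1 : br (y l / y k) ≠ 0 := h.br_div _ _ hne.symm
    have n2 : br (q ^ 2 * y k * y l) ≠ 0 := h.br_mul _ _
    have n3 : br (q * y l / y k) ≠ 0 := h.br_q_div _ _
    have n4 : xf q (y k) - xf q (y l) ≠ 0 := h.xf_ne hne
    have a1 : xf q (y l) - uf (y k) = br (q * y l / y k) * br (q * y k * y l) :=
      (br_mul_br_eq_xf_sub_uf hq (h.1 (Fin.castAdd m l)) (h.1 (Fin.castAdd m k))).symm
    have a2 : xf q (y l) - xf q (y k) = br (y l / y k) * br (q ^ 2 * y k * y l) :=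
      (br_mul_br_eq_xf_sub_xf hq (h.1 (Fin.castAdd m l)) (h.1 (Fin.castAdd m k))).symm
    rw [a1, a2]
    generalize xf q (y k) - xf q (y l) = A at *
    generalize br (y l / y k) = B at *
    generalize br (q ^ 2 * y k * y l) = C at *
    generalize br (q * y l / y k) = D at *
    field_simp
  have e2 : (∏ k, ∏ i, br (q * x i / y k) * br (q ^ 2 * y k * x i)) *
      ((∏ k, ∏ i, (br (x i / y k))⁻¹) * (∏ k, ∏ i, (br (q ^ 2 * y k * x i))⁻¹) *
        ∏ k, ∏ i, br (x i / y k) / br (q * x i / y k)) = 1 := by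
    simp only [← Finset.prod_mul_distrib]
    refine Finset.prod_eq_one fun k _ => Finset.prod_eq_one fun i _ => ?_
    have hne : Fin.natAdd n i ≠ Fin.castAdd m k := by
      rw [Ne, Fin.ext_iff, Fin.val_castAdd, Fin.val_natAdd]; omega
    have n1 : br (x i / y k) ≠ 0 := h.br_div _ _ hne
    have n2 : br (q ^ 2 * y k * x i) ≠ 0 := h.br_mul _ _
    have n3 : br (q * x i / y k) ≠ 0 := h.br_q_div _ _
    generalize br (x i / y k) = B at *
    generalize br (q ^ 2 * y k * x i) = C at *
    generalize br (q * x i / y k) = D at *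
    field_simp
  have e3 : br q ^ n * (br q)⁻¹ ^ n = 1 := by rw [← mul_pow, mul_inv_cancel₀ hbq, one_pow]
  rw [← e1, pref]
  generalize (pairProd fun i j => br (q * y j / y i) * br (q ^ 2 * y i * y j)) = A1
  generalize (pairProd fun k l => (xf q (y l) - xf q (y k))⁻¹) = A2
  generalize (pairProd fun k l => (xf q (y k) - xf q (y l))⁻¹) = A3
  generalize (pairProd fun k l => br (y l / y k) / br (q * y l / y k)) = A4
  generalize (pairProd fun k l => (xf q (y k) - xf q (y l)) * (xf q (y l) - uf (y k))) = A5
  simp only [Finset.prod_mul_distrib] at e2 ⊢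
  generalize (∏ k, ∏ i, br (q * x i / y k)) = B1 at *
  generalize (∏ k, ∏ i, br (q ^ 2 * y k * x i)) = B2 at *
  generalize (∏ k, ∏ i, (br (x i / y k))⁻¹) = B3 at *
  generalize (∏ k, ∏ i, (br (q ^ 2 * y k * x i))⁻¹) = B4 at *
  generalize (∏ k, ∏ i, br (x i / y k) / br (q * x i / y k)) = B5 at *
  generalize (∏ k, br (β * y k)) = B6
  generalize (pairProd fun i j => br (q * x j / x i) * br (q ^ 2 * x i * x j)) = B7
  generalize br q ^ n = G at *
  generalize (br q)⁻¹ ^ n = H at *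
  linear_combination A1 * A2 * A3 * A4 * A5 * B6 * B7 * (B1 * B2 * B3 * B4 * B5 * e3 + e2)

/-! ### The inhomogeneous identity -/

/-- A down spin at the last site is impossible for the boundary parameter `(q z_N)⁻¹`. -/
theorem Phi_eq_zero_of_last {n N : ℕ} {q : ℂ} {z : Fin (N + 1) → ℂ} (h : Good q z)
    (hn : 2 * n < N) {a : Fin (n + 1) → Fin (N + 1)} (ha : a (Fin.last n) = Fin.last N) :
    Phi q (q * z (Fin.last N))⁻¹ z a = 0 := by
  -- As in `downSum_eq_zero_last`, the boundary factor cancels `phi` of the last variable up to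
  -- sign.
  rw [Phi, resSum_eq_zero_of_last h (C := -1) (fun s => ?_) (by rw [Fintype.card_fin]; omega),
    mul_zero]
  have h1 : br (q * z (Fin.last N) / z s) ≠ 0 := h.br_q_div _ _
  have h2 : (q * z (Fin.last N))⁻¹ * z s = (q * z (Fin.last N) / z s)⁻¹ := by
    rw [inv_div, div_eq_inv_mul]
  rw [ha, phi_last, h2, br_inv, mul_neg, inv_mul_cancel₀ h1]

/-- Base case, by comparing two product formulas. The pair factors linking the last site to the up
spins on the left provide both the missing boundary factors and, at β = qz_last, the product ∏
[qβz_l] on the right. -/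
theorem Phi_castAdd_eq {n m : ℕ} (hnm : n = m ∨ n = m + 1) {q : ℂ} {z : Fin (n + m + 1) → ℂ}
    (h : Good3 q z) :
    Phi q (q * z (Fin.last _))⁻¹ z (Fin.castSucc ∘ (Fin.castAdd m : Fin n → Fin (n + m))) =
      (-1) ^ (m * (n + 1)) * (∏ i : Fin (n + m), br ((q * z (Fin.last _))⁻¹ * z i.castSucc)) *
        Phi q (q * z (Fin.last _)) (z ∘ Fin.castSucc)
          (Fin.natAdd n : Fin m → Fin (n + m)) := by
  set y := z (Fin.last _) with hy
  have hq : q ≠ 0 := h.q_ne_zero (Fin.last _)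
  have hy0 : y ≠ 0 := h.ne_zero _
  have hz' : Good3 q (z ∘ Fin.castSucc) := h.comp (Fin.castSucc_injective _)
  have h1 := Phi_castAdd (n := n) (m := m + 1) (β := (q * y)⁻¹) h.toGood
  have e0 : (Fin.castSucc ∘ (Fin.castAdd m : Fin n → Fin (n + m))) =
      (Fin.castAdd (m + 1) : Fin n → Fin (n + (m + 1))) := rfl
  rw [e0, Phi_natAdd hnm hz' (mul_ne_zero hq hy0)]
  refine h1.trans ?_
  have e1 : pref q (z ∘ (Fin.natAdd n : Fin (m + 1) → Fin (n + (m + 1)))) =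
      pref q ((z ∘ Fin.castSucc) ∘ (Fin.natAdd n : Fin m → Fin (n + m))) *
        ∏ l : Fin m, br (q * y / (z ∘ Fin.castSucc) (Fin.natAdd n l)) *
          br (q ^ 2 * (z ∘ Fin.castSucc) (Fin.natAdd n l) * y) := by
    rw [pref, pairProd_castSucc]
    rfl
  have e2 : ∏ i : Fin (n + m), br ((q * y)⁻¹ * z i.castSucc) =
      (∏ k : Fin n, br ((q * y)⁻¹ * z (Fin.castAdd (m + 1) k))) *
        ((-1) ^ m * ∏ l : Fin m, br (q * y / (z ∘ Fin.castSucc) (Fin.natAdd n l))) := by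
    rw [Fin.prod_univ_add]
    congr 1
    rw [← Fin.prod_const, ← Finset.prod_mul_distrib]
    refine Finset.prod_congr rfl fun l _ => ?_
    rw [neg_one_mul, br_div_comm, neg_neg, div_eq_inv_mul]
    rfl
  have e3 : ∏ l : Fin m, br (q * (q * y) * (z ∘ Fin.castSucc) (Fin.natAdd n l)) =
      ∏ l : Fin m, br (q ^ 2 * (z ∘ Fin.castSucc) (Fin.natAdd n l) * y) :=
    Finset.prod_congr rfl fun l _ => by congr 1; ring
  have e4 : (-1 : ℂ) ^ (m * (n + 1)) * (-1) ^ m * (-1) ^ (n * m) = 1 := by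
    rw [← pow_add, ← pow_add, show m * (n + 1) + m + n * m = 2 * (m * (n + 1)) by ring, pow_mul]
    simp
  have e5 : downPair q ((z ∘ Fin.castSucc) ∘ (Fin.castAdd m : Fin n → Fin (n + m))) =
      downPair q (z ∘ (Fin.castAdd (m + 1) : Fin n → Fin (n + (m + 1)))) := rfl
  rw [e1, e2, e3, e5, Finset.prod_mul_distrib]
  generalize (∏ k : Fin n, br ((q * y)⁻¹ * z (Fin.castAdd (m + 1) k))) = A1
  generalize (∏ l : Fin m, br (q * y / (z ∘ Fin.castSucc) (Fin.natAdd n l))) = A2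
  generalize (∏ l : Fin m, br (q ^ 2 * (z ∘ Fin.castSucc) (Fin.natAdd n l) * y)) = A3
  generalize pref q ((z ∘ Fin.castSucc) ∘ (Fin.natAdd n : Fin m → Fin (n + m))) = A4
  generalize downPair q (z ∘ (Fin.castAdd (m + 1) : Fin n → Fin (n + (m + 1)))) = A5
  linear_combination -(A1 * A2 * A3 * A4 * A5) * e4

/-! ### Moving the down spins by neighbouring exchanges -/

theorem strictMono_swap_comp {n N : ℕ} {a : Fin n → Fin N} (ha : StrictMono a) {i i' : Fin N}
    (h : i'.val = i.val + 1) (hi : (∀ k, a k ≠ i) ∨ ∀ k, a k ≠ i') :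
    StrictMono (Equiv.swap i i' ∘ a) := by
  intro k l hkl
  have h1 := ha hkl
  have h2 : ¬(a k = i ∧ a l = i') := by
    rintro ⟨h2, h3⟩
    rcases hi with hi | hi
    · exact hi k h2
    · exact hi l h3
  simp only [Function.comp_apply, Fin.lt_def, val_swap, Fin.ext_iff] at *
  split_ifs <;> omega

/-- Every configuration arises from the leftmost one by moving single down spins one site to the
right into empty sites; the sum of the positions is the induction measure. -/
theorem strictMono_induction {n m : ℕ} {P : (Fin n → Fin (n + m)) → Prop}
    (base : P (Fin.castAdd m))
    (step : ∀ a i i' k₀, StrictMono a → i'.val = i.val + 1 → a k₀ = i →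
      (∀ k, k ≠ k₀ → a k ≠ i ∧ a k ≠ i') → P a → P (Equiv.swap i i' ∘ a))
    {a : Fin n → Fin (n + m)} (ha : StrictMono a) : P a := by
  induction hs : ∑ k, (a k).val using Nat.strong_induction_on generalizing a with
  | _ s ih =>
  subst hs
  by_cases hall : ∀ k, (a k).val = k.val
  · have : a = Fin.castAdd m := funext fun k => Fin.ext (hall k)
    rw [this]; exact base
  · have hex : ∃ j, ∃ hj : j < n, (a ⟨j, hj⟩).val ≠ j := by
      by_contra hcon
      push Not at hcon
      exact hall fun k => hcon k.val k.isLt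
    classical
    obtain ⟨hjn, hj⟩ := Nat.find_spec hex
    have hmin : ∀ k : Fin n, k.val < Nat.find hex → (a k).val = k.val := by
      intro k hk
      have := Nat.find_min hex hk
      push Not at this
      exact this k.isLt
    -- The first down spin off its leftmost position: all earlier ones are packed to the left, so
    -- the site just before it is empty.
    set k₀ : Fin n := ⟨Nat.find hex, hjn⟩ with hk₀
    have hle : ∀ k : Fin n, k.val ≤ (a k).val := by
      intro k
      induction hk : k.val generalizing k with
      | zero => omega
      | succ j ihj =>
        have h1 := ihj ⟨j, by omega⟩ rfl
        have h2 : a ⟨j, by omega⟩ < a k := ha (by rw [Fin.lt_def, hk]; exact Nat.lt_succ_self j)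
        rw [Fin.lt_def] at h2
        omega
    have hk₀v : k₀.val = Nat.find hex := rfl
    have hgt : k₀.val < (a k₀).val := lt_of_le_of_ne (hle k₀) (Ne.symm hj)
    have hlt := (a k₀).isLt
    let i : Fin (n + m) := ⟨(a k₀).val - 1, by omega⟩
    have hi : (a k₀).val = i.val + 1 := by
      change _ = (a k₀).val - 1 + 1
      omega
    have hni : ∀ k, a k ≠ i := by
      intro k hk
      have h1 : (a k).val < (a k₀).val := by rw [hk, hi]; exact Nat.lt_succ_self _
      have h2 : k < k₀ := ha.lt_iff_lt.1 (Fin.lt_def.2 h1)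
      have h3 := hmin k (Fin.lt_def.1 h2)
      rw [Fin.lt_def] at h2
      rw [hk] at h3
      omega
    have hne : ∀ k, k ≠ k₀ → a k ≠ a k₀ := fun k hk h => hk (ha.injective h)
    have hsw : ∀ k, k ≠ k₀ → Equiv.swap i (a k₀) (a k) = a k := fun k hk =>
      Equiv.swap_apply_of_ne_of_ne (hni k) (hne k hk)
    have hmono := strictMono_swap_comp ha hi (Or.inl hni)
    have hP := ih (∑ k, ((Equiv.swap i (a k₀) ∘ a) k).val) (by
      refine Finset.sum_lt_sum (fun k _ => ?_) ⟨k₀, Finset.mem_univ _, ?_⟩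
      · rcases eq_or_ne k k₀ with rfl | hk
        · rw [Function.comp_apply, Equiv.swap_apply_right]; omega
        · rw [Function.comp_apply, hsw k hk]
      · rw [Function.comp_apply, Equiv.swap_apply_right]; omega) hmono rfl
    have hfin := step _ i (a k₀) k₀ hmono hi (by simp) (fun k hk => by
      rw [Function.comp_apply, hsw k hk]; exact ⟨hni k, hne k hk⟩) hP
    have : Equiv.swap i (a k₀) ∘ Equiv.swap i (a k₀) ∘ a = a := by
      ext k; simp
    rwa [this] at hfin

theorem swap_castSucc_castSucc {N : ℕ} (i i' : Fin N) (j : Fin N) :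
    Equiv.swap i.castSucc i'.castSucc j.castSucc = (Equiv.swap i i' j).castSucc := by
  simp only [Equiv.swap_apply_def, Fin.castSucc_inj]
  split_ifs <;> rfl

/-- The inhomogeneous form of the relation between the components for `N + 1` and `N` sites. -/
theorem Phi_castSucc_comp_eq {n m : ℕ} (hnm : n = m ∨ n = m + 1) {q : ℂ}
    {a : Fin n → Fin (n + m)} (ha : StrictMono a) {b : Fin m → Fin (n + m)} (hb : StrictMono b)
    (hab : ∀ i, i ∈ Set.range a ↔ i ∉ Set.range b) {z : Fin (n + m + 1) → ℂ} (h : Good3 q z) :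
    Phi q (q * z (Fin.last _))⁻¹ z (Fin.castSucc ∘ a) =
      (-1) ^ (m * (n + 1)) * (∏ i : Fin (n + m), br ((q * z (Fin.last _))⁻¹ * z i.castSucc)) *
        Phi q (q * z (Fin.last _)) (z ∘ Fin.castSucc) b := by
  refine strictMono_induction (P := fun a => ∀ b : Fin m → Fin (n + m), StrictMono b →
    (∀ i, i ∈ Set.range a ↔ i ∉ Set.range b) → ∀ z : Fin (n + m + 1) → ℂ, Good3 q z →
    Phi q (q * z (Fin.last _))⁻¹ z (Fin.castSucc ∘ a) =
      (-1) ^ (m * (n + 1)) * (∏ i : Fin (n + m), br ((q * z (Fin.last _))⁻¹ * z i.castSucc)) *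
        Phi q (q * z (Fin.last _)) (z ∘ Fin.castSucc) b) ?_ ?_ ha b hb hab z h
  · intro b hb hab z h
    have : b = Fin.natAdd n := by
      refine (StrictMono.range_inj hb (Fin.strictMono_natAdd n)).1 ?_
      ext j
      rw [← not_iff_not, ← hab]
      refine Fin.addCases (fun l => ?_) (fun l => ?_) j
      · simp only [Set.mem_range, exists_apply_eq_apply, true_iff, not_exists]
        intro i hi
        have := congrArg Fin.val hi
        simp at this
        omega
      · simp only [Set.mem_range, exists_apply_eq_apply, not_true, iff_false, not_exists]
        intro i hi
        have := congrArg Fin.val hi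
        simp at this
        omega
    rw [this]
    exact Phi_castAdd_eq hnm h
  · intro a i i' k₀ ha hi hk₀ hne hP b hb hab z h
    have hii : i ≠ i' := by rw [Ne, Fin.ext_iff]; omega
    have hbi' : ∀ k, b k ≠ i' := by
      have := (hab i').1 ⟨k₀, by simp [hk₀]⟩
      exact fun k hk => this ⟨k, hk⟩
    -- After the move site i is empty in the first configuration and hence occupied in its
    -- complement b; the complement before the move is b with this spin at i'.
    obtain ⟨k₁, hk₁⟩ : i ∈ Set.range b := by
      by_contra hcon
      obtain ⟨k, hk⟩ := (hab i).2 hcon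
      have hk' : a k = i' := by
        have := congrArg (Equiv.swap i i') hk
        simpa using this
      have : k ≠ k₀ := fun hh => hii (by rw [← hk', hh, hk₀])
      exact (hne k this).2 hk'
    have hbne : ∀ k, k ≠ k₁ → b k ≠ i ∧ b k ≠ i' := fun k hk =>
      ⟨fun hh => hk (hb.injective (hh.trans hk₁.symm)), hbi' k⟩
    have hb0 := strictMono_swap_comp hb hi (Or.inr hbi')
    have hab0 : ∀ j, j ∈ Set.range a ↔ j ∉ Set.range (Equiv.swap i i' ∘ b) := by
      intro j
      have h1 := hab (Equiv.swap i i' j)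
      have h2 : ∀ {p : ℕ} (c : Fin p → Fin (n + m)),
          j ∈ Set.range (Equiv.swap i i' ∘ c) ↔ Equiv.swap i i' j ∈ Set.range c := by
        intro p c
        simp only [Set.mem_range, Function.comp_apply]
        exact exists_congr fun k => Equiv.swap_apply_eq_iff
      rw [h2]
      rw [← h1, Set.mem_range, Set.mem_range]
      exact exists_congr fun k => by simp
    have hicv : i'.castSucc.val = i.castSucc.val + 1 := hi
    have e1 : Fin.castSucc ∘ Equiv.swap i i' ∘ a =
        Equiv.swap i.castSucc i'.castSucc ∘ Fin.castSucc ∘ a := by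
      ext k; simp [swap_castSucc_castSucc]
    have e2 : (z ∘ Equiv.swap i.castSucc i'.castSucc) ∘ Fin.castSucc =
        (z ∘ Fin.castSucc) ∘ Equiv.swap i i' := by
      ext k; simp [swap_castSucc_castSucc]
    have e3 : (z ∘ Equiv.swap i.castSucc i'.castSucc) (Fin.last _) = z (Fin.last _) := by
      rw [Function.comp_apply, Equiv.swap_apply_of_ne_of_ne (Fin.castSucc_lt_last _).ne'
        (Fin.castSucc_lt_last _).ne']
    have e4 : ∏ j : Fin (n + m), br ((q * z (Fin.last _))⁻¹ *
        (z ∘ Equiv.swap i.castSucc i'.castSucc) j.castSucc) =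
        ∏ j : Fin (n + m), br ((q * z (Fin.last _))⁻¹ * z j.castSucc) := by
      simp only [Function.comp_apply, swap_castSucc_castSucc]
      exact Equiv.prod_comp (Equiv.swap i i') fun j => br ((q * z (Fin.last _))⁻¹ * z j.castSucc)
    have hs : Good3 q (z ∘ Equiv.swap i.castSucc i'.castSucc) := h.comp (Equiv.injective _)
    have hc : Good3 q (z ∘ Fin.castSucc) := h.comp (Fin.castSucc_injective _)
    -- The induction hypothesis is used at z and at the exchanged parameters, because the exchange
    -- relation for the first configuration involves both.
    have P1 := hP _ hb0 hab0 z h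
    have P2 := hP _ hb0 hab0 _ hs
    rw [e2, e3, e4] at P2
    have X1 := Phi_exchange (β := (q * z (Fin.last _))⁻¹) h.toGood hicv
      (a := Fin.castSucc ∘ a) (k₀ := k₀) (by rw [Function.comp_apply, hk₀])
      (fun k hk => by
        simp only [Function.comp_apply, Ne, Fin.castSucc_inj]; exact hne k hk)
    have X2 := Phi_exchange (β := q * z (Fin.last _)) hc.toGood hi hk₁ hbne
    have X3 := Phi_exchange (β := q * z (Fin.last _))
      (hc.comp (Equiv.injective (Equiv.swap i i'))).toGood hi hk₁ hbne
    have e5 : ((z ∘ Fin.castSucc) ∘ Equiv.swap i i') ∘ Equiv.swap i i' = z ∘ Fin.castSucc := by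
      ext k; simp
    rw [e5] at X3
    simp only [Function.comp_apply, Equiv.swap_apply_left, Equiv.swap_apply_right] at X2 X3
    rw [e1]
    have ht : br (z i'.castSucc / z i.castSucc) ≠ 0 :=
      h.br_div _ _ fun hh => hii (Fin.castSucc_injective _ hh).symm
    have k1 : br (z i.castSucc / z i'.castSucc) = -br (z i'.castSucc / z i.castSucc) :=
      br_div_comm _ _
    -- This identity makes the exchange of b inverse to that of the first configuration: inserting
    -- X2 and X3 leaves the component of b at z, times [z_{i'}/z_i]².
    have k2 : br q ^ 2 - br (q * z i'.castSucc / z i.castSucc) *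
        br (q * z i.castSucc / z i'.castSucc) = br (z i'.castSucc / z i.castSucc) ^ 2 := by
      have h1 := h.ne_zero i.castSucc
      have h2 := h.ne_zero i'.castSucc
      have h3 := h.q_ne_zero i.castSucc
      unfold br; field_simp; ring
    rw [k1] at X3
    refine mul_left_cancel₀ (pow_ne_zero 2 ht) ?_
    simp only [Function.comp_def] at *
    generalize br (z i'.castSucc / z i.castSucc) = T at *
    generalize br (q * z i'.castSucc / z i.castSucc) = Q1 at *
    generalize br (q * z i.castSucc / z i'.castSucc) = Q2 at *
    generalize (∏ j : Fin (n + m), br ((q * z (Fin.last _))⁻¹ * z j.castSucc)) = C at *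
    linear_combination T * X1 + T * br q * P1 - T * Q1 * P2 +
      (-1) ^ (m * (n + 1)) * C * (br q * X2 + Q1 * X3 + Phi q (q * z (Fin.last (n + m)))
        (fun x => z x.castSucc) b * k2)

/-! ### Regularity of the components at coinciding parameters -/

/-- The algebra generated by the `z i`, the parameter `β`, their inverses and the inverses of the
sums `z i + z j`. -/
def regAlg (N : ℕ) : Subalgebra ℂ ((Fin N → ℂ) × ℂ → ℂ) :=
  Algebra.adjoin ℂ ({f | ∃ i, f = fun p => p.1 i} ∪ {f | ∃ i, f = fun p => (p.1 i)⁻¹} ∪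
    {f | ∃ i j, f = fun p => (p.1 i + p.1 j)⁻¹} ∪ {fun p => p.2, fun p => p.2⁻¹})

section
variable {N : ℕ}

theorem coord_mem_regAlg (i : Fin N) : (fun p => p.1 i) ∈ regAlg N :=
  Algebra.subset_adjoin (Or.inl (Or.inl (Or.inl ⟨i, rfl⟩)))

theorem inv_coord_mem_regAlg (i : Fin N) : (fun p => (p.1 i)⁻¹) ∈ regAlg N :=
  Algebra.subset_adjoin (Or.inl (Or.inl (Or.inr ⟨i, rfl⟩)))

theorem inv_add_mem_regAlg (i j : Fin N) : (fun p => (p.1 i + p.1 j)⁻¹) ∈ regAlg N :=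
  Algebra.subset_adjoin (Or.inl (Or.inr ⟨i, j, rfl⟩))

theorem snd_mem_regAlg : (fun p => p.2) ∈ regAlg N :=
  Algebra.subset_adjoin (Or.inr (Or.inl rfl))

theorem inv_snd_mem_regAlg : (fun p => p.2⁻¹) ∈ regAlg N :=
  Algebra.subset_adjoin (Or.inr (Or.inr rfl))

theorem const_mem_regAlg (c : ℂ) : (fun _ => c) ∈ regAlg N :=
  (regAlg N).algebraMap_mem c

theorem mul_mem_regAlg {f g : (Fin N → ℂ) × ℂ → ℂ} (hf : f ∈ regAlg N) (hg : g ∈ regAlg N) :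
    (fun p => f p * g p) ∈ regAlg N := mul_mem hf hg

theorem br_mem_regAlg {f : (Fin N → ℂ) × ℂ → ℂ} (hf : f ∈ regAlg N)
    (hf' : (fun p => (f p)⁻¹) ∈ regAlg N) : (fun p => br (f p)) ∈ regAlg N :=
  sub_mem hf hf'

theorem prod_mem_regAlg {ι : Type*} (s : Finset ι) {f : ι → (Fin N → ℂ) × ℂ → ℂ}
    (hf : ∀ i ∈ s, f i ∈ regAlg N) : (fun p => ∏ i ∈ s, f i p) ∈ regAlg N := by
  have := prod_mem hf
  rwa [show (∏ i ∈ s, f i) = fun p => ∏ i ∈ s, f i p from funext fun p => by simp] at this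

theorem pairProd_mem_regAlg {n : ℕ} {f : Fin n → Fin n → (Fin N → ℂ) × ℂ → ℂ}
    (hf : ∀ i j, f i j ∈ regAlg N) : (fun p => pairProd fun i j => f i j p) ∈ regAlg N := by
  unfold pairProd
  refine prod_mem_regAlg _ fun i _ => prod_mem_regAlg _ fun j _ => ?_
  split_ifs
  · exact hf i j
  · exact const_mem_regAlg 1

theorem br_mul_mul_mem_regAlg (c : ℂ) (i j : Fin N) :
    (fun p => br (c * p.1 i * p.1 j)) ∈ regAlg N := by
  refine br_mem_regAlg (mul_mem_regAlg (mul_mem_regAlg (const_mem_regAlg c) (coord_mem_regAlg i))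
    (coord_mem_regAlg j)) ?_
  simp only [mul_inv]
  exact mul_mem_regAlg (mul_mem_regAlg (const_mem_regAlg _) (inv_coord_mem_regAlg i))
    (inv_coord_mem_regAlg j)

theorem br_mul_div_mem_regAlg (c : ℂ) (i j : Fin N) :
    (fun p => br (c * p.1 i / p.1 j)) ∈ regAlg N := by
  refine br_mem_regAlg ?_ ?_
  · simp only [div_eq_mul_inv]
    exact mul_mem_regAlg (mul_mem_regAlg (const_mem_regAlg c) (coord_mem_regAlg i))
      (inv_coord_mem_regAlg j)
  · simp only [div_eq_mul_inv, mul_inv, inv_inv]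
    exact mul_mem_regAlg (mul_mem_regAlg (const_mem_regAlg _) (inv_coord_mem_regAlg i))
      (coord_mem_regAlg j)

theorem br_snd_mul_mem_regAlg (i : Fin N) : (fun p => br (p.2 * p.1 i)) ∈ regAlg N := by
  refine br_mem_regAlg (mul_mem_regAlg snd_mem_regAlg (coord_mem_regAlg i)) ?_
  simp only [mul_inv]
  exact mul_mem_regAlg inv_snd_mem_regAlg (inv_coord_mem_regAlg i)

/-- At z = 1 the generators' denominators are 1, 2 and β. No inverse of a difference or of
[q²z_iz_j] is allowed, so special values of q do no harm. -/
theorem continuousAt_of_mem_regAlg {f : (Fin N → ℂ) × ℂ → ℂ} (hf : f ∈ regAlg N) {β : ℂ}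
    (hβ : β ≠ 0) : ContinuousAt f (fun _ => 1, β) := by
  induction hf using Algebra.adjoin_induction with
  | mem f hf =>
    have hc : ∀ i : Fin N, ContinuousAt (fun p : (Fin N → ℂ) × ℂ => p.1 i) (fun _ => 1, β) :=
      fun i => by fun_prop
    rcases hf with ((⟨i, rfl⟩ | ⟨i, rfl⟩) | ⟨i, j, rfl⟩) | (rfl | rfl)
    · exact hc i
    · exact (hc i).inv₀ one_ne_zero
    · exact ((hc i).add (hc j)).inv₀ (by norm_num)
    · exact continuousAt_snd
    · exact continuousAt_snd.inv₀ hβ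
  | algebraMap c => exact continuousAt_const
  | add f g _ _ hf hg => exact hf.add hg
  | mul f g _ _ hf hg => exact hf.mul hg

theorem comp_perm_mem_regAlg {f : (Fin N → ℂ) × ℂ → ℂ} (hf : f ∈ regAlg N)
    (e : Equiv.Perm (Fin N)) : (fun p => f (p.1 ∘ e, p.2)) ∈ regAlg N := by
  induction hf using Algebra.adjoin_induction with
  | mem f hf =>
    rcases hf with ((⟨i, rfl⟩ | ⟨i, rfl⟩) | ⟨i, j, rfl⟩) | (rfl | rfl)
    · exact coord_mem_regAlg (e i)
    · exact inv_coord_mem_regAlg (e i)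
    · exact inv_add_mem_regAlg (e i) (e j)
    · exact snd_mem_regAlg
    · exact inv_snd_mem_regAlg
  | algebraMap c => exact const_mem_regAlg c
  | add f g _ _ hf hg => exact add_mem hf hg
  | mul f g _ _ hf hg => exact mul_mem hf hg

/-- `f` has a divided difference for the exchange of the parameters `i` and `i'`. -/
def HasDivDiff (i i' : Fin N) (f : (Fin N → ℂ) × ℂ → ℂ) : Prop :=
  ∃ g ∈ regAlg N, ∀ p : (Fin N → ℂ) × ℂ, (∀ j, p.1 j ≠ 0) → (∀ j k, p.1 j + p.1 k ≠ 0) →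
    f p - f (p.1 ∘ Equiv.swap i i', p.2) = (p.1 i' - p.1 i) * g p

theorem HasDivDiff.add {i i' : Fin N} {f g : (Fin N → ℂ) × ℂ → ℂ} (hf : HasDivDiff i i' f)
    (hg : HasDivDiff i i' g) : HasDivDiff i i' (f + g) := by
  obtain ⟨f', hf', h⟩ := hf
  obtain ⟨g', hg', h'⟩ := hg
  refine ⟨f' + g', add_mem hf' hg', fun p h1 h2 => ?_⟩
  rw [Pi.add_apply, Pi.add_apply, Pi.add_apply]
  linear_combination h p h1 h2 + h' p h1 h2

theorem HasDivDiff.mul {i i' : Fin N} {f g : (Fin N → ℂ) × ℂ → ℂ} (hf : HasDivDiff i i' f)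
    (hg : HasDivDiff i i' g) (hfm : f ∈ regAlg N) (hgm : g ∈ regAlg N) :
    HasDivDiff i i' (f * g) := by
  obtain ⟨f', hf', h⟩ := hf
  obtain ⟨g', hg', h'⟩ := hg
  refine ⟨f' * g + (fun p => f (p.1 ∘ Equiv.swap i i', p.2)) * g',
    add_mem (mul_mem hf' hgm) (mul_mem (comp_perm_mem_regAlg hfm _) hg'), fun p h1 h2 => ?_⟩
  simp only [Pi.add_apply, Pi.mul_apply]
  linear_combination g p * h p h1 h2 + f (p.1 ∘ Equiv.swap i i', p.2) * h' p h1 h2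

theorem HasDivDiff.inv {i i' : Fin N} {f : (Fin N → ℂ) × ℂ → ℂ} (hf : HasDivDiff i i' f)
    (hfm : (fun p => (f p)⁻¹) ∈ regAlg N)
    (hne : ∀ p : (Fin N → ℂ) × ℂ, (∀ j, p.1 j ≠ 0) → (∀ j k, p.1 j + p.1 k ≠ 0) → f p ≠ 0) :
    HasDivDiff i i' fun p => (f p)⁻¹ := by
  obtain ⟨f', hf', h⟩ := hf
  refine ⟨-(f' * (fun p => (f p)⁻¹) * fun p => (f (p.1 ∘ Equiv.swap i i', p.2))⁻¹),
    neg_mem (mul_mem (mul_mem hf' hfm) (comp_perm_mem_regAlg hfm _)), fun p h1 h2 => ?_⟩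
  have n1 := hne p h1 h2
  have n2 := hne (p.1 ∘ Equiv.swap i i', p.2) (fun j => h1 _) fun j k => h2 _ _
  have n3 := h p h1 h2
  simp only [Pi.neg_apply, Pi.mul_apply]
  field_simp
  linear_combination -n3

theorem hasDivDiff_coord (i i' j : Fin N) : HasDivDiff i i' fun p => p.1 j := by
  rcases eq_or_ne j i with rfl | h1
  · exact ⟨_, const_mem_regAlg (-1), fun p _ _ => by simp⟩
  · rcases eq_or_ne j i' with rfl | h2
    · exact ⟨_, const_mem_regAlg 1, fun p _ _ => by simp⟩
    · exact ⟨_, const_mem_regAlg 0, fun p _ _ => by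
        simp [Equiv.swap_apply_of_ne_of_ne h1 h2]⟩

/-- Divided differences obey Leibniz and quotient rules, so it suffices to treat the generators. -/
theorem hasDivDiff_of_mem_regAlg (i i' : Fin N) {f : (Fin N → ℂ) × ℂ → ℂ} (hf : f ∈ regAlg N) :
    HasDivDiff i i' f := by
  induction hf using Algebra.adjoin_induction with
  | mem f hf =>
    rcases hf with ((⟨j, rfl⟩ | ⟨j, rfl⟩) | ⟨j, k, rfl⟩) | (rfl | rfl)
    · exact hasDivDiff_coord i i' j
    · exact (hasDivDiff_coord i i' j).inv (inv_coord_mem_regAlg j) fun p h _ => h j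
    · exact ((hasDivDiff_coord i i' j).add (hasDivDiff_coord i i' k)).inv
        (inv_add_mem_regAlg j k) fun p _ h => h j k
    · exact ⟨0, zero_mem _, fun p _ _ => by simp⟩
    · exact ⟨0, zero_mem _, fun p _ _ => by simp⟩
  | algebraMap c => exact ⟨0, zero_mem _, fun p _ _ => by simp⟩
  | add f g _ _ hf hg => exact hf.add hg
  | mul f g hfm hgm hf hg => exact hf.mul hg hfm hgm

end

theorem Good.add_ne_zero {ι : Type*} {q : ℂ} {z : ι → ℂ} (h : Good q z) (i j : ι) :
    z i + z j ≠ 0 := by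
  intro hij
  rcases eq_or_ne i j with rfl | hne
  · exact h.ne_zero i (by linear_combination hij / 2)
  · refine h.br_div i j hne (br_eq_zero_iff.2 (Or.inr (Or.inr ?_)))
    rw [div_eq_iff (h.ne_zero j)]
    linear_combination hij

/-- The components extend to regular functions at the homogeneous point. -/
theorem exists_mem_regAlg_Phi_eq {n m : ℕ} (q : ℂ) {a : Fin n → Fin (n + m)} (ha : StrictMono a) :
    ∃ R ∈ regAlg (n + m), ∀ z β, Good q z → Phi q β z a = R (z, β) := by
  refine strictMono_induction (P := fun a => ∃ R ∈ regAlg (n + m), ∀ z β, Good q z →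
    Phi q β z a = R (z, β)) ?_ ?_ ha
  · refine ⟨fun p => downPair q (p.1 ∘ Fin.castAdd m) * pref q (p.1 ∘ Fin.natAdd n) *
      ∏ k, br (p.2 * p.1 (Fin.castAdd m k)), ?_, fun z β h => Phi_castAdd h⟩
    unfold downPair pref
    refine mul_mem_regAlg (mul_mem_regAlg ?_ ?_) ?_
    · exact pairProd_mem_regAlg fun i j => mul_mem_regAlg (br_mul_div_mem_regAlg q _ _)
        (br_mul_mul_mem_regAlg q _ _)
    · exact pairProd_mem_regAlg fun i j => mul_mem_regAlg (br_mul_div_mem_regAlg q _ _)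
        (br_mul_mul_mem_regAlg _ _ _)
    · exact prod_mem_regAlg _ fun k _ => br_snd_mul_mem_regAlg _
  · rintro a i i' k₀ - hi hk₀ hne ⟨R, hR, hPhi⟩
    obtain ⟨g, hg, hgR⟩ := hasDivDiff_of_mem_regAlg i i' hR
    -- With z = z_i and z' = z_{i'}, the right side of the exchange relation is ([q] - [qz'/z])R +
    -- [qz'/z](R - R∘swap). Dividing by [z'/z] = (z'-z)(z'+z)/(zz') turns the two parts into these
    -- terms; z' - z cancels and only z + z' is left below.
    refine ⟨fun p => (-(q * p.1 i' + q⁻¹ * p.1 i) * R p +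
      br (q * p.1 i' / p.1 i) * (p.1 i * p.1 i') * g p) * (p.1 i + p.1 i')⁻¹, ?_, ?_⟩
    · refine mul_mem_regAlg (add_mem (mul_mem_regAlg (neg_mem (add_mem
        (mul_mem_regAlg (const_mem_regAlg q) (coord_mem_regAlg i'))
        (mul_mem_regAlg (const_mem_regAlg q⁻¹) (coord_mem_regAlg i)))) hR)
        (mul_mem_regAlg (mul_mem_regAlg (br_mul_div_mem_regAlg q i' i)
          (mul_mem_regAlg (coord_mem_regAlg i) (coord_mem_regAlg i'))) hg))
        (inv_add_mem_regAlg i i')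
    · intro z β h
      have hii : i' ≠ i := by rw [Ne, Fin.ext_iff]; omega
      have X := Phi_exchange (β := β) h hi hk₀ hne
      rw [hPhi z β h, hPhi _ β (h.comp (Equiv.injective _))] at X
      have Y := hgR (z, β) h.ne_zero h.add_ne_zero
      have ht := h.br_div i' i hii
      have h1 := h.ne_zero i
      have h2 := h.ne_zero i'
      have h3 := h.q_ne_zero i
      have h4 := h.add_ne_zero i i'
      refine mul_left_cancel₀ ht (mul_left_cancel₀ h4 ?_)
      rw [X]
      dsimp only at Y ⊢
      have e1 : (z i + z i') * (br q - br (q * z i' / z i)) =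
          -(br (z i' / z i) * (q * z i' + q⁻¹ * z i)) := by
        unfold br; field_simp; ring
      have e2 : (z i + z i') * (z i' - z i) = br (z i' / z i) * (z i * z i') := by
        unfold br; field_simp; ring
      generalize br (z i' / z i) = T at *
      generalize br (q * z i' / z i) = Q at *
      field_simp
      field_simp at e1
      linear_combination R (z, β) * e1 + q * Q * (z i + z i') * Y + q * Q * g (z, β) * e2

theorem exists_continuousAt_Phi_eq {n N : ℕ} (q : ℂ) {a : Fin n → Fin N} (ha : StrictMono a) :
    ∃ R : (Fin N → ℂ) × ℂ → ℂ, (∀ β, β ≠ 0 → ContinuousAt R (fun _ => 1, β)) ∧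
      ∀ z β, Good q z → Phi q β z a = R (z, β) := by
  obtain ⟨m, rfl⟩ : ∃ m, N = n + m :=
    Nat.exists_eq_add_of_le (by simpa using Fintype.card_le_of_injective a ha.injective)
  obtain ⟨R, hR, h⟩ := exists_mem_regAlg_Phi_eq q ha
  exact ⟨R, fun β hβ => continuousAt_of_mem_regAlg hR hβ, h⟩

/-! ### Generic points near the homogeneous point -/

theorem Good.generic {N : ℕ} {q : ℂ} {z : Fin N → ℂ} (h : Good q z) : Generic q z := by
  have h0 := h.ne_zero
  rintro j (h1 | ⟨k, hk, h1⟩ | ⟨k, h1 | h1 | h1 | h1 | h1⟩)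
  · exact h0 j h1
  · exact h.br_div k j hk (by rw [h1, div_self (h0 k), br_one])
  · exact h.add_ne_zero j k (by rw [h1, neg_add_cancel])
  · exact h.br_q_div k j (by rw [← h1, div_self (h0 j), br_one])
  · exact h.br_q_div k j (by
      rw [← neg_eq_iff_eq_neg.2 h1, neg_div, div_self (h0 j), br_neg, br_one, neg_zero])
  · refine h.br_mul k j ?_
    have h2 : q ^ 2 * z k ≠ 0 := mul_ne_zero (pow_ne_zero 2 (h.q_ne_zero k)) (h0 k)
    rw [h1, mul_inv_cancel₀ h2, br_one]
  · refine h.br_mul k j ?_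
    have h2 : q ^ 2 * z k ≠ 0 := mul_ne_zero (pow_ne_zero 2 (h.q_ne_zero k)) (h0 k)
    rw [h1, mul_neg, mul_inv_cancel₀ h2, br_neg, br_one, neg_zero]

/-- A curve of parameters through the homogeneous point. -/
def ray (N : ℕ) (t : ℂ) : Fin N → ℂ := fun j => 1 + t * (j.val + 1 : ℕ)

theorem continuous_ray (N : ℕ) : Continuous (ray N) := by unfold ray; fun_prop

theorem ray_zero (N : ℕ) : ray N 0 = fun _ => 1 := by ext; simp [ray]

theorem eventually_ray_mul_ray_ne {N : ℕ} (i j : Fin N) (c : ℂ) :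
    ∀ᶠ t in 𝓝[≠] (0 : ℂ), ray N t i * ray N t j ≠ c := by
  have hc : ∀ k, Continuous fun t => ray N t k := fun k => (continuous_apply k).comp
    (continuous_ray N)
  rcases eq_or_ne c 1 with rfl | hne
  · have h1 : ∀ᶠ t in 𝓝 (0 : ℂ), ((i.val + 1 : ℕ) + (j.val + 1 : ℕ) +
        t * ((i.val + 1 : ℕ) * (j.val + 1 : ℕ)) : ℂ) ≠ 0 := by
      refine ContinuousAt.eventually_ne (by fun_prop) ?_
      rw [zero_mul, add_zero, ← Nat.cast_add]
      exact Nat.cast_ne_zero.2 (by omega)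
    filter_upwards [h1.filter_mono nhdsWithin_le_nhds, self_mem_nhdsWithin] with t ht ht0 h
    refine mul_ne_zero ht0 ht ?_
    unfold ray at h
    linear_combination h
  · refine Filter.Eventually.filter_mono nhdsWithin_le_nhds ?_
    refine ContinuousAt.eventually_ne ((hc i).mul (hc j)).continuousAt ?_
    simpa [ray] using hne.symm

theorem eventually_ray_ne_mul_ray {N : ℕ} (i j : Fin N) {c : ℂ} (hc1 : c = 1 → i ≠ j) :
    ∀ᶠ t in 𝓝[≠] (0 : ℂ), ray N t i ≠ c * ray N t j := by
  have hc : ∀ k, Continuous fun t => ray N t k := fun k => (continuous_apply k).comp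
    (continuous_ray N)
  rcases eq_or_ne c 1 with rfl | hne
  · filter_upwards [self_mem_nhdsWithin] with t ht0 h
    refine hc1 rfl (Fin.ext ?_)
    have h1 : t * (i.val + 1 : ℕ) = t * (j.val + 1 : ℕ) := by
      unfold ray at h; linear_combination h
    have h2 := Nat.cast_injective (mul_left_cancel₀ ht0 h1)
    omega
  · refine Filter.Eventually.filter_mono nhdsWithin_le_nhds ?_
    have h1 : ∀ᶠ t in 𝓝 (0 : ℂ), ray N t i - c * ray N t j ≠ 0 := by
      refine ContinuousAt.eventually_ne ((hc i).sub ((hc j).const_mul c)).continuousAt ?_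
      simpa [ray, sub_eq_zero] using hne.symm
    filter_upwards [h1] with t ht
    exact sub_ne_zero.1 ht

theorem br_ne_zero {q : ℂ} (h0 : q ≠ 0) (h1 : q ≠ 1) (h2 : q ≠ -1) : br q ≠ 0 := by
  rw [Ne, br_eq_zero_iff]; tauto

/-- Even when q² or q³ is ±1 the conditions fail only at t = 0 locally, because products z_i z_j on
the ray differ from 1 for small t ≠ 0. Thus the limit is taken along a nontrivial filter for every
admitted q. -/
theorem eventually_good3_ray (N : ℕ) {q : ℂ} (h0 : q ≠ 0) (h1 : q ≠ 1) (h2 : q ≠ -1) :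
    ∀ᶠ t in 𝓝[≠] (0 : ℂ), Good3 q (ray N t) := by
  have e0 : ∀ᶠ t in 𝓝[≠] (0 : ℂ), ∀ i, ray N t i ≠ 0 := by
    refine eventually_all.2 fun i => ?_
    filter_upwards [eventually_ray_mul_ray_ne i i 0] with t ht h
    exact ht (by rw [h, zero_mul])
  have e1 : ∀ᶠ t in 𝓝[≠] (0 : ℂ), ∀ i j, i ≠ j → ray N t i ≠ ray N t j ∧
      ray N t i ≠ -ray N t j := by
    refine eventually_all.2 fun i => eventually_all.2 fun j => ?_
    by_cases hij : i = j
    · exact Eventually.of_forall fun t h => absurd hij h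
    · filter_upwards [eventually_ray_ne_mul_ray i j (c := 1) fun _ => hij,
        eventually_ray_ne_mul_ray i j (c := -1) fun _ => hij] with t ht ht' _
      exact ⟨by simpa using ht, by simpa using ht'⟩
  have e2 : ∀ (c : ℂ), c ≠ 0 → ∀ᶠ t in 𝓝[≠] (0 : ℂ), ∀ i j,
      c * ray N t i * ray N t j ≠ 1 ∧ c * ray N t i * ray N t j ≠ -1 := by
    intro c hc
    refine eventually_all.2 fun i => eventually_all.2 fun j => ?_
    filter_upwards [eventually_ray_mul_ray_ne i j c⁻¹, eventually_ray_mul_ray_ne i j (-c⁻¹)]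
      with t ht ht'
    rw [mul_assoc]
    refine ⟨fun h => ht (eq_inv_of_mul_eq_one_right h), fun h => ht' ?_⟩
    rw [← mul_neg_one, ← h, inv_mul_cancel_left₀ hc]
  have e3 : ∀ᶠ t in 𝓝[≠] (0 : ℂ), ∀ i j, ray N t j ≠ q * ray N t i ∧
      ray N t j ≠ -(q * ray N t i) := by
    refine eventually_all.2 fun i => eventually_all.2 fun j => ?_
    filter_upwards [eventually_ray_ne_mul_ray j i (c := q) fun h => absurd h h1,
      eventually_ray_ne_mul_ray j i (c := -q) fun h => absurd (neg_eq_iff_eq_neg.1 h) h2]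
      with t ht ht'
    exact ⟨ht, by rwa [← neg_mul]⟩
  filter_upwards [e0, e1, e2 _ (pow_ne_zero 2 h0), e2 _ (pow_ne_zero 3 h0), e3]
    with t t0 t1 t2 t3 t4
  refine ⟨⟨t0, fun i j hij => ?_, fun i j => ?_, fun i j => ?_⟩, fun i j => ?_⟩ <;>
    rw [Ne, br_eq_zero_iff, not_or, not_or]
  · refine ⟨div_ne_zero (t0 i) (t0 j), fun h => (t1 i j hij).1 ((div_eq_one_iff_eq (t0 j)).1 h),
      fun h => (t1 i j hij).2 ?_⟩
    rw [div_eq_iff (t0 j)] at h; rw [h, neg_one_mul]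
  · exact ⟨mul_ne_zero (mul_ne_zero (pow_ne_zero 2 h0) (t0 i)) (t0 j), t2 i j⟩
  · refine ⟨div_ne_zero (mul_ne_zero h0 (t0 i)) (t0 j),
      fun h => (t4 i j).1 ((div_eq_one_iff_eq (t0 j)).1 h).symm, fun h => (t4 i j).2 ?_⟩
    rw [div_eq_iff (t0 j)] at h; rw [h, neg_one_mul, neg_neg]
  · exact ⟨mul_ne_zero (mul_ne_zero (pow_ne_zero 3 h0) (t0 i)) (t0 j), t3 i j⟩

theorem neBot_nhdsWithin_good3 (N : ℕ) {q : ℂ} (h0 : q ≠ 0) (h1 : q ≠ 1) (h2 : q ≠ -1) :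
    (𝓝[{z : Fin N → ℂ | Good3 q z}] (fun _ => 1)).NeBot := by
  have : Tendsto (ray N) (𝓝[≠] (0 : ℂ)) (𝓝[{z : Fin N → ℂ | Good3 q z}] (fun _ => 1)) := by
    refine tendsto_nhdsWithin_iff.2 ⟨?_, eventually_good3_ray N h0 h1 h2⟩
    rw [← ray_zero N]
    exact (continuous_ray N).continuousAt.tendsto.mono_left nhdsWithin_le_nhds
  exact this.neBot

theorem nhdsWithin_good3_le (N : ℕ) (q : ℂ) :
    𝓝[{z : Fin N → ℂ | Good3 q z}] (fun _ => 1) ≤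
      𝓝[{z : Fin N → ℂ | Generic q z}] (fun _ => 1) :=
  nhdsWithin_mono _ fun _ hz => hz.toGood.generic

/-! ### The homogeneous limit -/

section
variable {N : ℕ} {q β : ℂ}

theorem exists_isHomLimit (h0 : q ≠ 0) (hβ : β ≠ 0) : ∃ v, IsHomLimit N q β v := by
  classical
  have hR : ∀ a : Fin (nDown N) → Fin N, ∃ L : ℂ, StrictMono a →
      Tendsto (PsiComp q β a) (𝓝[{z | Generic q z}] (fun _ => 1)) (𝓝 L) := by
    intro a
    by_cases ha : StrictMono a
    · obtain ⟨R, hc, hR⟩ := exists_continuousAt_Phi_eq q ha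
      refine ⟨R (fun _ => 1, β), fun _ => ?_⟩
      have h1 : Tendsto (fun z : Fin N → ℂ => R (z, β)) (𝓝 fun _ => 1)
          (𝓝 (R (fun _ => 1, β))) :=
        (ContinuousAt.comp (f := fun z : Fin N → ℂ => (z, β)) (hc β hβ)
          (by fun_prop : ContinuousAt (fun z : Fin N → ℂ => (z, β)) fun _ => 1)).tendsto
      refine (h1.mono_left nhdsWithin_le_nhds).congr' ?_
      filter_upwards [self_mem_nhdsWithin] with z hz
      rw [PsiComp_eq_Phi hz h0 hβ, hR z β (Generic.good hz h0)]
    · exact ⟨0, fun h => absurd h ha⟩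
  choose L hL using hR
  refine ⟨normFactor N q β • ∑ a : Fin (nDown N) → Fin N with StrictMono a, L a • ket (config a),
    Tendsto.const_smul (tendsto_finsetSum _ fun a ha => ?_) _⟩
  exact (hL a (Finset.mem_filter.1 ha).2).smul_const _

theorem isHomLimit_psi (h0 : q ≠ 0) (h1 : q ≠ 1) (h2 : q ≠ -1) (hβ : β ≠ 0) :
    IsHomLimit N q β (psi N q β) := by
  obtain ⟨v, hv⟩ := exists_isHomLimit (N := N) h0 hβ
  have := neBot_nhdsWithin_good3 N h0 h1 h2
  have : (𝓝[{z : Fin N → ℂ | Generic q z}] (fun _ => 1)).NeBot :=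
    NeBot.mono this (nhdsWithin_good3_le N q)
  have h := hv
  unfold IsHomLimit at h
  rwa [psi, h.limUnder_eq]

theorem config_injective {n : ℕ} {a b : Fin n → Fin N} (ha : StrictMono a) (hb : StrictMono b)
    (h : config a = config b) : a = b := by
  refine (ha.range_inj hb).1 (Set.ext fun i => ?_)
  have hi := congrFun h i
  unfold config at hi
  simp only [Set.mem_range]
  by_cases h1 : ∃ k, a k = i <;> by_cases h2 : ∃ k, b k = i <;> simp [h1, h2] at hi ⊢

theorem Psi_config {a : Fin (nDown N) → Fin N} (ha : StrictMono a) (z : Fin N → ℂ) :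
    Psi q β z (config a) = PsiComp q β a z := by
  classical
  unfold Psi
  rw [Finset.sum_apply, Finset.sum_eq_single a]
  · simp [ket]
  · intro b hb hba
    rw [Pi.smul_apply, ket, Pi.single_eq_of_ne, smul_zero]
    exact fun h => hba (config_injective (Finset.mem_filter.1 hb).2 ha h.symm)
  · intro h; exact absurd (Finset.mem_filter.2 ⟨Finset.mem_univ _, ha⟩) h

theorem Psi_of_forall_ne {s : Fin N → Fin 2}
    (hs : ∀ a : Fin (nDown N) → Fin N, StrictMono a → config a ≠ s) (z : Fin N → ℂ) :
    Psi q β z s = 0 := by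
  classical
  unfold Psi
  rw [Finset.sum_apply]
  refine Finset.sum_eq_zero fun a ha => ?_
  rw [Pi.smul_apply, ket, Pi.single_eq_of_ne, smul_zero]
  exact (hs a (Finset.mem_filter.1 ha).2).symm

theorem tendsto_psi_apply (h0 : q ≠ 0) (h1 : q ≠ 1) (h2 : q ≠ -1) (hβ : β ≠ 0)
    (s : Fin N → Fin 2) :
    Tendsto (fun z => normFactor N q β * Psi q β z s)
      (𝓝[{z : Fin N → ℂ | Good3 q z}] (fun _ => 1)) (𝓝 (psi N q β s)) :=
  ((isHomLimit_psi h0 h1 h2 hβ).mono_left (nhdsWithin_good3_le N q)).apply_nhds s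

theorem psi_config (h0 : q ≠ 0) (h1 : q ≠ 1) (h2 : q ≠ -1) (hβ : β ≠ 0)
    {a : Fin (nDown N) → Fin N} (ha : StrictMono a) {R : (Fin N → ℂ) × ℂ → ℂ}
    (hc : ContinuousAt R (fun _ => 1, β)) (hR : ∀ z β, Good q z → Phi q β z a = R (z, β)) :
    psi N q β (config a) = normFactor N q β * R (fun _ => 1, β) := by
  have := neBot_nhdsWithin_good3 N h0 h1 h2
  refine tendsto_nhds_unique (tendsto_psi_apply h0 h1 h2 hβ _) ?_
  have h3 : Tendsto (fun z : Fin N → ℂ => R (z, β)) (𝓝 fun _ => 1) (𝓝 (R (fun _ => 1, β))) :=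
    (ContinuousAt.comp (f := fun z : Fin N → ℂ => (z, β)) hc
      (by fun_prop : ContinuousAt (fun z : Fin N → ℂ => (z, β)) fun _ => 1)).tendsto
  refine ((h3.mono_left nhdsWithin_le_nhds).const_mul _).congr' ?_
  filter_upwards [self_mem_nhdsWithin] with z hz
  rw [Psi_config ha, PsiComp_eq_Phi hz.toGood.generic h0 hβ, hR z β hz.toGood]

theorem psi_of_forall_ne (h0 : q ≠ 0) (h1 : q ≠ 1) (h2 : q ≠ -1) (hβ : β ≠ 0)
    {s : Fin N → Fin 2} (hs : ∀ a : Fin (nDown N) → Fin N, StrictMono a → config a ≠ s) :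
    psi N q β s = 0 := by
  have := neBot_nhdsWithin_good3 N h0 h1 h2
  refine tendsto_nhds_unique (tendsto_psi_apply h0 h1 h2 hβ s) ?_
  simp only [Psi_of_forall_ne hs, mul_zero]
  exact tendsto_const_nhds

/-- Each down spin contributes one odd factor [βw], balanced by the power of [β] in the
normalisation. -/
theorem normFactor_neg_mul_Phi_neg (a : Fin (nDown N) → Fin N) (z : Fin N → ℂ) :
    normFactor N q (-β) * Phi q (-β) z a = normFactor N q β * Phi q β z a := by
  have h1 : resSum q z (fun k s => phi q z (a k) (z s) * br (-β * z s)) =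
      (-1) ^ nDown N * resSum q z fun k s => phi q z (a k) (z s) * br (β * z s) := by
    unfold resSum
    rw [Finset.mul_sum]
    refine Finset.sum_congr rfl fun c _ => ?_
    rw [← mul_assoc, ← Fin.prod_const, ← Finset.prod_mul_distrib]
    congr 1
    refine Finset.prod_congr rfl fun k _ => ?_
    beta_reduce
    rw [neg_mul, br_neg]
    ring
  have h2 : ((-1 : ℂ) ^ nDown N)⁻¹ * (-1) ^ nDown N = 1 := inv_mul_cancel₀ (by simp)
  rw [Phi, Phi, h1, normFactor, normFactor, br_neg, neg_pow (br β), mul_inv]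
  linear_combination (-1) ^ (nUp N * (nUp N - 1) / 2) * (br β ^ nDown N)⁻¹ *
    (br q ^ (nDown N * (nDown N - 1) + nUp N * (nUp N - 1)))⁻¹ * br q ^ nDown N * pref q z *
    (resSum q z fun k s => phi q z (a k) (z s) * br (β * z s)) * h2

theorem psi_neg (h0 : q ≠ 0) (hβ : β ≠ 0) : psi N q (-β) = psi N q β := by
  unfold psi limUnder
  congr 1
  refine Filter.map_congr ?_
  filter_upwards [self_mem_nhdsWithin] with z hz
  unfold Psi
  rw [Finset.smul_sum, Finset.smul_sum]
  refine Finset.sum_congr rfl fun a _ => ?_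
  rw [smul_smul, smul_smul, PsiComp_eq_Phi hz h0 hβ, PsiComp_eq_Phi hz h0 (neg_ne_zero.2 hβ),
    normFactor_neg_mul_Phi_neg]

end

/-! ### The two boundary values and the matching of normalisations. -/

theorem Represents.eq_inv_or_eq_neg_inv {q β : ℂ} (h0 : q ≠ 0) (h : Represents q β 0) :
    β = q⁻¹ ∨ β = -q⁻¹ := by
  obtain ⟨hβ, hb, h⟩ := h
  rw [eq_comm, div_eq_zero_iff, neg_eq_zero, or_iff_left hb, br_eq_zero_iff,
    or_iff_right (mul_ne_zero h0 hβ)] at h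
  rcases h with h | h
  · exact Or.inl (eq_inv_of_mul_eq_one_right h)
  · right
    rw [← neg_eq_iff_eq_neg]
    exact eq_inv_of_mul_eq_one_right (by rw [mul_neg, h, neg_neg])

/-- The reason is [qβ] - (q + q⁻¹)[β] = q/β - β/q. -/
theorem Represents.eq_or_eq_neg {q β : ℂ} (h0 : q ≠ 0) (h : Represents q β (tau q)) :
    β = q ∨ β = -q := by
  obtain ⟨hβ, hb, h⟩ := h
  rw [eq_div_iff hb, tau, br, br] at h
  refine sq_eq_sq_iff_eq_or_eq_neg.1 ?_
  field_simp at h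
  linear_combination -h

/-- The normalisations for `N + 1` and `N` sites are compatible. -/
theorem normFactor_succ {q : ℂ} (hq : br q ≠ 0) (N : ℕ) :
    normFactor (N + 1) q q⁻¹ * ((-1) ^ (nDown N * (nDown (N + 1) + 1)) * br q⁻¹ ^ N) =
      normFactor N q q := by
  -- Up and down numbers trade places when a site is added: the up number for N sites is the down
  -- number for N+1.
  obtain ⟨m, n, hm, hn, hu, hu', hN, hnm⟩ : ∃ m n, nDown N = m ∧ nDown (N + 1) = n ∧
      nUp N = n ∧ nUp (N + 1) = m + 1 ∧ N = n + m ∧ (n = m ∨ n = m + 1) :=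
    ⟨_, _, rfl, rfl, rfl, by unfold nUp nDown; omega, by unfold nDown; omega,
      by unfold nDown; omega⟩
  rw [normFactor, normFactor, hm, hn, hu, hu', br_inv, neg_pow (br q) n, neg_pow (br q) N, hN]
  have hs : (-1 : ℂ) ^ ((m + 1) * (m + 1 - 1) / 2) * ((-1) ^ n)⁻¹ *
      ((-1) ^ (m * (n + 1)) * (-1) ^ (n + m)) = (-1) ^ (n * (n - 1) / 2) := by
    have h1 : ((-1 : ℂ) ^ n)⁻¹ = (-1) ^ n := by rw [← inv_pow]; norm_num
    rw [h1, ← pow_add, ← pow_add, ← pow_add]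
    obtain ⟨r, hr⟩ : ∃ r, m * (m + 1) = r + r := Nat.even_mul_succ_self m
    have hr' : (m + 1) * (m + 1 - 1) / 2 = r := by
      rw [Nat.add_sub_cancel, mul_comm, hr]; omega
    rw [hr']
    rcases hnm with rfl | rfl
    · have h2 : r = n * (n - 1) / 2 + n := by
        rcases n with _ | k
        · simpa using hr.symm
        · rw [Nat.add_sub_cancel]
          have : (k + 1) * k = 2 * (r - (k + 1)) := by
            rw [Nat.mul_sub, two_mul, ← hr]
            rw [show (k + 1) * (k + 1 + 1) = (k + 1) * k + 2 * (k + 1) by ring,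
              Nat.add_sub_cancel]
          have h3 : k + 1 ≤ r := by nlinarith
          omega
      have h3 : r + n + (n * (n + 1) + (n + n)) = n * (n - 1) / 2 + 2 * (r + 2 * n) := by
        rw [hr]; omega
      rw [h3, pow_add, pow_mul]
      simp
    · have h3 : r + (m + 1) + (m * (m + 1 + 1) + (m + 1 + m)) = r + 2 * (r + 2 * m + 1) := by
        rw [show m * (m + 1 + 1) = m * (m + 1) + m by ring, hr]; ring
      rw [hr', h3, pow_add, pow_mul]
      simp
  have hp : (br q ^ n)⁻¹ * (br q ^ (n * (n - 1) + (m + 1) * (m + 1 - 1)))⁻¹ * br q ^ (n + m) =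
      (br q ^ m)⁻¹ * (br q ^ (m * (m - 1) + n * (n - 1)))⁻¹ := by
    have h2 : (m + 1) * (m + 1 - 1) = m * (m - 1) + m + m := by
      cases m with
      | zero => rfl
      | succ k => simp only [Nat.add_sub_cancel]; ring
    rw [h2]
    simp only [pow_add]
    field_simp
  rw [mul_inv]
  linear_combination (br q ^ n)⁻¹ * (br q ^ (n * (n - 1) + (m + 1) * (m + 1 - 1)))⁻¹ *
    br q ^ (n + m) * hs + (-1) ^ (n * (n - 1) / 2) * hp

/-! ### The relation between the homogeneous vectors -/

theorem config_eq_iff {n N : ℕ} {a : Fin n → Fin N} {s : Fin N → Fin 2} :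
    config a = s ↔ ∀ i, s i = down ↔ i ∈ Set.range a := by
  have h2 : ∀ x : Fin 2, x ≠ down → x = up := by decide
  have h3 : (up : Fin 2) ≠ down := by decide
  constructor
  · rintro rfl i
    unfold config
    by_cases h : ∃ k, a k = i <;> simp [h]
  · intro h
    funext i
    by_cases hi : s i = down
    · rw [hi]; exact if_pos ((h i).1 hi)
    · rw [h2 _ hi]; exact if_neg fun hk => hi ((h i).2 hk)

theorem exists_strictMono_config_eq {n N : ℕ} {s : Fin N → Fin 2}
    (hs : (Finset.univ.filter fun i => s i = down).card = n) :
    ∃ a : Fin n → Fin N, StrictMono a ∧ config a = s :=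
  ⟨_, (Finset.orderEmbOfFin _ hs).strictMono, config_eq_iff.2 fun i => by
    rw [Finset.range_orderEmbOfFin]; simp⟩

theorem card_filter_config {n N : ℕ} {a : Fin n → Fin N} (ha : StrictMono a) :
    (Finset.univ.filter fun i => config a i = down).card = n := by
  have h := (config_eq_iff (a := a)).1 rfl
  have : (Finset.univ.filter fun i => config a i = down) = Finset.univ.image a := by
    ext i; simp [h]
  rw [this, Finset.card_image_of_injective _ ha.injective, Finset.card_univ, Fintype.card_fin]

theorem Phi_eq_zero_of_mem_range {n N : ℕ} {q : ℂ} {z : Fin (N + 1) → ℂ} (h : Good q z)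
    (hn : 2 * n ≤ N + 1) {a : Fin n → Fin (N + 1)} (ha : StrictMono a)
    (hl : Fin.last N ∈ Set.range a) : Phi q (q * z (Fin.last N))⁻¹ z a = 0 := by
  obtain ⟨k, hk⟩ := hl
  cases n with
  | zero => exact k.elim0
  | succ n =>
    refine Phi_eq_zero_of_last h (by omega) (le_antisymm (Fin.le_last _) ?_)
    rw [← hk]
    exact ha.monotone (Fin.le_last k)

/-- The inhomogeneous identity needs a β that moves with z_last, whereas `psi` has β fixed;
continuity in both arguments identifies the two limits. -/
theorem tendsto_comp_inv_last {N : ℕ} {q : ℂ} (h0 : q ≠ 0)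
    {R : (Fin (N + 1) → ℂ) × ℂ → ℂ} (hR : ContinuousAt R (fun _ => 1, q⁻¹)) :
    Tendsto (fun z : Fin (N + 1) → ℂ => R (z, (q * z (Fin.last N))⁻¹)) (𝓝 fun _ => 1)
      (𝓝 (R (fun _ => 1, q⁻¹))) := by
  have h : ContinuousAt (fun z : Fin (N + 1) → ℂ => (z, (q * z (Fin.last N))⁻¹)) fun _ => 1 :=
    continuousAt_id.prodMk (ContinuousAt.inv₀
      (by fun_prop : Continuous fun z : Fin (N + 1) → ℂ => q * z (Fin.last N)).continuousAt
      (by simpa using h0))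
  have e : ((fun _ => 1 : Fin (N + 1) → ℂ), (q * 1)⁻¹) = (fun _ => 1, q⁻¹) := by rw [mul_one]
  refine Tendsto.comp (f := fun z : Fin (N + 1) → ℂ => (z, (q * z (Fin.last N))⁻¹)) hR ?_
  rw [← e]
  exact h.tendsto

theorem psi_config_eq_zero {N : ℕ} {q : ℂ} (h0 : q ≠ 0) (h1 : q ≠ 1) (h2 : q ≠ -1)
    {a : Fin (nDown (N + 1)) → Fin (N + 1)}
    (ha : StrictMono a) (hl : Fin.last N ∈ Set.range a) : psi (N + 1) q q⁻¹ (config a) = 0 := by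
  obtain ⟨R, hc, hR⟩ := exists_continuousAt_Phi_eq q ha
  have := neBot_nhdsWithin_good3 (N + 1) h0 h1 h2
  have hz : R (fun _ => 1, q⁻¹) = 0 := by
    refine tendsto_nhds_unique ((tendsto_comp_inv_last h0 (hc _ (inv_ne_zero h0))).mono_left
      (nhdsWithin_le_nhds (s := {z | Good3 q z}))) (tendsto_const_nhds.congr' ?_)
    filter_upwards [self_mem_nhdsWithin] with z hz
    rw [← hR _ _ hz.toGood, Phi_eq_zero_of_mem_range hz.toGood (by unfold nDown; omega) ha hl]
  rw [psi_config h0 h1 h2 (inv_ne_zero h0) ha (hc _ (inv_ne_zero h0)) hR, hz, mul_zero]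

/-- Limit of `Phi_castSucc_comp_eq` along `Good3` points: every factor of the prefactor tends to
[q⁻¹], and `normFactor_succ` absorbs the result. -/
theorem psi_succ_config {N : ℕ} {q : ℂ} (h0 : q ≠ 0) (h1 : q ≠ 1) (h2 : q ≠ -1)
    {a : Fin (nDown (N + 1)) → Fin N} (ha : StrictMono a) {b : Fin (nDown N) → Fin N} (hb : StrictMono b)
    (hab : ∀ i, i ∈ Set.range a ↔ i ∉ Set.range b) :
    psi (N + 1) q q⁻¹ (config (Fin.castSucc ∘ a)) = psi N q q (config b) := by
  have ha' : StrictMono (Fin.castSucc ∘ a) := (Fin.strictMono_castSucc).comp ha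
  obtain ⟨R, hc, hR⟩ := exists_continuousAt_Phi_eq q ha'
  obtain ⟨R', hc', hR'⟩ := exists_continuousAt_Phi_eq q hb
  have := neBot_nhdsWithin_good3 (N + 1) h0 h1 h2
  have hz : R (fun _ => 1, q⁻¹) = (-1) ^ (nDown N * (nDown (N + 1) + 1)) * br q⁻¹ ^ N *
      R' (fun _ => 1, q) := by
    refine tendsto_nhds_unique ((tendsto_comp_inv_last h0 (hc _ (inv_ne_zero h0))).mono_left
      (nhdsWithin_le_nhds (s := {z | Good3 q z}))) ?_
    have t1 : Tendsto (fun z : Fin (N + 1) → ℂ =>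
        (-1) ^ (nDown N * (nDown (N + 1) + 1)) *
          (∏ i : Fin N, br ((q * z (Fin.last _))⁻¹ * z i.castSucc)) *
            R' (z ∘ Fin.castSucc, q * z (Fin.last N))) (𝓝 fun _ => 1)
        (𝓝 ((-1) ^ (nDown N * (nDown (N + 1) + 1)) * br q⁻¹ ^ N * R' (fun _ => 1, q))) := by
      refine Tendsto.mul (Tendsto.const_mul _ ?_) ?_
      · rw [← Fin.prod_const]
        refine tendsto_finsetProd _ fun i _ => ?_
        have hcont : ContinuousAt (fun z : Fin (N + 1) → ℂ =>
            br ((q * z (Fin.last _))⁻¹ * z i.castSucc)) fun _ => 1 := by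
          have h3 : ContinuousAt (fun z : Fin (N + 1) → ℂ =>
              (q * z (Fin.last _))⁻¹ * z i.castSucc) fun _ => 1 :=
            (ContinuousAt.inv₀ (by fun_prop : Continuous fun z : Fin (N + 1) → ℂ =>
              q * z (Fin.last N)).continuousAt (by simpa using h0)).mul
                (continuous_apply _).continuousAt
          exact h3.sub (h3.inv₀ (by simpa using h0))
        simpa using hcont.tendsto
      · have h3 : ContinuousAt (fun z : Fin (N + 1) → ℂ =>
            (z ∘ Fin.castSucc, q * z (Fin.last N))) fun _ => 1 := by
          simp only [Function.comp_def]
          fun_prop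
        refine Tendsto.comp (f := fun z : Fin (N + 1) → ℂ =>
          (z ∘ Fin.castSucc, q * z (Fin.last N))) (hc' _ h0) ?_
        have h4 := h3.tendsto
        rw [mul_one] at h4
        exact h4
    refine (t1.mono_left nhdsWithin_le_nhds).congr' ?_
    filter_upwards [self_mem_nhdsWithin] with z hz
    rw [← hR _ _ hz.toGood, ← hR' _ _ (hz.toGood.comp (Fin.castSucc_injective _))]
    have key : ∀ {n m M : ℕ} (_ : M = n + m) (_ : n = m ∨ n = m + 1) {a : Fin n → Fin M}
        (_ : StrictMono a) {b : Fin m → Fin M} (_ : StrictMono b)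
        (_ : ∀ i, i ∈ Set.range a ↔ i ∉ Set.range b) {z : Fin (M + 1) → ℂ} (_ : Good3 q z),
        Phi q (q * z (Fin.last _))⁻¹ z (Fin.castSucc ∘ a) =
          (-1) ^ (m * (n + 1)) * (∏ i : Fin M, br ((q * z (Fin.last _))⁻¹ * z i.castSucc)) *
            Phi q (q * z (Fin.last _)) (z ∘ Fin.castSucc) b := by
      rintro n m M rfl hnm a ha b hb hab z h
      exact Phi_castSucc_comp_eq hnm ha hb hab h
    exact (key (by unfold nDown; omega) (by unfold nDown; omega) ha hb hab hz).symm
  rw [psi_config h0 h1 h2 (inv_ne_zero h0) ha' (hc _ (inv_ne_zero h0)) hR,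
    psi_config h0 h1 h2 h0 hb (hc' _ h0) hR', hz, ← normFactor_succ (br_ne_zero h0 h1 h2)]
  ring

/-- The reversed spin. -/
def flip (x : Fin 2) : Fin 2 := 1 - x

theorem spinReversal_mulVec {N : ℕ} (v : Vec N) (s : Fin N → Fin 2) :
    (spinReversal N).mulVec v s = v (flip ∘ s) := by
  have h : ∀ x y : Fin 2, sigmaX x y = if y = flip x then 1 else 0 := by
    intro x y
    fin_cases x <;> fin_cases y <;> simp [sigmaX, flip]
  simp only [Matrix.mulVec, dotProduct, spinReversal, Matrix.of_apply]
  rw [Finset.sum_eq_single (flip ∘ s)]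
  · rw [Finset.prod_eq_one fun i _ => by simp [h], one_mul]
  · intro t _ ht
    obtain ⟨i, hi⟩ := Function.ne_iff.1 ht
    rw [Finset.prod_eq_zero (Finset.mem_univ i) (by rw [h]; exact if_neg hi), zero_mul]
  · intro hh; exact absurd (Finset.mem_univ _) hh

theorem psi_succ_eq_tmulLast (N : ℕ) {q : ℂ} (h0 : q ≠ 0) (h1 : q ≠ 1) (h2 : q ≠ -1) :
    psi (N + 1) q q⁻¹ = tmulLast ((spinReversal N).mulVec (psi N q q)) ketUp := by
  funext s
  have hud : ∀ x : Fin 2, x ≠ down → x = up := by decide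
  have hflip : ∀ x : Fin 2, flip x = down ↔ x ≠ down := by decide
  rw [tmulLast, spinReversal_mulVec]
  by_cases hl : s (Fin.last N) = down
  · have : ketUp (s (Fin.last N)) = 0 := by rw [hl, ketUp, Pi.single_eq_of_ne (by decide)]
    rw [this, mul_zero]
    by_cases hs : ∃ a : Fin (nDown (N + 1)) → Fin (N + 1), StrictMono a ∧ config a = s
    · obtain ⟨a, ha, rfl⟩ := hs
      exact psi_config_eq_zero h0 h1 h2 ha (((config_eq_iff (a := a)).1 rfl _).1 hl)
    · exact psi_of_forall_ne h0 h1 h2 (inv_ne_zero h0) fun a ha h => hs ⟨a, ha, h⟩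
  · have : ketUp (s (Fin.last N)) = 1 := by rw [hud _ hl, ketUp, Pi.single_eq_same]
    rw [this, mul_one]
    have hcard : (Finset.univ.filter fun i => s i = down).card =
        (Finset.univ.filter fun i => Fin.init s i = down).card := by
      rw [Finset.card_filter, Finset.card_filter, Fin.sum_univ_castSucc, if_neg hl, add_zero]
      rfl
    have hcard' : (Finset.univ.filter fun i => Fin.init s i = down).card +
        (Finset.univ.filter fun i => (flip ∘ Fin.init s) i = down).card = N := by
      simp only [Function.comp_apply, hflip]
      rw [Finset.card_filter_add_card_filter_not, Finset.card_univ, Fintype.card_fin]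
    -- Reversing the first N spins complements the down sites, so s has the right number of down
    -- spins exactly when its reversal does; otherwise both components vanish.
    by_cases hn : (Finset.univ.filter fun i => s i = down).card = nDown (N + 1)
    · obtain ⟨a, ha, has⟩ := exists_strictMono_config_eq (hcard.symm.trans hn)
      obtain ⟨b, hb, hbs⟩ := exists_strictMono_config_eq
        (show (Finset.univ.filter fun i => (flip ∘ Fin.init s) i = down).card = nDown N by
          unfold nDown at hn ⊢; omega)
      rw [config_eq_iff] at has hbs
      have hcs : config (Fin.castSucc ∘ a) = s := by
        refine config_eq_iff.2 fun i => ?_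
        refine Fin.lastCases ?_ (fun j => ?_) i
        · simp only [hl, false_iff, Set.mem_range, Function.comp_apply, not_exists]
          exact fun k => (Fin.castSucc_lt_last _).ne
        · rw [show s j.castSucc = Fin.init s j from rfl, has]
          simp
      rw [← hcs, psi_succ_config h0 h1 h2 ha hb fun i => ?_, hcs, config_eq_iff.2 hbs]
      rw [← has, ← hbs, Function.comp_apply, hflip, not_not]
    · rw [psi_of_forall_ne h0 h1 h2 (inv_ne_zero h0), psi_of_forall_ne h0 h1 h2 h0]
      · rintro b hb hbs
        have := card_filter_config hb
        rw [hbs] at this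
        exact hn (by unfold nDown at this ⊢; omega)
      · rintro a ha rfl
        exact hn (card_filter_config ha)

end XXZ

end

theorem mainTheorem9 (N : ℕ) (hN : 1 ≤ N) (q : ℂ) (hq0 : q ≠ 0) (hq1 : q ≠ 1) (hq2 : q ≠ -1)
    (β β' : ℂ) (hβ : XXZ.Represents q β 0) (hβ' : XXZ.Represents q β' (XXZ.tau q)) :
    XXZ.IsHomLimit (N + 1) q β (XXZ.psi (N + 1) q β) ∧
    XXZ.IsHomLimit N q β' (XXZ.psi N q β') ∧
    XXZ.psi (N + 1) q β =
      XXZ.tmulLast ((XXZ.spinReversal N).mulVec (XXZ.psi N q β')) XXZ.ketUp := by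
  refine ⟨XXZ.isHomLimit_psi hq0 hq1 hq2 hβ.1, XXZ.isHomLimit_psi hq0 hq1 hq2 hβ'.1, ?_⟩
  -- The given β is determined only up to sign, and the sign is immaterial by `psi_neg`.
  have e1 : XXZ.psi (N + 1) q β = XXZ.psi (N + 1) q q⁻¹ := by
    rcases hβ.eq_inv_or_eq_neg_inv hq0 with rfl | rfl
    · rfl
    · exact XXZ.psi_neg hq0 (inv_ne_zero hq0)
  have e2 : XXZ.psi N q β' = XXZ.psi N q q := by
    rcases hβ'.eq_or_eq_neg hq0 with rfl | rfl
    · rfl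
    · exact XXZ.psi_neg hq0 hq0
  rw [e1, e2]
  exact XXZ.psi_succ_eq_tmulLast N hq0 hq1 hq2
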